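/- Let $a,b>0$ and $\Omega=(-a,a)\times(-b,b)\subset\mathbb R^2$ with coordinates $(x,y)$. Let $$X=\Bigl\{w\in H^2(\Omega):\ w_x=0\text{ at }x=\pm a,\ w\text{ is periodic in }y\text{ (the traces of }w\text{ and of }w_y\text{ at }y=b\text{ and }y=-b\text{ agree)},\ \int_\Omega w=0\Bigr\},$$ with the $H^2(\Omega)$-topology. Put $[u,v]=\tfrac12u_{xx}v_{yy}+\tfrac12u_{yy}v_{xx}-u_{xy}v_{xy}$. For $w\in X$ let $\phi,\phi_1\in X$ be the weak solutions of $$\Delta^2\phi=-[w,w]-w_{xx},\qquad \Delta^2\phi_1=-w_{xx},$$ with the natural boundary conditions $(\Delta\phi)_x=(\Delta\phi_1)_x=0$ at $x=\pm a$ and periodicity in $y$; here $\psi\in X$ is a weak solution of $\Delta^2\psi=g$ if $\int_\Omega\Delta\psi\,\Delta f=\int_\Omega g f$ for every $f\in C^\infty(\mathbb R^2)$ that is $2b$-periodic in $y$ and satisfies $f_x=0$ at $x=\pm a$. Define $$\|w\|_X^2=\int_\Omega\bigl((\Delta w)^2+(\Delta\phi_1)^2\bigr),\quad E(w)=\tfrac12\int_\Omega\bigl((\Delta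 w)^2+(\Delta\phi)^2\bigr),\quad S(w)=\tfrac12\int_\Omega w_x^2,\quad F_\lambda(w)=E(w)-\lambda S(w);$$ the norm $\|\cdot\|_X$ is equivalent to the $H^2$-norm on $X$. For $w_2\in X$ and $\mu\in\mathbb R$ let $$\Gamma=\{\gamma\in C([0,1];X):\gamma(0)=0,\ \gamma(1)=w_2\},\qquad c(\mu)=\inf_{\gamma\in\Gamma}\max_{t\in[0,1]}F_\mu(\gamma(t)).$$ Let $\lambda\in(0,2)$, let $w_2\in X$ satisfy $F_\lambda(w_2)<0$, and suppose that the function $c$ (for this fixed $w_2$) is differentiable at $\lambda$. Then there is a sequence $(w_n)$ in $X$ such that 1. $(w_n)$ is bounded in $X$: $\sup_n\|w_n\|_X<\infty$; 2. $F_\lambda$ is Fréchet differentiable at each $w_n$, $F_\lambda'(w_n)\to0$ in the dual space $X'$ of $(X,\|\cdot\|_X)$, and $F_\lambda(w_n)\to c(\lambda)$; 3. there is a sequence of curves $\gamma_n\in\Gamma$ such that $w_n\in\gamma_n([0,1])$ for every $n$ and $\max_{t\in[0,1]}F_\lambda(\gamma_n(t))\to c(\lambda)$. -/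

import Mathlib

open Filter Topology MeasureTheory
open scoped ContDiff

namespace VKD

/-- The rectangle `Ω = (-a, a) × (-b, b)`; the first coordinate `x` is axial, the second
coordinate `y` is tangential. -/
def Omega (a b : ℝ) : Set (ℝ × ℝ) := Set.Ioo (-a) a ×ˢ Set.Ioo (-b) b

/-- Lebesgue measure on `Ω`. -/
noncomputable abbrev mu (a b : ℝ) : Measure (ℝ × ℝ) := volume.restrict (Omega a b)

/-- The real Hilbert space `L²(Ω)`. -/
abbrev L2 (a b : ℝ) : Type := Lp ℝ 2 (mu a b)

/-- The (classical) partial derivative of a function on `ℝ²` in the direction `e`. -/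
noncomputable def pd (e : ℝ × ℝ) (f : ℝ × ℝ → ℝ) : ℝ × ℝ → ℝ := fun p => fderiv ℝ f p e

/-- The direction of `x`. -/
def ex : ℝ × ℝ := (1, 0)

/-- The direction of `y`. -/
def ey : ℝ × ℝ := (0, 1)

/-- `C_c^∞(Ω)`. -/
def TestC (a b : ℝ) : Set (ℝ × ℝ → ℝ) :=
  {f | ContDiff ℝ ∞ f ∧ HasCompactSupport f ∧ tsupport f ⊆ Omega a b}

/-- Smooth functions on `ℝ²` that are `2b`-periodic in `y` (no condition at `x = ±a`). -/
def TestPer (b : ℝ) : Set (ℝ × ℝ → ℝ) :=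
  {f | ContDiff ℝ ∞ f ∧ ∀ x y : ℝ, f (x, y + 2 * b) = f (x, y)}

/-- Smooth functions `f` on `ℝ²` that are `2b`-periodic in `y` and satisfy `f_x = 0` at
`x = ±a`. -/
def TestBC (a b : ℝ) : Set (ℝ × ℝ → ℝ) :=
  {f | f ∈ TestPer b ∧ ∀ y : ℝ, pd ex f (a, y) = 0 ∧ pd ex f (-a, y) = 0}

/-- Integration by parts in the direction `e`, without boundary terms, against all functions of
the class `T`: `∫_Ω g f = - ∫_Ω u ∂_e f` for all `f ∈ T`. -/
def ByParts (a b : ℝ) (T : Set (ℝ × ℝ → ℝ)) (e : ℝ × ℝ) (u g : L2 a b) : Prop :=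
  ∀ f ∈ T, ∫ p in Omega a b, g p * f p = - ∫ p in Omega a b, u p * pd e f p

/-- Names for a function of two variables and its partial derivatives up to order two. -/
inductive Jet : Type
  | o | x | y | xx | xy | yy
  deriving DecidableEq

instance : Fintype Jet where
  elems := {Jet.o, Jet.x, Jet.y, Jet.xx, Jet.xy, Jet.yy}
  complete := by intro k; cases k <;> decide

/-- Six-tuples of `L²(Ω)`-functions with the Hilbert norm
`‖J‖² = ‖J_o‖² + ‖J_x‖² + ‖J_y‖² + ‖J_xx‖² + ‖J_xy‖² + ‖J_yy‖²`. -/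
abbrev JetL2 (a b : ℝ) : Type := PiLp 2 (fun _ : Jet => L2 a b)

/-- `J` consists of an `H²(Ω)`-function `J_o` and its weak partial derivatives up to order two. -/
structure IsH2 (a b : ℝ) (J : JetL2 a b) : Prop where
  o_x : ByParts a b (TestC a b) ex (J Jet.o) (J Jet.x)
  o_y : ByParts a b (TestC a b) ey (J Jet.o) (J Jet.y)
  x_x : ByParts a b (TestC a b) ex (J Jet.x) (J Jet.xx)
  x_y : ByParts a b (TestC a b) ey (J Jet.x) (J Jet.xy)
  y_x : ByParts a b (TestC a b) ex (J Jet.y) (J Jet.xy)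
  y_y : ByParts a b (TestC a b) ey (J Jet.y) (J Jet.yy)

/-- The boundary conditions, in the sense of traces, for `w = J_o` in `H²(Ω)`; each trace
condition is expressed by the vanishing of the corresponding boundary term in Green's formula.

* `per`: the traces of `w` at `y = b` and `y = -b` agree; the boundary term is
  `∫ (w(x,b) - w(x,-b)) f(x,b) dx`;
* `per_y`: the traces of `w_y` at `y = b` and `y = -b` agree (so that `w` is periodic in `y` as
  an `H²`-function);
* `neumann`: `w_x = 0` at `x = ±a`; the boundary term is
  `∫ (w_x(a,y) f(a,y) - w_x(-a,y) f(-a,y)) dy`. -/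
structure IsBC (a b : ℝ) (J : JetL2 a b) : Prop where
  per : ByParts a b (TestPer b) ey (J Jet.o) (J Jet.y)
  per_y : ByParts a b (TestPer b) ey (J Jet.y) (J Jet.yy)
  neumann : ByParts a b (TestPer b) ex (J Jet.x) (J Jet.xx)

lemma TestC.smooth {a b : ℝ} {f : ℝ × ℝ → ℝ} (hf : f ∈ TestC a b) : ContDiff ℝ ∞ f := hf.1

lemma TestPer.smooth {b : ℝ} {f : ℝ × ℝ → ℝ} (hf : f ∈ TestPer b) : ContDiff ℝ ∞ f := hf.1

lemma continuous_pd {f : ℝ × ℝ → ℝ} (hf : ContDiff ℝ ∞ f) (e : ℝ × ℝ) : Continuous (pd e f) :=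
  (hf.continuous_fderiv (by simp)).clm_apply continuous_const

instance (a b : ℝ) : IsFiniteMeasure (mu a b) := by
  refine ⟨?_⟩
  rw [Measure.restrict_apply_univ]
  exact ((Metric.isBounded_Ioo _ _).prod (Metric.isBounded_Ioo _ _)).measure_lt_top

lemma integrable_mul_cont {a b : ℝ} (u : L2 a b) {f : ℝ × ℝ → ℝ} (hf : Continuous f) :
    Integrable (fun p => u p * f p) (mu a b) := by
  have hc : IsCompact (Set.Icc (-a) a ×ˢ Set.Icc (-b) b) := isCompact_Icc.prod isCompact_Icc
  obtain ⟨C, hC⟩ := hc.exists_bound_of_continuousOn hf.continuousOn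
  have hu : Integrable (u : ℝ × ℝ → ℝ) (mu a b) := (Lp.memLp u).integrable (by norm_num)
  refine hu.mul_bdd (c := C) hf.aestronglyMeasurable ?_
  refine (ae_restrict_iff' (measurableSet_Ioo.prod measurableSet_Ioo)).2 (Eventually.of_forall ?_)
  intro p hp
  exact hC p ⟨Set.Ioo_subset_Icc_self hp.1, Set.Ioo_subset_Icc_self hp.2⟩

lemma integral_add_mul {a b : ℝ} (u v : L2 a b) {f : ℝ × ℝ → ℝ} (hf : Continuous f) :
    ∫ p in Omega a b, (u + v : L2 a b) p * f p
      = (∫ p in Omega a b, u p * f p) + ∫ p in Omega a b, v p * f p := by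
  rw [← integral_add (integrable_mul_cont u hf) (integrable_mul_cont v hf)]
  refine integral_congr_ae ?_
  filter_upwards [Lp.coeFn_add u v] with p hp
  rw [hp, Pi.add_apply, add_mul]

lemma integral_smul_mul {a b : ℝ} (r : ℝ) (u : L2 a b) (f : ℝ × ℝ → ℝ) :
    ∫ p in Omega a b, (r • u : L2 a b) p * f p = r * ∫ p in Omega a b, u p * f p := by
  rw [← integral_const_mul]
  refine integral_congr_ae ?_
  filter_upwards [Lp.coeFn_smul r u] with p hp
  rw [hp, Pi.smul_apply, smul_eq_mul, mul_assoc]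

lemma ByParts.add {a b : ℝ} {T : Set (ℝ × ℝ → ℝ)} {e : ℝ × ℝ} {u g v h : L2 a b}
    (hT : ∀ f ∈ T, ContDiff ℝ ∞ f) (h1 : ByParts a b T e u g) (h2 : ByParts a b T e v h) :
    ByParts a b T e (u + v) (g + h) := by
  intro f hf
  rw [integral_add_mul _ _ (hT f hf).continuous, integral_add_mul _ _ (continuous_pd (hT f hf) e),
    h1 f hf, h2 f hf]
  ring

lemma ByParts.smul {a b : ℝ} {T : Set (ℝ × ℝ → ℝ)} {e : ℝ × ℝ} {u g : L2 a b}
    (r : ℝ) (h1 : ByParts a b T e u g) : ByParts a b T e (r • u) (r • g) := by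
  intro f hf
  rw [integral_smul_mul, integral_smul_mul, h1 f hf]
  ring

lemma ByParts.zero {a b : ℝ} {T : Set (ℝ × ℝ → ℝ)} {e : ℝ × ℝ} :
    ByParts a b T e (0 : L2 a b) 0 := by
  intro f _
  have h := integral_smul_mul (a := a) (b := b) 0 0 f
  have h' := integral_smul_mul (a := a) (b := b) 0 0 (pd e f)
  simp only [zero_smul, zero_mul] at h h'
  rw [h, h', neg_zero]

/-- The space `X` of all `w ∈ H²(Ω)` with `w_x = 0` at `x = ±a`, `w` periodic in `y`, and
`∫_Ω w = 0`. An element is stored together with its weak derivatives, which it determines; the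
inherited topology is that of the `H²(Ω)`-norm. -/
noncomputable def X (a b : ℝ) : Submodule ℝ (JetL2 a b) where
  carrier := {J | IsH2 a b J ∧ IsBC a b J ∧ ∫ p in Omega a b, J Jet.o p = 0}
  add_mem' := by
    rintro J K ⟨hJ, hJ', hJ0⟩ ⟨hK, hK', hK0⟩
    refine ⟨⟨?_, ?_, ?_, ?_, ?_, ?_⟩, ⟨?_, ?_, ?_⟩, ?_⟩
    · exact ByParts.add (fun _ => TestC.smooth) hJ.o_x hK.o_x
    · exact ByParts.add (fun _ => TestC.smooth) hJ.o_y hK.o_y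
    · exact ByParts.add (fun _ => TestC.smooth) hJ.x_x hK.x_x
    · exact ByParts.add (fun _ => TestC.smooth) hJ.x_y hK.x_y
    · exact ByParts.add (fun _ => TestC.smooth) hJ.y_x hK.y_x
    · exact ByParts.add (fun _ => TestC.smooth) hJ.y_y hK.y_y
    · exact ByParts.add (fun _ => TestPer.smooth) hJ'.per hK'.per
    · exact ByParts.add (fun _ => TestPer.smooth) hJ'.per_y hK'.per_y
    · exact ByParts.add (fun _ => TestPer.smooth) hJ'.neumann hK'.neumann
    · have h := integral_add_mul (J Jet.o) (K Jet.o) (f := fun _ => 1) continuous_const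
      simp only [mul_one] at h
      rw [PiLp.add_apply, h, hJ0, hK0, add_zero]
  zero_mem' := by
    refine ⟨⟨?_, ?_, ?_, ?_, ?_, ?_⟩, ⟨?_, ?_, ?_⟩, ?_⟩
    iterate 9 exact ByParts.zero
    have h := integral_smul_mul (a := a) (b := b) 0 0 (fun _ => 1)
    simp only [zero_smul, zero_mul, mul_one] at h
    exact h
  smul_mem' := by
    rintro r J ⟨hJ, hJ', hJ0⟩
    refine ⟨⟨?_, ?_, ?_, ?_, ?_, ?_⟩, ⟨?_, ?_, ?_⟩, ?_⟩
    · exact hJ.o_x.smul r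
    · exact hJ.o_y.smul r
    · exact hJ.x_x.smul r
    · exact hJ.x_y.smul r
    · exact hJ.y_x.smul r
    · exact hJ.y_y.smul r
    · exact hJ'.per.smul r
    · exact hJ'.per_y.smul r
    · exact hJ'.neumann.smul r
    · have h := integral_smul_mul r (J Jet.o) (fun _ => 1)
      simp only [mul_one] at h
      rw [PiLp.smul_apply, h, hJ0, mul_zero]

variable {a b : ℝ}

/-- The partial derivative of `w ∈ X` named by `k`, as a function on `Ω`. -/
noncomputable def D (k : Jet) (w : X a b) : ℝ × ℝ → ℝ := (w : JetL2 a b) k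

/-- The Laplacian `Δw = w_xx + w_yy` of `w ∈ X`. -/
noncomputable def lap (w : X a b) : ℝ × ℝ → ℝ := fun p => D Jet.xx w p + D Jet.yy w p

/-- The bracket `[u,v] = ½ u_xx v_yy + ½ u_yy v_xx - u_xy v_xy`. -/
noncomputable def bracket (u v : X a b) : ℝ × ℝ → ℝ := fun p =>
  1 / 2 * D Jet.xx u p * D Jet.yy v p + 1 / 2 * D Jet.yy u p * D Jet.xx v p
    - D Jet.xy u p * D Jet.xy v p

/-- `φ ∈ X` is the weak solution of `Δ²φ = g` with `φ` periodic in `y`,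
`φ_x = (Δφ)_x = 0` at `x = ±a` and `∫_Ω φ = 0`. The conditions on `φ` and `φ_x` and the mean are
part of `φ ∈ X`; the condition on `(Δφ)_x` is the natural boundary condition of the weak form
`∫_Ω Δφ Δf = ∫_Ω g f`. -/
def SolvesBiharmonic (g : ℝ × ℝ → ℝ) (φ : X a b) : Prop :=
  ∀ f ∈ TestBC a b,
    ∫ p in Omega a b, lap φ p * (pd ex (pd ex f) p + pd ey (pd ey f) p)
      = ∫ p in Omega a b, g p * f p

/-- The solution `φ ∈ X` of `Δ²φ = g` (with the boundary conditions above). -/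
noncomputable def solveBiharmonic (a b : ℝ) (g : ℝ × ℝ → ℝ) : X a b :=
  Classical.epsilon (fun φ : X a b => SolvesBiharmonic g φ)

/-- `φ₁`, the solution of `Δ²φ₁ = -w_xx`. -/
noncomputable def phi1 (w : X a b) : X a b := solveBiharmonic a b (fun p => - D Jet.xx w p)

/-- The Airy stress function `φ` of `w`, the solution of `Δ²φ + [w,w] + w_xx = 0`. -/
noncomputable def phi (w : X a b) : X a b :=
  solveBiharmonic a b (fun p => - bracket w w p - D Jet.xx w p)

/-- The norm `‖w‖_X = (∫_Ω (Δw)² + (Δφ₁)²)^{1/2}`; it is equivalent to the `H²`-norm on `X`. -/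
noncomputable def normX (w : X a b) : ℝ :=
  Real.sqrt (∫ p in Omega a b, (lap w p ^ 2 + lap (phi1 w) p ^ 2))

/-- The stored energy `E(w) = ½ ∫_Ω ((Δw)² + (Δφ)²)`. -/
noncomputable def E (w : X a b) : ℝ :=
  1 / 2 * ∫ p in Omega a b, (lap w p ^ 2 + lap (phi w) p ^ 2)

/-- The average axial shortening `S(w) = ½ ∫_Ω w_x²`. -/
noncomputable def S (w : X a b) : ℝ := 1 / 2 * ∫ p in Omega a b, D Jet.x w p ^ 2

/-- The total potential `F_lam(w) = E(w) - lam S(w)`. -/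
noncomputable def F (lam : ℝ) (w : X a b) : ℝ := E w - lam * S w

/-- The mountain-pass level `c(lam) = inf_γ max_t F_lam(γ(t))` over all continuous paths
`γ : [0,1] → X` from `0` to `w₂`. -/
noncomputable def c (w₂ : X a b) (lam : ℝ) : ℝ :=
  ⨅ γ : Path (0 : X a b) w₂, ⨆ t : unitInterval, F lam (γ t)

end VKD

/-! The core is Struwe's monotonicity trick, `exists_almost_critical`. Write c for the mountain-pass
level. Differentiability at λ gives c(λ - h) ≤ c(λ) + Kh for small h > 0. Take a path that is
optimal up to h for F_{λ-h}. Since S ≥ 0, F_λ stays below c(λ) + (K+1)h along it. Where F_λ is at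
least c(λ) - h, the difference F_{λ-h} - F_λ = hS is at most (K+2)h. Hence S ≤ K+2 there, so E is
bounded, and so is the norm, independently of h. If the gradient of F_λ had norm at least ε at all
these points, one gradient step, switched off at low levels, would push the whole path below c(λ) -
h/2, contradicting the definition of c(λ). A single step can replace a flow because F_λ has a
quadratic upper bound that is uniform on balls.

To apply this to the shell energy, F_λ is shown to be a polynomial of degree four on the Hilbert
space X (`F_eq_quartic`). By `phi_eq`, φ = -(Q(w,w) + Lw) with Q bounded bilinear and L bounded
linear; smoothness and the quadratic bound follow (`contDiff_quartic`, `quartic_le`). Coercivity of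
E comes from E ≥ ½‖Δw‖² and the fact that Δ controls the H²-norm on X (`exists_norm_le_lap`).

The linear theory is Fourier analysis on the rectangle: cosines in x (sines after one x-derivative)
times Hartley functions cos + sin in y. The boundary conditions are exactly what lets derivatives
pass to coefficients, so each derivative becomes a multiplier. Parseval then gives the estimate for
Δ, the identity ∫ w_xx w_yy = ∫ w_xy², and the embedding of X into L^∞ (`exists_ae_bound`). The
embedding is needed because the bracket is only in L¹: it must define a bounded functional on X
before Lax–Milgram yields φ. Uniqueness follows by testing with the modes
(`solvesBiharmonic_unique`). -/

namespace VKD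

/-! ### Mountain-pass levels of a one-parameter family -/

section MountainPass

variable {H : Type*} [NormedAddCommGroup H]

/-- The mountain-pass level of the family `μ ↦ E - μ S`. -/
noncomputable def mpLevel (E S : H → ℝ) (w₂ : H) (μ : ℝ) : ℝ :=
  ⨅ γ : Path (0 : H) w₂, ⨆ t : unitInterval, (E (γ t) - μ * S (γ t))

lemma bddAbove_along_path {H : Type*} [TopologicalSpace H] {G : H → ℝ} (hG : Continuous G) {w₁ w₂ : H} (γ : Path w₁ w₂) :
    BddAbove (Set.range fun t : unitInterval => G (γ t)) :=
  (isCompact_range (hG.comp γ.continuous)).bddAbove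

/-- All paths share their starting point, so every maximum is at least the value there. Without such
a bound the real infimum would be a junk value. -/
lemma bddBelow_iSup_path {H : Type*} [TopologicalSpace H] {G : H → ℝ} (hG : Continuous G) (w₁ w₂ : H) :
    BddBelow (Set.range fun γ : Path w₁ w₂ => ⨆ t : unitInterval, G (γ t)) := by
  refine ⟨G w₁, ?_⟩
  rintro _ ⟨γ, rfl⟩
  simpa using le_ciSup (bddAbove_along_path hG γ) 0

lemma mpLevel_le {E S : H → ℝ} (hE : Continuous E) (hS : Continuous S) {w₂ : H} {μ M : ℝ}
    (γ : Path (0 : H) w₂) (h : ∀ t, E (γ t) - μ * S (γ t) ≤ M) : mpLevel E S w₂ μ ≤ M :=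
  (ciInf_le (bddBelow_iSup_path (G := fun w => E w - μ * S w) (by fun_prop) 0 w₂) γ).trans
    (ciSup_le h)

lemma exists_path_of_mpLevel_lt [NormedSpace ℝ H] {E S : H → ℝ} (hE : Continuous E) (hS : Continuous S) {w₂ : H}
    {μ M : ℝ} (h : mpLevel E S w₂ μ < M) :
    ∃ γ : Path (0 : H) w₂, ∀ t, E (γ t) - μ * S (γ t) < M := by
  have : Nonempty (Path (0 : H) w₂) := ⟨PathConnectedSpace.somePath 0 w₂⟩
  obtain ⟨γ, hγ⟩ := exists_lt_of_ciInf_lt h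
  exact ⟨γ, fun t => (le_ciSup
    (bddAbove_along_path (G := fun w => E w - μ * S w) (by fun_prop) γ) t).trans_lt hγ⟩

lemma mpLevel_nonneg [NormedSpace ℝ H] {E S : H → ℝ} (hE : Continuous E) (hS : Continuous S) (hE0 : E 0 = 0)
    (hS0 : S 0 = 0) (w₂ : H) (μ : ℝ) : 0 ≤ mpLevel E S w₂ μ := by
  by_contra! h
  obtain ⟨γ, hγ⟩ := exists_path_of_mpLevel_lt hE hS h
  simpa [hE0, hS0] using hγ 0

end MountainPass

/-! ### Gradient steps and the monotonicity trick -/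

section Deformation

variable {H : Type*} [NormedAddCommGroup H] [InnerProductSpace ℝ H] [CompleteSpace H]

/-- The gradient of `G`, shortened to norm at most one. -/
noncomputable def gradStep (G : H → ℝ) (w : H) : H :=
  (max 1 ‖fderiv ℝ G w‖)⁻¹ • (InnerProductSpace.toDual ℝ H).symm (fderiv ℝ G w)

lemma continuous_gradStep {G : H → ℝ} (hG : ContDiff ℝ 1 G) : Continuous (gradStep G) := by
  have h1 : Continuous (fderiv ℝ G) := hG.continuous_fderiv (by simp)
  unfold gradStep
  refine Continuous.smul (Continuous.inv₀ (by fun_prop) fun w => ?_) (by fun_prop)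
  have : (1 : ℝ) ≤ max 1 ‖fderiv ℝ G w‖ := le_max_left _ _
  positivity

lemma norm_gradStep_le (G : H → ℝ) (w : H) : ‖gradStep G w‖ ≤ 1 := by
  have h1 : (0 : ℝ) < max 1 ‖fderiv ℝ G w‖ := lt_max_of_lt_left one_pos
  rw [gradStep, norm_smul, LinearIsometryEquiv.norm_map, norm_inv, Real.norm_of_nonneg h1.le,
    inv_mul_le_iff₀ h1, mul_one]
  exact le_max_right _ _

lemma fderiv_gradStep (G : H → ℝ) (w : H) :
    fderiv ℝ G w (gradStep G w) = (max 1 ‖fderiv ℝ G w‖)⁻¹ * ‖fderiv ℝ G w‖ ^ 2 := by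
  rw [gradStep, map_smul, smul_eq_mul]
  congr 1
  have := InnerProductSpace.toDual_symm_apply (𝕜 := ℝ) (y := fderiv ℝ G w)
    (x := (InnerProductSpace.toDual ℝ H).symm (fderiv ℝ G w))
  rw [← this, real_inner_self_eq_norm_sq, LinearIsometryEquiv.norm_map]

/-- Dividing by the maximum twice instead of once only helps, since it is at least one. This is what
lets the first-order gain absorb the quadratic error of a step. -/
lemma norm_gradStep_sq_le (G : H → ℝ) (w : H) :
    ‖gradStep G w‖ ^ 2 ≤ fderiv ℝ G w (gradStep G w) := by
  have h1 : (1 : ℝ) ≤ max 1 ‖fderiv ℝ G w‖ := le_max_left _ _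
  rw [fderiv_gradStep, gradStep, norm_smul, LinearIsometryEquiv.norm_map, norm_inv,
    Real.norm_of_nonneg (by linarith), mul_pow]
  refine mul_le_mul_of_nonneg_right ?_ (by positivity)
  exact pow_le_of_le_one (by positivity) (inv_le_one_of_one_le₀ h1) (by norm_num)

/-- The slope along the truncated gradient is the squared gradient norm when that norm is at most
one, and the norm itself otherwise. -/
lemma min_le_fderiv_gradStep {G : H → ℝ} {w : H} {ε : ℝ} (hε : 0 ≤ ε)
    (h : ε ≤ ‖fderiv ℝ G w‖) : min 1 (ε ^ 2) ≤ fderiv ℝ G w (gradStep G w) := by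
  rw [fderiv_gradStep]
  rcases le_total ‖fderiv ℝ G w‖ 1 with h1 | h1
  · rw [max_eq_left h1, inv_one, one_mul]
    exact (min_le_right _ _).trans (by gcongr)
  · rw [max_eq_right h1]
    refine (min_le_left _ _).trans ?_
    rw [sq, ← mul_assoc, inv_mul_cancel₀ (by linarith), one_mul]
    exact h1

/-- A gradient step of relative length `s ≤ 1 / (2C)` decreases `G`. -/
lemma step_decrease {G : H → ℝ} {w : H} {C s : ℝ} (hC : 1 ≤ C) (hs : 0 ≤ s)
    (hsC : s * (2 * C) ≤ 1)
    (hq : ∀ h, ‖h‖ ≤ 1 → G (w + h) ≤ G w + fderiv ℝ G w h + C * ‖h‖ ^ 2) :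
    G (w - s • gradStep G w) ≤ G w - s / 2 * fderiv ℝ G w (gradStep G w) := by
  have h1 : ‖-(s • gradStep G w)‖ ≤ 1 := by
    rw [norm_neg, norm_smul, Real.norm_of_nonneg hs]
    exact mul_le_one₀ (by nlinarith) (norm_nonneg _) (norm_gradStep_le G w)
  have h2 := hq _ h1
  rw [← sub_eq_add_neg, map_neg, map_smul, norm_neg, norm_smul, Real.norm_of_nonneg hs,
    smul_eq_mul, mul_pow] at h2
  have h3 := norm_gradStep_sq_le G w
  -- Since 2Cs ≤ 1, the quadratic error costs at most half of the first-order gain.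
  have h4 : C * (s ^ 2 * ‖gradStep G w‖ ^ 2) ≤ s / 2 * fderiv ℝ G w (gradStep G w) := by
    calc C * (s ^ 2 * ‖gradStep G w‖ ^ 2) = (s / 2) * ((s * (2 * C)) * ‖gradStep G w‖ ^ 2) := by
          ring
      _ ≤ s / 2 * (1 * ‖gradStep G w‖ ^ 2) := by gcongr
      _ ≤ _ := by rw [one_mul]; gcongr
  linarith

/-- This one-sided linear bound is all that the monotonicity trick takes from differentiability of
the level. -/
lemma exists_bound_left_of_differentiableAt {f : ℝ → ℝ} {x : ℝ} (hf : DifferentiableAt ℝ f x) :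
    ∃ K : ℝ, 0 ≤ K ∧ ∀ᶠ h in 𝓝[>] (0 : ℝ), f (x - h) ≤ f x + K * h := by
  obtain ⟨K, hK⟩ := hf.hasDerivAt.isBigO_sub.bound
  refine ⟨|K|, abs_nonneg _, ?_⟩
  have ht : Tendsto (fun h : ℝ => x - h) (𝓝[>] 0) (𝓝 x) := by
    have : Tendsto (fun h : ℝ => x - h) (𝓝 0) (𝓝 (x - 0)) := by
      exact (continuous_const.sub continuous_id).tendsto 0
    rw [sub_zero] at this
    exact this.mono_left nhdsWithin_le_nhds
  filter_upwards [ht.eventually hK, self_mem_nhdsWithin] with h hh hpos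
  have hpos' : (0 : ℝ) < h := hpos
  have e : x - h - x = -h := by ring
  rw [e, norm_neg, Real.norm_of_nonneg hpos'.le, Real.norm_eq_abs] at hh
  have := le_abs_self (f (x - h) - f x)
  have : K * h ≤ |K| * h := by gcongr; exact le_abs_self K
  linarith

/-- Struwe's monotonicity trick: where the mountain-pass level of `μ ↦ E - μ S` is
differentiable, there are bounded almost critical points at that level on almost optimal paths. -/
theorem exists_almost_critical {E S : H → ℝ} {lam : ℝ} {w₂ : H}
    (hE : Continuous E) (hS : Continuous S) (hSnn : ∀ w, 0 ≤ S w)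
    (hE0 : E 0 = 0) (hS0 : S 0 = 0)
    (hbdd : ∀ M, ∃ R, ∀ w, E w ≤ M → ‖w‖ ≤ R)
    (hF : ContDiff ℝ 1 fun w => E w - lam * S w)
    (hF0 : fderiv ℝ (fun w => E w - lam * S w) 0 = 0)
    (hquad : ∀ R, ∃ C, ∀ w, ‖w‖ ≤ R → ∀ h, ‖h‖ ≤ 1 →
      E (w + h) - lam * S (w + h) ≤ E w - lam * S w
        + fderiv ℝ (fun w => E w - lam * S w) w h + C * ‖h‖ ^ 2)
    (hw₂ : E w₂ - lam * S w₂ ≤ 0)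
    (hc : DifferentiableAt ℝ (mpLevel E S w₂) lam) :
    ∃ R, ∀ ε > 0, ∃ (w : H) (γ : Path (0 : H) w₂), ‖w‖ ≤ R ∧
      ‖fderiv ℝ (fun w => E w - lam * S w) w‖ ≤ ε ∧
      |E w - lam * S w - mpLevel E S w₂ lam| ≤ ε ∧ w ∈ Set.range γ ∧
      ∀ t, E (γ t) - lam * S (γ t) ≤ mpLevel E S w₂ lam + ε := by
  set F : H → ℝ := fun w => E w - lam * S w with hFdef
  set c := mpLevel E S w₂ lam with hcdef
  have hFc : Continuous F := hF.continuous
  -- At level zero the deformation could not keep the endpoint 0 fixed. There the origin itself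
  -- serves: it is critical, has value zero and lies on every path.
  rcases (mpLevel_nonneg hE hS hE0 hS0 w₂ lam).eq_or_lt with hc0 | hc0
  · refine ⟨0, fun ε hε => ?_⟩
    obtain ⟨γ, hγ⟩ := exists_path_of_mpLevel_lt hE hS (μ := lam) (w₂ := w₂) (M := c + ε)
      (by linarith)
    refine ⟨0, γ, by simp, ?_, ?_, ⟨0, γ.source⟩, fun t => (hγ t).le⟩
    · rw [hF0, norm_zero]; exact hε.le
    · rw [hE0, hS0, hcdef, ← hc0]; simpa using hε.le
  obtain ⟨K, hK0, hK⟩ := exists_bound_left_of_differentiableAt hc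
  -- This bounds E wherever F ≤ c + K + 1 and S ≤ K + 2. It is fixed before ε, so R is uniform.
  obtain ⟨R, hR⟩ := hbdd (c + K + 1 + |lam| * (K + 2))
  obtain ⟨C₀, hC₀⟩ := hquad R
  refine ⟨R, fun ε hε => ?_⟩
  by_contra hcon
  push Not at hcon
  set C := max C₀ 1
  have hC1 : 1 ≤ C := le_max_right _ _
  -- The longest step allowed by `step_decrease`; below, `e` is the slope guaranteed where the
  -- gradient norm is at least ε.
  set ρ : ℝ := (2 * C)⁻¹ with hρ
  have hρ0 : 0 < ρ := by positivity
  set e : ℝ := min 1 (ε ^ 2)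
  have he : 0 < e := lt_min one_pos (by positivity)
  -- The last three conditions keep the path within ε above c, put both endpoints below level c - h,
  -- and let one full step drop from c + (K+1)h to c - h.
  obtain ⟨h, hKh, hpos, hh1, hhε, hhc, hhd⟩ : ∃ h : ℝ, mpLevel E S w₂ (lam - h) ≤ c + K * h ∧
      0 < h ∧ h ≤ 1 ∧ (K + 1) * h ≤ ε ∧ h < c ∧ (K + 2) * h ≤ ρ * e / 2 := by
    have small : ∀ A B : ℝ, 0 < B → ∀ᶠ h in 𝓝[>] (0 : ℝ), A * h < B := by
      intro A B hB
      have : Tendsto (fun h : ℝ => A * h) (𝓝 0) (𝓝 (A * 0)) :=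
        (continuous_const.mul continuous_id).tendsto 0
      rw [mul_zero] at this
      exact (this.mono_left nhdsWithin_le_nhds).eventually (gt_mem_nhds hB)
    have hIoi : ∀ᶠ h in 𝓝[>] (0 : ℝ), 0 < h := self_mem_nhdsWithin
    have hall := hK.and (hIoi.and
      ((small 1 1 one_pos).and ((small (K + 1) ε hε).and ((small 1 c hc0).and
        (small (K + 2) (ρ * e / 2) (by positivity))))))
    obtain ⟨h, h1, h2, h3, h4, h5, h6⟩ := hall.exists
    exact ⟨h, h1, h2, by linarith, h4.le, by linarith, h6.le⟩
  obtain ⟨γ, hγ⟩ := exists_path_of_mpLevel_lt hE hS (μ := lam - h) (w₂ := w₂)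
    (M := c + K * h + h) (by linarith)
  have hγF : ∀ t, F (γ t) ≤ c + (K + 1) * h := fun t => by
    have := hγ t
    have := mul_nonneg hpos.le (hSnn (γ t))
    simp only [hFdef]
    nlinarith
  have hnear : ∀ t, c - h ≤ F (γ t) → ‖γ t‖ ≤ R ∧ ε ≤ ‖fderiv ℝ F (γ t)‖ := by
    intro t ht
    -- The functionals at `lam - h` and `lam` differ by h S; one is below c + (K+1)h and the other
    -- is at least c - h.
    have hS1 : S (γ t) ≤ K + 2 := by
      have h1 := hγ t
      simp only [hFdef] at ht
      have : h * S (γ t) ≤ h * (K + 2) := by nlinarith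
      exact le_of_mul_le_mul_left this hpos
    have hR1 : ‖γ t‖ ≤ R := by
      apply hR
      have h1 := hγF t
      simp only [hFdef] at h1
      have h2 : lam * S (γ t) ≤ |lam| * (K + 2) :=
        mul_le_mul (le_abs_self _) hS1 (hSnn _) (abs_nonneg _)
      nlinarith
    refine ⟨hR1, ?_⟩
    by_contra! hlt
    -- With a small gradient, `γ t` would meet every requirement, so the negated claim could fail
    -- only through a high point on `γ`; `hγF` excludes that.
    obtain ⟨s, hs⟩ := hcon (γ t) γ hR1 hlt.le (by
      rw [abs_le]
      have := hγF t
      simp only [hFdef] at this ht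
      constructor <;> nlinarith) ⟨t, rfl⟩
    have := hγF s
    simp only [hFdef] at this
    linarith
  -- Cutoff by level: no motion below c - h, full motion above c - h/2.
  set θ : H → ℝ := fun w => max 0 (min 1 ((F w - (c - h)) / (h / 2))) with hθ
  have hθc : Continuous θ := by fun_prop
  have hθ0 : ∀ w, 0 ≤ θ w := fun w => le_max_left _ _
  have hθ1 : ∀ w, θ w ≤ 1 := fun w => max_le zero_le_one (min_le_left _ _)
  have hθlow : ∀ w, F w ≤ c - h → θ w = 0 := fun w hw => by
    refine max_eq_left ((min_le_right _ _).trans ?_)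
    exact div_nonpos_of_nonpos_of_nonneg (by linarith) (by linarith)
  have hθhigh : ∀ w, c - h / 2 ≤ F w → θ w = 1 := fun w hw => by
    have : 1 ≤ (F w - (c - h)) / (h / 2) := by
      rw [le_div_iff₀ (by linarith)]; linarith
    simp only [hθ]
    rw [min_eq_left this]; simp
  set T : H → H := fun w => w - (θ w * ρ) • gradStep F w with hT
  have hTc : Continuous T := by
    have := continuous_gradStep hF
    fun_prop
  have hTfix : ∀ w, F w ≤ c - h → T w = w := fun w hw => by
    simp only [hT, hθlow w hw, zero_mul, zero_smul, sub_zero]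
  have hF00 : F 0 = 0 := by simp [hFdef, hE0, hS0]
  -- Both endpoints have value at most 0 < c - h, so the deformation does not move them.
  let γ' : Path (0 : H) w₂ := (γ.map hTc).cast (hTfix 0 (by linarith)).symm
    (hTfix w₂ (by simp only [hFdef]; linarith)).symm
  have hγ' : ∀ t, F (γ' t) ≤ c - h / 2 := by
    intro t
    change F (T (γ t)) ≤ _
    rcases le_or_gt (F (γ t)) (c - h) with hlow | hlow
    · rw [hTfix _ hlow]; linarith
    obtain ⟨hnR, hgr⟩ := hnear t hlow.le
    have hstep := step_decrease (G := F) (w := γ t) (C := C) (s := θ (γ t) * ρ) hC1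
      (mul_nonneg (hθ0 _) hρ0.le) (by
        rw [mul_assoc, hρ, inv_mul_cancel₀ (by positivity), mul_one]; exact hθ1 _)
      (fun k hk => (hC₀ (γ t) hnR k hk).trans (by gcongr; exact le_max_left _ _))
    have hdec := min_le_fderiv_gradStep hε.le hgr
    have hθρ : 0 ≤ θ (γ t) * ρ / 2 := by have := hθ0 (γ t); positivity
    rcases le_or_gt (c - h / 2) (F (γ t)) with hhi | hhi
    · rw [hθhigh _ hhi] at hstep
      have h1 := hγF t
      have h2 : 1 * ρ / 2 * e ≤ 1 * ρ / 2 * fderiv ℝ F (γ t) (gradStep F (γ t)) := by gcongr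
      simp only [hT, hθhigh _ hhi]
      nlinarith
    -- Between the two levels a partial step suffices, since it cannot raise the value above c -
    -- h/2.
    · have h2 : 0 ≤ θ (γ t) * ρ / 2 * fderiv ℝ F (γ t) (gradStep F (γ t)) :=
        mul_nonneg hθρ (he.le.trans hdec)
      simp only [hT]
      linarith
  have := mpLevel_le hE hS γ' hγ'
  linarith

end Deformation

/-! ### Completeness of cosine, sine and Hartley systems in L¹ -/

section Completeness

/-- Powers of a continuous injective function are complete in `L¹` of an interval. -/
lemma ae_eq_zero_of_integral_mul_pow {p q : ℝ} {g t : ℝ → ℝ}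
    (hg : IntegrableOn g (Set.Ioo p q)) (ht : Continuous t) (hinj : Set.InjOn t (Set.Icc p q))
    (h : ∀ j : ℕ, ∫ x in Set.Ioo p q, g x * t x ^ j = 0) :
    ∀ᵐ x ∂(volume.restrict (Set.Ioo p q)), g x = 0 := by
  let τ : C(Set.Icc p q, ℝ) := ⟨fun x => t x, by fun_prop⟩
  have hpoly : ∀ P : Polynomial ℝ, ∫ x in Set.Ioo p q, g x * P.eval (t x) = 0 := by
    intro P
    have e : ∀ x, g x * P.eval (t x) = P.sum fun j r => r * (g x * t x ^ j) := by
      intro x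
      rw [Polynomial.eval_eq_sum, Polynomial.sum_def, Polynomial.sum_def, Finset.mul_sum]
      exact Finset.sum_congr rfl fun j _ => by ring
    have hint : ∀ j : ℕ, Integrable (fun x => g x * t x ^ j) (volume.restrict (Set.Ioo p q)) := by
      intro j
      obtain ⟨M, hM⟩ := (isCompact_Icc (a := p) (b := q)).exists_bound_of_continuousOn
        (f := fun x => t x ^ j) (by fun_prop)
      refine hg.mul_bdd (c := M) (by fun_prop) ?_
      exact (ae_restrict_iff' measurableSet_Ioo).2
        (Eventually.of_forall fun x hx => hM x (Set.Ioo_subset_Icc_self hx))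
    simp_rw [e, Polynomial.sum_def]
    rw [integral_finsetSum _ fun j _ => (hint j).const_mul _]
    simp [integral_const_mul, h]
  -- Stone–Weierstrass: injectivity of `t` means that the single generator separates points.
  have hdense : (Algebra.adjoin ℝ {τ}).topologicalClosure = ⊤ := by
    apply ContinuousMap.subalgebra_topologicalClosure_eq_top_of_separatesPoints
    intro x y hxy
    refine ⟨τ, ⟨τ, Algebra.self_mem_adjoin_singleton ℝ τ, rfl⟩, fun he => hxy ?_⟩
    exact Subtype.ext (hinj x.2 y.2 he)
  have hU : IsOpen (Set.Ioo p q) := isOpen_Ioo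
  rw [ae_restrict_iff' measurableSet_Ioo]
  -- It is enough to test with smooth compactly supported functions, each a uniform limit of
  -- polynomials in `t`.
  refine hU.ae_eq_zero_of_integral_contDiff_smul_eq_zero hg.locallyIntegrableOn fun φ hφ _ hφs => ?_
  have hφ0 : ∀ x ∉ Set.Ioo p q, φ x • g x = 0 := fun x hx => by
    rw [image_eq_zero_of_notMem_tsupport fun hx' => hx (hφs hx'), zero_smul]
  rw [← setIntegral_eq_integral_of_forall_compl_eq_zero hφ0]
  let Φ : C(Set.Icc p q, ℝ) := ⟨fun x => φ x, by have := hφ.continuous; fun_prop⟩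
  have hΦ : Φ ∈ closure (Algebra.adjoin ℝ {τ} : Set C(Set.Icc p q, ℝ)) := by
    have : Φ ∈ (Algebra.adjoin ℝ {τ}).topologicalClosure := by rw [hdense]; trivial
    exact this
  rw [Metric.mem_closure_iff] at hΦ
  refine abs_eq_zero.1 (le_antisymm (le_of_forall_pos_le_add fun ε hε => ?_) (abs_nonneg _))
  set N := ∫ x in Set.Ioo p q, ‖g x‖ with hN
  have hN0 : 0 ≤ N := integral_nonneg fun _ => norm_nonneg _
  -- The tolerance is relative to the L¹-norm N of `g`; adding one avoids division by zero.
  obtain ⟨ψ, hψ, hd⟩ := hΦ (ε / (N + 1)) (by positivity)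
  rw [SetLike.mem_coe, Algebra.adjoin_singleton_eq_range_aeval] at hψ
  obtain ⟨P, rfl⟩ := hψ
  have hval : ∀ x : Set.Icc p q, (Polynomial.aeval τ P : C(Set.Icc p q, ℝ)) x = P.eval (t x) := by
    intro x
    have := Polynomial.aeval_continuousMap_apply P τ x
    rw [this]; rfl
  have hbd : ∀ x ∈ Set.Ioo p q, |φ x - P.eval (t x)| ≤ ε / (N + 1) := by
    intro x hx
    have h1 := (ContinuousMap.dist_apply_le_dist (f := Φ) (g := Polynomial.aeval τ P)
      ⟨x, Set.Ioo_subset_Icc_self hx⟩).trans hd.le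
    rw [hval, Real.dist_eq] at h1
    exact h1
  have hφi : Integrable (fun x => φ x • g x) (volume.restrict (Set.Ioo p q)) := by
    obtain ⟨M, hM⟩ := (isCompact_Icc (a := p) (b := q)).exists_bound_of_continuousOn
      hφ.continuous.continuousOn
    refine hg.bdd_mul (c := M) hφ.continuous.aestronglyMeasurable ?_
    exact (ae_restrict_iff' measurableSet_Ioo).2
      (Eventually.of_forall fun x hx => hM x (Set.Ioo_subset_Icc_self hx))
  have hPi : Integrable (fun x => g x * P.eval (t x)) (volume.restrict (Set.Ioo p q)) := by
    have hc : Continuous fun x => P.eval (t x) := P.continuous.comp ht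
    obtain ⟨M, hM⟩ := (isCompact_Icc (a := p) (b := q)).exists_bound_of_continuousOn
      hc.continuousOn
    refine hg.mul_bdd (c := M) hc.aestronglyMeasurable ?_
    exact (ae_restrict_iff' measurableSet_Ioo).2
      (Eventually.of_forall fun x hx => hM x (Set.Ioo_subset_Icc_self hx))
  have e1 : ∫ x in Set.Ioo p q, φ x • g x
      = ∫ x in Set.Ioo p q, (φ x • g x - g x * P.eval (t x)) := by
    rw [integral_sub hφi hPi, hpoly P, sub_zero]
  rw [e1, zero_add, ← Real.norm_eq_abs]
  calc ‖∫ x in Set.Ioo p q, (φ x • g x - g x * P.eval (t x))‖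
      ≤ ∫ x in Set.Ioo p q, (ε / (N + 1)) * ‖g x‖ := by
        refine norm_integral_le_of_norm_le (hg.norm.const_mul _) ?_
        refine (ae_restrict_iff' measurableSet_Ioo).2 (Eventually.of_forall fun x hx => ?_)
        have : φ x • g x - g x * P.eval (t x) = (φ x - P.eval (t x)) * g x := by
          rw [smul_eq_mul]; ring
        rw [this, norm_mul]
        gcongr
        exact hbd x hx
    _ = ε / (N + 1) * N := by rw [integral_const_mul]
    _ ≤ ε := by
        rw [div_mul_eq_mul_div, div_le_iff₀ (by positivity)]
        nlinarith

/-- The affine map of `[p, q]` onto `[0, π]`. -/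
noncomputable def ang (p q x : ℝ) : ℝ := Real.pi / (q - p) * (x - p)

@[fun_prop]
lemma continuous_ang (p q : ℝ) : Continuous (ang p q) := by unfold ang; fun_prop

lemma ang_mem {p q x : ℝ} (hpq : p < q) (hx : x ∈ Set.Icc p q) : ang p q x ∈ Set.Icc 0 Real.pi := by
  have h1 : 0 < q - p := sub_pos.2 hpq
  have := Real.pi_pos
  refine ⟨mul_nonneg (by positivity) (sub_nonneg.2 hx.1), ?_⟩
  rw [ang, div_mul_eq_mul_div, div_le_iff₀ h1]
  have := hx.2
  gcongr

lemma ang_pos {p q x : ℝ} (hpq : p < q) (hx : x ∈ Set.Ioo p q) : 0 < ang p q x :=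
  mul_pos (div_pos Real.pi_pos (sub_pos.2 hpq)) (sub_pos.2 hx.1)

lemma ang_lt_pi {p q x : ℝ} (hpq : p < q) (hx : x ∈ Set.Ioo p q) : ang p q x < Real.pi := by
  have h1 : 0 < q - p := sub_pos.2 hpq
  have := Real.pi_pos
  rw [ang, div_mul_eq_mul_div, div_lt_iff₀ h1]
  have := hx.2
  gcongr

lemma injOn_cos_ang {p q : ℝ} (hpq : p < q) :
    Set.InjOn (fun x => Real.cos (ang p q x)) (Set.Icc p q) := by
  intro x hx y hy h
  have h1 := Real.injOn_cos (ang_mem hpq hx) (ang_mem hpq hy) h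
  have h2 : Real.pi / (q - p) ≠ 0 := (div_pos Real.pi_pos (sub_pos.2 hpq)).ne'
  have h3 := mul_left_cancel₀ h2 h1
  linarith

lemma integrable_mul_bdd {p q : ℝ} {g h : ℝ → ℝ} (hg : IntegrableOn g (Set.Ioo p q))
    (hh : Continuous h) : Integrable (fun x => g x * h x) (volume.restrict (Set.Ioo p q)) := by
  obtain ⟨M, hM⟩ := (isCompact_Icc (a := p) (b := q)).exists_bound_of_continuousOn hh.continuousOn
  refine hg.mul_bdd (c := M) hh.aestronglyMeasurable ?_
  exact (ae_restrict_iff' measurableSet_Ioo).2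
    (Eventually.of_forall fun x hx => hM x (Set.Ioo_subset_Icc_self hx))

/-- The cosine system is complete in `L¹`. -/
lemma ae_eq_zero_of_integral_mul_cos {p q : ℝ} (hpq : p < q) {g : ℝ → ℝ}
    (hg : IntegrableOn g (Set.Ioo p q))
    (h : ∀ k : ℕ, ∫ x in Set.Ioo p q, g x * Real.cos (k * ang p q x) = 0) :
    ∀ᵐ x ∂(volume.restrict (Set.Ioo p q)), g x = 0 := by
  -- Product-to-sum formulas trade a power of cosine for neighbouring frequencies, which reduces the
  -- claim to powers of the injective function cos.
  have key : ∀ j k : ℕ, ∫ x in Set.Ioo p q,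
      g x * (Real.cos (ang p q x) ^ j * Real.cos (k * ang p q x)) = 0 := by
    intro j
    induction j with
    | zero => simpa using h
    | succ j ih =>
      intro k
      have hi : ∀ m : ℕ, Integrable (fun x => g x * (Real.cos (ang p q x) ^ j *
          Real.cos (m * ang p q x))) (volume.restrict (Set.Ioo p q)) := fun m =>
        integrable_mul_bdd hg (by fun_prop)
      rcases k with _ | k
      · simpa [pow_succ] using ih 1
      · have e : ∀ x, g x * (Real.cos (ang p q x) ^ (j + 1) * Real.cos ((k + 1 : ℕ) * ang p q x))
            = 1 / 2 * (g x * (Real.cos (ang p q x) ^ j * Real.cos ((k + 2 : ℕ) * ang p q x)))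
            + 1 / 2 * (g x * (Real.cos (ang p q x) ^ j * Real.cos (k * ang p q x))) := by
          intro x
          have e1 : ((k + 2 : ℕ) : ℝ) * ang p q x = (k + 1 : ℕ) * ang p q x + ang p q x := by
            push_cast; ring
          have e2 : (k : ℝ) * ang p q x = (k + 1 : ℕ) * ang p q x - ang p q x := by
            push_cast; ring
          rw [e1, e2, Real.cos_add, Real.cos_sub]
          ring
        simp_rw [e]
        rw [integral_add ((hi _).const_mul _) ((hi _).const_mul _), integral_const_mul,
          integral_const_mul, ih, ih]
        simp
  refine ae_eq_zero_of_integral_mul_pow hg (by fun_prop) (injOn_cos_ang hpq) fun j => ?_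
  simpa using key j 0

/-- The sine system is complete in `L¹`. -/
lemma ae_eq_zero_of_integral_mul_sin {p q : ℝ} (hpq : p < q) {g : ℝ → ℝ}
    (hg : IntegrableOn g (Set.Ioo p q))
    (h : ∀ k : ℕ, ∫ x in Set.Ioo p q, g x * Real.sin (k * ang p q x) = 0) :
    ∀ᵐ x ∂(volume.restrict (Set.Ioo p q)), g x = 0 := by
  have key : ∀ j k : ℕ, ∫ x in Set.Ioo p q,
      g x * (Real.cos (ang p q x) ^ j * Real.sin (k * ang p q x)) = 0 := by
    intro j
    induction j with
    | zero => simpa using h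
    | succ j ih =>
      intro k
      have hi : ∀ m : ℕ, Integrable (fun x => g x * (Real.cos (ang p q x) ^ j *
          Real.sin (m * ang p q x))) (volume.restrict (Set.Ioo p q)) := fun m =>
        integrable_mul_bdd hg (by fun_prop)
      rcases k with _ | k
      · simp
      · have e : ∀ x, g x * (Real.cos (ang p q x) ^ (j + 1) * Real.sin ((k + 1 : ℕ) * ang p q x))
            = 1 / 2 * (g x * (Real.cos (ang p q x) ^ j * Real.sin ((k + 2 : ℕ) * ang p q x)))
            + 1 / 2 * (g x * (Real.cos (ang p q x) ^ j * Real.sin (k * ang p q x))) := by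
          intro x
          have e1 : ((k + 2 : ℕ) : ℝ) * ang p q x = (k + 1 : ℕ) * ang p q x + ang p q x := by
            push_cast; ring
          have e2 : (k : ℝ) * ang p q x = (k + 1 : ℕ) * ang p q x - ang p q x := by
            push_cast; ring
          rw [e1, e2, Real.sin_add, Real.sin_sub]
          ring
        simp_rw [e]
        rw [integral_add ((hi _).const_mul _) ((hi _).const_mul _), integral_const_mul,
          integral_const_mul, ih, ih]
        simp
  -- Frequency one shows that `g` times the sine is orthogonal to all powers of cosine; the sine is
  -- positive inside the interval and can be divided out.
  have h1 : ∀ᵐ x ∂(volume.restrict (Set.Ioo p q)), g x * Real.sin (ang p q x) = 0 := by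
    refine ae_eq_zero_of_integral_mul_pow (integrable_mul_bdd hg (by fun_prop)) (by fun_prop)
      (injOn_cos_ang hpq) fun j => ?_
    rw [← key j 1]
    congr 1
    ext x
    simp only [Nat.cast_one, one_mul]
    ring
  filter_upwards [h1, ae_restrict_mem measurableSet_Ioo] with x hx hm
  exact (mul_eq_zero.1 hx).resolve_right
    (Real.sin_pos_of_pos_of_lt_pi (ang_pos hpq hm) (ang_lt_pi hpq hm)).ne'

/-- Hartley's function `cos + sin`. -/
noncomputable def cas (t : ℝ) : ℝ := Real.cos t + Real.sin t

@[fun_prop]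
lemma continuous_cas : Continuous cas := by unfold cas; fun_prop

lemma cas_neg (t : ℝ) : cas (-t) = Real.cos t - Real.sin t := by
  rw [cas, Real.cos_neg, Real.sin_neg]; ring

lemma integral_Ioo_neg_reflect {b : ℝ} (f : ℝ → ℝ) :
    ∫ y in Set.Ioo (-b) 0, f y = ∫ y in Set.Ioo 0 b, f (-y) := by
  have h := (Measure.measurePreserving_neg (volume : Measure ℝ)).setIntegral_preimage_emb
    (MeasurableEquiv.neg ℝ).measurableEmbedding f (Set.Ioo (-b) 0)
  rw [← h]
  simp

lemma integrableOn_reflect {b : ℝ} {g : ℝ → ℝ} (hg : IntegrableOn g (Set.Ioo (-b) 0)) :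
    IntegrableOn (fun y => g (-y)) (Set.Ioo 0 b) := by
  have h := (Measure.measurePreserving_neg (volume : Measure ℝ)).integrableOn_comp_preimage
    (MeasurableEquiv.neg ℝ).measurableEmbedding (f := g) (s := Set.Ioo (-b) 0)
  have h2 := h.2 hg
  simpa [Function.comp_def] using h2

lemma ae_reflect {b : ℝ} {P : ℝ → Prop} (h : ∀ᵐ y ∂(volume.restrict (Set.Ioo 0 b)), P (-y)) :
    ∀ᵐ y ∂(volume.restrict (Set.Ioo (-b) 0)), P y := by
  rw [ae_restrict_iff' measurableSet_Ioo] at h ⊢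
  have := (Measure.measurePreserving_neg (volume : Measure ℝ)).quasiMeasurePreserving.ae h
  filter_upwards [this] with y hy hm
  simpa using hy ⟨by linarith [hm.2], by linarith [hm.1]⟩

lemma integral_Ioo_symm {b : ℝ} (hb : 0 < b) {f : ℝ → ℝ} (hf : IntegrableOn f (Set.Ioo (-b) b)) :
    ∫ y in Set.Ioo (-b) b, f y = ∫ y in Set.Ioo 0 b, (f y + f (-y)) := by
  have h1 : IntegrableOn f (Set.Ioo (-b) 0) := hf.mono_set (Set.Ioo_subset_Ioo_right hb.le)
  have h2 : IntegrableOn f (Set.Ioo 0 b) := hf.mono_set (Set.Ioo_subset_Ioo_left (by linarith))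
  rw [integral_add h2 (integrableOn_reflect h1), ← integral_Ioo_neg_reflect,
    ← integral_Ioc_eq_integral_Ioo, ← integral_Ioc_eq_integral_Ioo,
    ← integral_Ioc_eq_integral_Ioo, ← intervalIntegral.integral_of_le (by linarith),
    ← intervalIntegral.integral_of_le (by linarith),
    ← intervalIntegral.integral_of_le (by linarith), add_comm,
    intervalIntegral.integral_add_adjacent_intervals]
  · rwa [intervalIntegrable_iff_integrableOn_Ioo_of_le (by linarith)]
  · rwa [intervalIntegrable_iff_integrableOn_Ioo_of_le (by linarith)]

/-- The Hartley system is complete in `L¹`. -/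
lemma ae_eq_zero_of_integral_mul_cas {b : ℝ} (hb : 0 < b) {g : ℝ → ℝ}
    (hg : IntegrableOn g (Set.Ioo (-b) b))
    (h : ∀ l : ℤ, ∫ y in Set.Ioo (-b) b, g y * cas (l * Real.pi / b * y) = 0) :
    ∀ᵐ y ∂(volume.restrict (Set.Ioo (-b) b)), g y = 0 := by
  have hi : ∀ l : ℤ, Integrable (fun y => g y * cas (l * Real.pi / b * y))
      (volume.restrict (Set.Ioo (-b) b)) := fun l => integrable_mul_bdd hg (by fun_prop)
  have hcos : ∀ k : ℕ, ∫ y in Set.Ioo (-b) b, g y * Real.cos (k * Real.pi / b * y) = 0 := by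
    intro k
    have e : ∀ y, g y * Real.cos (k * Real.pi / b * y)
        = 1 / 2 * (g y * cas ((k : ℤ) * Real.pi / b * y))
          + 1 / 2 * (g y * cas ((-k : ℤ) * Real.pi / b * y)) := by
      intro y
      have : ((-k : ℤ) : ℝ) * Real.pi / b * y = -((k : ℤ) * Real.pi / b * y) := by
        push_cast; ring
      rw [this, cas_neg, cas]; push_cast; ring
    simp_rw [e]
    rw [integral_add ((hi _).const_mul _) ((hi _).const_mul _), integral_const_mul,
      integral_const_mul, h, h]
    simp
  have hsin : ∀ k : ℕ, ∫ y in Set.Ioo (-b) b, g y * Real.sin (k * Real.pi / b * y) = 0 := by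
    intro k
    have e : ∀ y, g y * Real.sin (k * Real.pi / b * y)
        = 1 / 2 * (g y * cas ((k : ℤ) * Real.pi / b * y))
          - 1 / 2 * (g y * cas ((-k : ℤ) * Real.pi / b * y)) := by
      intro y
      have : ((-k : ℤ) : ℝ) * Real.pi / b * y = -((k : ℤ) * Real.pi / b * y) := by
        push_cast; ring
      rw [this, cas_neg, cas]; push_cast; ring
    simp_rw [e]
    rw [integral_sub ((hi _).const_mul _) ((hi _).const_mul _), integral_const_mul,
      integral_const_mul, h, h]
    simp
  have hang : ∀ (k : ℕ) (y : ℝ), k * ang 0 b y = k * Real.pi / b * y := fun k y => by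
    rw [ang]; ring
  have h1 : IntegrableOn (fun y => g (-y)) (Set.Ioo 0 b) :=
    integrableOn_reflect (hg.mono_set (Set.Ioo_subset_Ioo_right hb.le))
  have h2 : IntegrableOn g (Set.Ioo 0 b) := hg.mono_set (Set.Ioo_subset_Ioo_left (by linarith))
  -- Frequencies l and -l separate cosine and sine moments, which see only the even and the odd part
  -- of `g`. The half-interval results apply to each part.
  have heven : ∀ᵐ y ∂(volume.restrict (Set.Ioo 0 b)), g y + g (-y) = 0 := by
    refine ae_eq_zero_of_integral_mul_cos hb (h2.add h1) fun k => ?_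
    have := hcos k
    rw [integral_Ioo_symm hb (integrable_mul_bdd hg (by fun_prop))] at this
    refine Eq.trans (integral_congr_ae (Eventually.of_forall fun y => ?_)) this
    simp only [hang, mul_neg, Real.cos_neg]
    ring
  have hodd : ∀ᵐ y ∂(volume.restrict (Set.Ioo 0 b)), g y - g (-y) = 0 := by
    refine ae_eq_zero_of_integral_mul_sin hb (h2.sub h1) fun k => ?_
    have := hsin k
    rw [integral_Ioo_symm hb (integrable_mul_bdd hg (by fun_prop))] at this
    refine Eq.trans (integral_congr_ae (Eventually.of_forall fun y => ?_)) this
    simp only [hang, mul_neg, Real.sin_neg]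
    ring
  have hpos : ∀ᵐ y ∂(volume.restrict (Set.Ioo 0 b)), g y = 0 := by
    filter_upwards [heven, hodd] with y h1 h2
    linarith
  have hneg : ∀ᵐ y ∂(volume.restrict (Set.Ioo (-b) 0)), g y = 0 := by
    refine ae_reflect ?_
    filter_upwards [heven, hodd] with y h1 h2
    linarith
  rw [ae_restrict_iff' measurableSet_Ioo] at hpos hneg ⊢
  filter_upwards [hpos, hneg, compl_mem_ae_iff.2 (measure_singleton (0 : ℝ))] with y h1 h2 h3 hy
  rcases lt_trichotomy y 0 with h | h | h
  · exact h2 ⟨hy.1, h⟩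
  · exact absurd h h3
  · exact h1 ⟨h, hy.2⟩

/-- Products of complete systems are complete. -/
lemma ae_eq_zero_of_integral_mul_prod {ι κ : Type*} [Countable κ] {μ ν : Measure ℝ}
    [SFinite μ] [SFinite ν]
    {p : ι → ℝ → ℝ} {q : κ → ℝ → ℝ}
    (hp : ∀ g : ℝ → ℝ, Integrable g μ → (∀ k, ∫ x, g x * p k x ∂μ = 0) → ∀ᵐ x ∂μ, g x = 0)
    (hq : ∀ g : ℝ → ℝ, Integrable g ν → (∀ l, ∫ y, g y * q l y ∂ν = 0) → ∀ᵐ y ∂ν, g y = 0)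
    {u : ℝ × ℝ → ℝ} (hu : Integrable u (μ.prod ν))
    (huq : ∀ l, Integrable (fun z => u z * q l z.2) (μ.prod ν))
    (hupq : ∀ k l, Integrable (fun z => u z * (p k z.1 * q l z.2)) (μ.prod ν))
    (h : ∀ k l, ∫ z, u z * (p k z.1 * q l z.2) ∂(μ.prod ν) = 0) :
    ∀ᵐ z ∂(μ.prod ν), u z = 0 := by
  have h1 : ∀ l, ∀ᵐ x ∂μ, ∫ y, u (x, y) * q l y ∂ν = 0 := by
    intro l
    refine hp _ (huq l).integral_prod_left fun k => ?_
    rw [← h k l, integral_prod _ (hupq k l)]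
    congr 1
    ext x
    rw [← integral_mul_const]
    congr 1
    ext y
    ring
  -- Countability of `κ` collects the exceptional null sets of all `l` into one.
  have h2 : ∀ᵐ x ∂μ, ∀ᵐ y ∂ν, u (x, y) = 0 := by
    filter_upwards [ae_all_iff.2 h1, hu.prod_right_ae] with x hx hxi
    exact hq _ hxi hx
  have h3 : ∫ z, ‖u z‖ ∂(μ.prod ν) = 0 := by
    rw [integral_prod _ hu.norm]
    refine integral_eq_zero_of_ae ?_
    filter_upwards [h2] with x hx
    refine integral_eq_zero_of_ae ?_
    filter_upwards [hx] with y hy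
    simp [hy]
  have h4 := (integral_eq_zero_iff_of_nonneg (fun z => norm_nonneg (u z)) hu.norm).1 h3
  filter_upwards [h4] with z hz
  simpa using hz

end Completeness

/-! ### Orthonormal modes and their derivatives -/

section Modes

lemma integral_Ioo_eq_sub {p q : ℝ} (hpq : p ≤ q) {f f' : ℝ → ℝ} (hf : ∀ x, HasDerivAt f (f' x) x)
    (hc : Continuous f') : ∫ x in Set.Ioo p q, f' x = f q - f p := by
  rw [← integral_Ioc_eq_integral_Ioo, ← intervalIntegral.integral_of_le hpq]
  exact intervalIntegral.integral_eq_sub_of_hasDerivAt (fun x _ => hf x)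
    (hc.intervalIntegrable _ _)

lemma hasDerivAt_ang (p q x : ℝ) : HasDerivAt (ang p q) (Real.pi / (q - p)) x := by
  have h := ((hasDerivAt_id x).sub_const p).const_mul (Real.pi / (q - p))
  rw [mul_one] at h
  exact h

lemma ang_left (p q : ℝ) : ang p q p = 0 := by simp [ang]

lemma ang_right {p q : ℝ} (hpq : p < q) : ang p q q = Real.pi := by
  rw [ang, div_mul_cancel₀ _ (sub_pos.2 hpq).ne']

lemma integral_cos_ang {p q : ℝ} (hpq : p < q) (m : ℤ) :
    ∫ x in Set.Ioo p q, Real.cos (m * ang p q x) = if m = 0 then q - p else 0 := by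
  split_ifs with hm
  · subst hm; simp [hpq.le]
  · have hr : (m : ℝ) * (Real.pi / (q - p)) ≠ 0 :=
      mul_ne_zero (by exact_mod_cast hm) (div_pos Real.pi_pos (sub_pos.2 hpq)).ne'
    rw [integral_Ioo_eq_sub hpq.le
      (f := fun x => (m * (Real.pi / (q - p)))⁻¹ * Real.sin (m * ang p q x))]
    · rw [ang_left, ang_right hpq, Real.sin_int_mul_pi]; simp
    · intro x
      have := (((hasDerivAt_ang p q x).const_mul (m : ℝ)).sin).const_mul
        ((m * (Real.pi / (q - p)))⁻¹)
      refine this.congr_deriv ?_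
      rw [mul_comm (Real.cos _), ← mul_assoc, inv_mul_cancel₀ hr, one_mul]
    · fun_prop

lemma integral_cos_mul_cos {p q : ℝ} (hpq : p < q) (j k : ℕ) :
    ∫ x in Set.Ioo p q, Real.cos (j * ang p q x) * Real.cos (k * ang p q x)
      = if j = k then (if j = 0 then q - p else (q - p) / 2) else 0 := by
  have e : ∀ x, Real.cos (j * ang p q x) * Real.cos (k * ang p q x)
      = 1 / 2 * Real.cos (((j : ℤ) - k : ℤ) * ang p q x)
        + 1 / 2 * Real.cos (((j : ℤ) + k : ℤ) * ang p q x) := by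
    intro x
    push_cast
    rw [sub_mul, add_mul, Real.cos_add, Real.cos_sub]
    ring
  have hi : ∀ m : ℤ, Integrable (fun x => Real.cos (m * ang p q x))
      (volume.restrict (Set.Ioo p q)) := fun m =>
    ((by fun_prop : Continuous fun x => Real.cos (m * ang p q x)).integrableOn_Icc).mono_set
      Set.Ioo_subset_Icc_self
  simp_rw [e]
  rw [integral_add ((hi _).const_mul _) ((hi _).const_mul _), integral_const_mul,
    integral_const_mul, integral_cos_ang hpq, integral_cos_ang hpq]
  by_cases hjk : j = k
  · subst hjk
    by_cases hj : j = 0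
    · simp [hj]; ring
    · have : (j : ℤ) + j ≠ 0 := by omega
      simp [hj, this]; ring
  · have h1 : (j : ℤ) - k ≠ 0 := by omega
    have h2 : (j : ℤ) + k ≠ 0 := by omega
    simp [hjk, h1, h2]

lemma integral_sin_mul_sin {p q : ℝ} (hpq : p < q) (j k : ℕ) :
    ∫ x in Set.Ioo p q, Real.sin ((j + 1 : ℕ) * ang p q x) * Real.sin ((k + 1 : ℕ) * ang p q x)
      = if j = k then (q - p) / 2 else 0 := by
  have e : ∀ x, Real.sin ((j + 1 : ℕ) * ang p q x) * Real.sin ((k + 1 : ℕ) * ang p q x)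
      = 1 / 2 * Real.cos (((j : ℤ) - k : ℤ) * ang p q x)
        - 1 / 2 * Real.cos (((j : ℤ) + k + 2 : ℤ) * ang p q x) := by
    intro x
    have e1 : (((j : ℤ) - k : ℤ) : ℝ) * ang p q x
      = (j + 1 : ℕ) * ang p q x - (k + 1 : ℕ) * ang p q x := by push_cast; ring
    have e2 : (((j : ℤ) + k + 2 : ℤ) : ℝ) * ang p q x
      = (j + 1 : ℕ) * ang p q x + (k + 1 : ℕ) * ang p q x := by push_cast; ring
    rw [e1, e2, Real.cos_add, Real.cos_sub]
    ring
  have hi : ∀ m : ℤ, Integrable (fun x => Real.cos (m * ang p q x))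
      (volume.restrict (Set.Ioo p q)) := fun m =>
    ((by fun_prop : Continuous fun x => Real.cos (m * ang p q x)).integrableOn_Icc).mono_set
      Set.Ioo_subset_Icc_self
  simp_rw [e]
  rw [integral_sub ((hi _).const_mul _) ((hi _).const_mul _), integral_const_mul,
    integral_const_mul, integral_cos_ang hpq, integral_cos_ang hpq]
  have h2 : (j : ℤ) + k + 2 ≠ 0 := by omega
  by_cases hjk : j = k
  · subst hjk
    simp [h2]; ring
  · have h1 : (j : ℤ) - k ≠ 0 := by omega
    simp [hjk, h1, h2]

/-- Because cas s · cas t = cos(s - t) + sin(s + t) and the sine is odd, only the cosine of the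
frequency difference contributes. -/
lemma integral_cas_mul_cas {b : ℝ} (hb : 0 < b) (l m : ℤ) :
    ∫ y in Set.Ioo (-b) b, cas (l * Real.pi / b * y) * cas (m * Real.pi / b * y)
      = if l = m then 2 * b else 0 := by
  have e : ∀ y, cas (l * Real.pi / b * y) * cas (m * Real.pi / b * y)
      = Real.cos ((l - m : ℤ) * Real.pi / b * y) + Real.sin ((l + m : ℤ) * Real.pi / b * y) := by
    intro y
    have e1 : ((l - m : ℤ) : ℝ) * Real.pi / b * y
      = l * Real.pi / b * y - m * Real.pi / b * y := by push_cast; ring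
    have e2 : ((l + m : ℤ) : ℝ) * Real.pi / b * y
      = l * Real.pi / b * y + m * Real.pi / b * y := by push_cast; ring
    rw [e1, e2, Real.cos_sub, Real.sin_add, cas, cas]
    ring
  have hin : ∀ f : ℝ → ℝ, Continuous f → Integrable f (volume.restrict (Set.Ioo (-b) b)) :=
    fun f hf => hf.integrableOn_Icc.mono_set Set.Ioo_subset_Icc_self
  have hle : -b ≤ b := by linarith
  have hlin : ∀ (n : ℤ) (y : ℝ),
      HasDerivAt (fun y => n * Real.pi / b * y) (n * Real.pi / b) y := fun n y => by
    simpa using (hasDerivAt_id y).const_mul (n * Real.pi / b)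
  have hcos : ∀ n : ℤ, ∫ y in Set.Ioo (-b) b, Real.cos (n * Real.pi / b * y)
      = if n = 0 then 2 * b else 0 := by
    intro n
    split_ifs with hn
    · subst hn
      have : max (b + b) 0 = 2 * b := by rw [max_eq_left (by linarith)]; ring
      simpa using this
    · have hn' : (n : ℝ) ≠ 0 := by exact_mod_cast hn
      have hpi := Real.pi_pos.ne'
      rw [integral_Ioo_eq_sub hle (f := fun y => (n * Real.pi / b)⁻¹ * Real.sin (n * Real.pi / b * y))]
      · have e1 : (n : ℝ) * Real.pi / b * b = n * Real.pi := by field_simp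
        have e2 : (n : ℝ) * Real.pi / b * -b = -(n * Real.pi) := by field_simp
        rw [e1, e2, Real.sin_neg, Real.sin_int_mul_pi]; simp
      · intro y
        have := ((hlin n y).sin).const_mul ((n * Real.pi / b)⁻¹)
        have hr : (n : ℝ) * Real.pi / b ≠ 0 := by positivity
        refine this.congr_deriv ?_
        rw [mul_comm (Real.cos _), ← mul_assoc, inv_mul_cancel₀ hr, one_mul]
      · fun_prop
  have hsin : ∀ n : ℤ, ∫ y in Set.Ioo (-b) b, Real.sin (n * Real.pi / b * y) = 0 := by
    intro n
    rw [integral_Ioo_symm hb (hin _ (by fun_prop))]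
    simp
  simp_rw [e]
  rw [integral_add (hin _ (by fun_prop)) (hin _ (by fun_prop)), hcos, hsin, add_zero]
  simp [sub_eq_zero]

/-- Normalized cosines on `(-a, a)`. -/
noncomputable def cx (a : ℝ) (k : ℕ) (x : ℝ) : ℝ :=
  (if k = 0 then (√(2 * a))⁻¹ else (√a)⁻¹) * Real.cos (k * ang (-a) a x)

/-- Normalized sines on `(-a, a)`. -/
noncomputable def sx (a : ℝ) (k : ℕ) (x : ℝ) : ℝ := (√a)⁻¹ * Real.sin (k * ang (-a) a x)

/-- Normalized Hartley functions on `(-b, b)`. -/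
noncomputable def hy (b : ℝ) (l : ℤ) (y : ℝ) : ℝ := (√(2 * b))⁻¹ * cas (l * Real.pi / b * y)

/-- Frequencies in `x`. -/
noncomputable def fx (a : ℝ) (k : ℕ) : ℝ := k * Real.pi / (2 * a)

/-- Frequencies in `y`. -/
noncomputable def fy (b : ℝ) (l : ℤ) : ℝ := l * Real.pi / b

lemma fy_neg (b : ℝ) (l : ℤ) : fy b (-l) = -fy b l := by simp [fy]; ring

lemma contDiff_ang (p q : ℝ) : ContDiff ℝ ∞ (ang p q) := by unfold ang; fun_prop

lemma contDiff_cx (a : ℝ) (k : ℕ) : ContDiff ℝ ∞ (cx a k) := by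
  have := contDiff_ang (-a) a
  unfold cx; fun_prop

lemma contDiff_sx (a : ℝ) (k : ℕ) : ContDiff ℝ ∞ (sx a k) := by
  have := contDiff_ang (-a) a
  unfold sx; fun_prop

lemma contDiff_hy (b : ℝ) (l : ℤ) : ContDiff ℝ ∞ (hy b l) := by
  unfold hy cas; fun_prop

lemma hasDerivAt_cx {a : ℝ} (k : ℕ) (x : ℝ) : HasDerivAt (cx a k) (-fx a k * sx a k x) x := by
  have h := (((hasDerivAt_ang (-a) a x).const_mul (k : ℝ)).cos).const_mul
    (if k = 0 then (√(2 * a))⁻¹ else (√a)⁻¹)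
  have e2 : a - -a = 2 * a := by ring
  refine h.congr_deriv ?_
  rw [fx, sx, e2]
  -- The normalizations of cosine and sine disagree only at k = 0, where the frequency factor
  -- vanishes.
  split_ifs with hk
  · simp [hk]
  · ring

lemma hasDerivAt_sx {a : ℝ} (k : ℕ) (x : ℝ) : HasDerivAt (sx a k) (fx a k * cx a k x) x := by
  have h := (((hasDerivAt_ang (-a) a x).const_mul (k : ℝ)).sin).const_mul (√a)⁻¹
  have e2 : a - -a = 2 * a := by ring
  refine h.congr_deriv ?_
  rw [fx, cx, e2]
  split_ifs with hk
  · simp [hk]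
  · ring

/-- Differentiation exchanges l and -l, so this real family with one index is closed under ∂_y, as
exponentials would be. -/
lemma hasDerivAt_hy {b : ℝ} (l : ℤ) (y : ℝ) : HasDerivAt (hy b l) (fy b l * hy b (-l) y) y := by
  have hl : HasDerivAt (fun y => l * Real.pi / b * y) (l * Real.pi / b) y := by
    simpa using (hasDerivAt_id y).const_mul (l * Real.pi / b)
  have h := (hl.cos.add hl.sin).const_mul (√(2 * b))⁻¹
  refine h.congr_deriv ?_
  have : ((-l : ℤ) : ℝ) * Real.pi / b * y = -(l * Real.pi / b * y) := by push_cast; ring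
  rw [fy, hy, this, cas_neg]
  ring

lemma sx_left (a : ℝ) (k : ℕ) : sx a k (-a) = 0 := by simp [sx, ang_left]

lemma sx_right {a : ℝ} (ha : 0 < a) (k : ℕ) : sx a k a = 0 := by
  rw [sx, ang_right (by linarith), Real.sin_nat_mul_pi, mul_zero]

lemma hy_periodic {b : ℝ} (hb : 0 < b) (l : ℤ) (y : ℝ) : hy b l (y + 2 * b) = hy b l y := by
  have e : (l : ℝ) * Real.pi / b * (y + 2 * b) = l * Real.pi / b * y + l * (2 * Real.pi) := by
    field_simp
  rw [hy, hy, e, cas, cas, Real.cos_add_int_mul_two_pi, Real.sin_add_int_mul_two_pi]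

lemma integral_cx {a : ℝ} (ha : 0 < a) (j k : ℕ) :
    ∫ x in Set.Ioo (-a) a, cx a j x * cx a k x = if j = k then 1 else 0 := by
  have e : ∀ x, cx a j x * cx a k x = ((if j = 0 then (√(2 * a))⁻¹ else (√a)⁻¹) *
      (if k = 0 then (√(2 * a))⁻¹ else (√a)⁻¹)) *
        (Real.cos (j * ang (-a) a x) * Real.cos (k * ang (-a) a x)) := fun x => by
    rw [cx, cx]; ring
  simp_rw [e]
  rw [integral_const_mul, integral_cos_mul_cos (by linarith)]
  by_cases hjk : j = k
  · subst hjk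
    have h1 : √a * √a = a := Real.mul_self_sqrt ha.le
    have h2 : √(2 * a) * √(2 * a) = 2 * a := Real.mul_self_sqrt (by linarith)
    by_cases hj : j = 0
    · simp only [hj, if_true]
      rw [← mul_inv, h2]; field_simp; ring
    · simp only [hj, if_true, if_false]
      rw [← mul_inv, h1]; field_simp; ring
  · simp [hjk]

lemma integral_sx {a : ℝ} (ha : 0 < a) (j k : ℕ) :
    ∫ x in Set.Ioo (-a) a, sx a (j + 1) x * sx a (k + 1) x = if j = k then 1 else 0 := by
  have e : ∀ x, sx a (j + 1) x * sx a (k + 1) x = ((√a)⁻¹ * (√a)⁻¹) *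
        (Real.sin ((j + 1 : ℕ) * ang (-a) a x) * Real.sin ((k + 1 : ℕ) * ang (-a) a x)) :=
    fun x => by rw [sx, sx]; ring
  simp_rw [e]
  rw [integral_const_mul, integral_sin_mul_sin (by linarith), ← mul_inv, Real.mul_self_sqrt ha.le]
  split_ifs
  · field_simp; ring
  · simp

lemma integral_hy {b : ℝ} (hb : 0 < b) (l m : ℤ) :
    ∫ y in Set.Ioo (-b) b, hy b l y * hy b m y = if l = m then 1 else 0 := by
  have e : ∀ y, hy b l y * hy b m y = ((√(2 * b))⁻¹ * (√(2 * b))⁻¹) *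
        (cas (l * Real.pi / b * y) * cas (m * Real.pi / b * y)) :=
    fun x => by rw [hy, hy]; ring
  simp_rw [e]
  rw [integral_const_mul, integral_cas_mul_cas hb, ← mul_inv,
    Real.mul_self_sqrt (by linarith)]
  split_ifs
  · field_simp
  · simp

/-- The modes `cos · cas`. -/
noncomputable def modeC (a b : ℝ) (i : ℕ × ℤ) : ℝ × ℝ → ℝ := fun p => cx a i.1 p.1 * hy b i.2 p.2

/-- The modes `sin · cas`. -/
noncomputable def modeS (a b : ℝ) (i : ℕ × ℤ) : ℝ × ℝ → ℝ := fun p => sx a i.1 p.1 * hy b i.2 p.2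

lemma contDiff_modeC (a b : ℝ) (i : ℕ × ℤ) : ContDiff ℝ ∞ (modeC a b i) :=
  ((contDiff_cx a i.1).comp contDiff_fst).mul ((contDiff_hy b i.2).comp contDiff_snd)

lemma contDiff_modeS (a b : ℝ) (i : ℕ × ℤ) : ContDiff ℝ ∞ (modeS a b i) :=
  ((contDiff_sx a i.1).comp contDiff_fst).mul ((contDiff_hy b i.2).comp contDiff_snd)

lemma pd_ex_prod {f g : ℝ → ℝ} {f' : ℝ} {p : ℝ × ℝ} (hf : HasDerivAt f f' p.1)
    (hg : DifferentiableAt ℝ g p.2) : pd ex (fun p => f p.1 * g p.2) p = f' * g p.2 := by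
  have h1 := hf.hasFDerivAt.comp p (hasFDerivAt_fst (𝕜 := ℝ) (p := p))
  have h2 := hg.hasFDerivAt.comp p (hasFDerivAt_snd (𝕜 := ℝ) (p := p))
  have h3 := h1.mul h2
  have h4 : HasFDerivAt (fun p : ℝ × ℝ => f p.1 * g p.2) _ p := h3
  rw [pd, h4.fderiv]
  simp [ex, mul_comm]

lemma pd_ey_prod {f g : ℝ → ℝ} {g' : ℝ} {p : ℝ × ℝ} (hf : DifferentiableAt ℝ f p.1)
    (hg : HasDerivAt g g' p.2) : pd ey (fun p => f p.1 * g p.2) p = f p.1 * g' := by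
  have h1 := hf.hasFDerivAt.comp p (hasFDerivAt_fst (𝕜 := ℝ) (p := p))
  have h2 := hg.hasFDerivAt.comp p (hasFDerivAt_snd (𝕜 := ℝ) (p := p))
  have h3 := h1.mul h2
  have h4 : HasFDerivAt (fun p : ℝ × ℝ => f p.1 * g p.2) _ p := h3
  rw [pd, h4.fderiv]
  simp [ey]

lemma pd_ex_modeC (a b : ℝ) (i : ℕ × ℤ) (p : ℝ × ℝ) :
    pd ex (modeC a b i) p = -fx a i.1 * modeS a b i p := by
  have := pd_ex_prod (p := p) (hasDerivAt_cx (a := a) i.1 p.1)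
    (hasDerivAt_hy (b := b) i.2 p.2).differentiableAt
  rw [modeS, ← mul_assoc]; exact this

lemma pd_ex_modeS (a b : ℝ) (i : ℕ × ℤ) (p : ℝ × ℝ) :
    pd ex (modeS a b i) p = fx a i.1 * modeC a b i p := by
  have := pd_ex_prod (p := p) (hasDerivAt_sx (a := a) i.1 p.1)
    (hasDerivAt_hy (b := b) i.2 p.2).differentiableAt
  rw [modeC, ← mul_assoc]; exact this

lemma pd_ey_modeC (a b : ℝ) (k : ℕ) (l : ℤ) (p : ℝ × ℝ) :
    pd ey (modeC a b (k, l)) p = fy b l * modeC a b (k, -l) p := by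
  have := pd_ey_prod (p := p) (hasDerivAt_cx (a := a) k p.1).differentiableAt
    (hasDerivAt_hy (b := b) l p.2)
  refine Eq.trans this ?_
  simp only [modeC]; ring

lemma pd_const_mul (e : ℝ × ℝ) (r : ℝ) (f : ℝ × ℝ → ℝ) (hf : ContDiff ℝ ∞ f) :
    pd e (fun p => r * f p) = fun p => r * pd e f p := by
  ext p
  have hd : DifferentiableAt ℝ f p := hf.differentiable (by simp) p
  simp only [pd]
  rw [fderiv_const_mul hd]
  rfl

lemma modeC_mem_TestPer {a b : ℝ} (hb : 0 < b) (i : ℕ × ℤ) : modeC a b i ∈ TestPer b :=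
  ⟨contDiff_modeC a b i, fun x y => by simp [modeC, hy_periodic hb]⟩

lemma modeC_mem_TestBC {a b : ℝ} (ha : 0 < a) (hb : 0 < b) (i : ℕ × ℤ) :
    modeC a b i ∈ TestBC a b := by
  refine ⟨modeC_mem_TestPer hb i, fun y => ?_⟩
  rw [pd_ex_modeC, pd_ex_modeC]
  simp [modeS, sx_left, sx_right ha]

lemma lap_modeC (a b : ℝ) (i : ℕ × ℤ) (p : ℝ × ℝ) :
    pd ex (pd ex (modeC a b i)) p + pd ey (pd ey (modeC a b i)) p
      = -(fx a i.1 ^ 2 + fy b i.2 ^ 2) * modeC a b i p := by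
  obtain ⟨k, l⟩ := i
  have h1 : pd ex (modeC a b (k, l)) = fun p => -fx a k * modeS a b (k, l) p :=
    funext fun p => pd_ex_modeC a b (k, l) p
  have h2 : pd ey (modeC a b (k, l)) = fun p => fy b l * modeC a b (k, -l) p :=
    funext fun p => pd_ey_modeC a b k l p
  rw [h1, h2, pd_const_mul _ _ _ (contDiff_modeS a b _), pd_const_mul _ _ _ (contDiff_modeC a b _)]
  simp only
  rw [pd_ex_modeS, pd_ey_modeC, fy_neg, neg_neg]
  ring

end Modes

/-! ### Hilbert bases of L²(Ω) and Parseval identities -/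

section Bases

variable {a b : ℝ}

lemma mu_eq_prod (a b : ℝ) : mu a b = (volume.restrict (Set.Ioo (-a) a)).prod
    (volume.restrict (Set.Ioo (-b) b)) := by
  rw [mu, Omega, Measure.volume_eq_prod, Measure.prod_restrict]

lemma measurableSet_Omega (a b : ℝ) : MeasurableSet (Omega a b) :=
  measurableSet_Ioo.prod measurableSet_Ioo

lemma exists_bound_Omega (a b : ℝ) {f : ℝ × ℝ → ℝ} (hf : Continuous f) :
    ∃ M, ∀ p ∈ Omega a b, |f p| ≤ M := by
  have hc : IsCompact (Set.Icc (-a) a ×ˢ Set.Icc (-b) b) := isCompact_Icc.prod isCompact_Icc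
  obtain ⟨C, hC⟩ := hc.exists_bound_of_continuousOn hf.continuousOn
  exact ⟨C, fun p hp => hC p ⟨Set.Ioo_subset_Icc_self hp.1, Set.Ioo_subset_Icc_self hp.2⟩⟩

lemma memLp_of_continuous (a b : ℝ) {f : ℝ × ℝ → ℝ} (hf : Continuous f) (r : ENNReal) :
    MemLp f r (mu a b) := by
  obtain ⟨M, hM⟩ := exists_bound_Omega a b hf
  refine MemLp.of_bound hf.aestronglyMeasurable M ?_
  exact (ae_restrict_iff' (measurableSet_Omega a b)).2 (Eventually.of_forall hM)

/-- The class in `L²(Ω)` of a continuous function. -/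
noncomputable def toL2 (a b : ℝ) (f : ℝ × ℝ → ℝ) (hf : Continuous f) : L2 a b :=
  (memLp_of_continuous a b hf 2).toLp f

lemma coeFn_toL2 {f : ℝ × ℝ → ℝ} (hf : Continuous f) : toL2 a b f hf =ᵐ[mu a b] f :=
  MemLp.coeFn_toLp _

lemma inner_toL2 {f : ℝ × ℝ → ℝ} (hf : Continuous f) (u : L2 a b) :
    inner ℝ (toL2 a b f hf) u = ∫ p in Omega a b, u p * f p := by
  rw [L2.inner_def]
  refine integral_congr_ae ?_
  filter_upwards [coeFn_toL2 (a := a) (b := b) hf] with p hp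
  rw [hp]
  simp

/-- Coefficients with respect to `modeC`. -/
noncomputable def coefC (u : L2 a b) (i : ℕ × ℤ) : ℝ := ∫ p in Omega a b, u p * modeC a b i p

/-- Coefficients with respect to `modeS`. -/
noncomputable def coefS (u : L2 a b) (i : ℕ × ℤ) : ℝ := ∫ p in Omega a b, u p * modeS a b i p

lemma inner_eq_zero_of_mem_orthogonal_span {V ι : Type*} [NormedAddCommGroup V]
    [InnerProductSpace ℝ V] {v : ι → V} {u : V} (hu : u ∈ (Submodule.span ℝ (Set.range v))ᗮ)
    (i : ι) : inner ℝ (v i) u = 0 :=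
  hu _ (Submodule.subset_span ⟨i, rfl⟩)

lemma integral_Omega_mul (f g : ℝ → ℝ) : ∫ p in Omega a b, f p.1 * g p.2
    = (∫ x in Set.Ioo (-a) a, f x) * ∫ y in Set.Ioo (-b) b, g y := by
  rw [← integral_prod_mul, ← mu_eq_prod]

lemma eq_zero_of_complete {p : ℕ → ℝ → ℝ} {q : ℤ → ℝ → ℝ} (hpc : ∀ k, Continuous (p k))
    (hqc : ∀ l, Continuous (q l))
    (hp : ∀ g : ℝ → ℝ, IntegrableOn g (Set.Ioo (-a) a) →
      (∀ k, ∫ x in Set.Ioo (-a) a, g x * p k x = 0) →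
      ∀ᵐ x ∂(volume.restrict (Set.Ioo (-a) a)), g x = 0)
    (hq : ∀ g : ℝ → ℝ, IntegrableOn g (Set.Ioo (-b) b) →
      (∀ l, ∫ x in Set.Ioo (-b) b, g x * q l x = 0) →
      ∀ᵐ x ∂(volume.restrict (Set.Ioo (-b) b)), g x = 0)
    {u : L2 a b} (h : ∀ k l, ∫ z in Omega a b, u z * (p k z.1 * q l z.2) = 0) : u = 0 := by
  rw [Lp.eq_zero_iff_ae_eq_zero]
  change ∀ᵐ z ∂(mu a b), u z = 0
  have key : ∀ f : ℝ × ℝ → ℝ, (∀ᵐ z ∂((volume.restrict (Set.Ioo (-a) a)).prod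
      (volume.restrict (Set.Ioo (-b) b))), f z = 0) → ∀ᵐ z ∂(mu a b), f z = 0 :=
    fun f hf => by rwa [mu_eq_prod]
  apply key
  have hi : ∀ f : ℝ × ℝ → ℝ, Continuous f → Integrable (fun z => u z * f z)
      ((volume.restrict (Set.Ioo (-a) a)).prod (volume.restrict (Set.Ioo (-b) b))) := by
    intro f hf
    rw [← mu_eq_prod]
    exact integrable_mul_cont u hf
  refine ae_eq_zero_of_integral_mul_prod hp hq ?_ (fun l => ?_) (fun k l => ?_) (fun k l => ?_)
  · simpa using hi (fun _ => 1) continuous_const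
  · exact hi (fun z => q l z.2) ((hqc l).comp continuous_snd)
  · exact hi _ (((hpc k).comp continuous_fst).mul ((hqc l).comp continuous_snd))
  · rw [← mu_eq_prod]; exact h k l

lemma cx_complete (ha : 0 < a) (g : ℝ → ℝ) (hg : IntegrableOn g (Set.Ioo (-a) a))
    (h : ∀ k, ∫ x in Set.Ioo (-a) a, g x * cx a k x = 0) :
    ∀ᵐ x ∂(volume.restrict (Set.Ioo (-a) a)), g x = 0 := by
  refine ae_eq_zero_of_integral_mul_cos (by linarith) hg fun k => ?_
  have hk := h k
  have hn : (if k = 0 then (√(2 * a))⁻¹ else (√a)⁻¹) ≠ 0 := by split_ifs <;> positivity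
  have e : ∀ x, g x * cx a k x = (if k = 0 then (√(2 * a))⁻¹ else (√a)⁻¹) *
      (g x * Real.cos (k * ang (-a) a x)) := fun x => by rw [cx]; ring
  simp_rw [e] at hk
  rw [integral_const_mul] at hk
  exact (mul_eq_zero.1 hk).resolve_left hn

lemma sx_complete (ha : 0 < a) (g : ℝ → ℝ) (hg : IntegrableOn g (Set.Ioo (-a) a))
    (h : ∀ k, ∫ x in Set.Ioo (-a) a, g x * sx a (k + 1) x = 0) :
    ∀ᵐ x ∂(volume.restrict (Set.Ioo (-a) a)), g x = 0 := by
  refine ae_eq_zero_of_integral_mul_sin (by linarith) hg fun k => ?_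
  rcases k with _ | k
  · simp
  have hk := h k
  have hn : (√a)⁻¹ ≠ 0 := by positivity
  have e : ∀ x, g x * sx a (k + 1) x = (√a)⁻¹ *
      (g x * Real.sin ((k + 1 : ℕ) * ang (-a) a x)) := fun x => by rw [sx]; ring
  simp_rw [e] at hk
  rw [integral_const_mul] at hk
  exact (mul_eq_zero.1 hk).resolve_left hn

lemma hy_complete (hb : 0 < b) (g : ℝ → ℝ) (hg : IntegrableOn g (Set.Ioo (-b) b))
    (h : ∀ l, ∫ x in Set.Ioo (-b) b, g x * hy b l x = 0) :
    ∀ᵐ x ∂(volume.restrict (Set.Ioo (-b) b)), g x = 0 := by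
  refine ae_eq_zero_of_integral_mul_cas hb hg fun l => ?_
  have hl := h l
  have hn : (√(2 * b))⁻¹ ≠ 0 := by positivity
  have e : ∀ x, g x * hy b l x = (√(2 * b))⁻¹ * (g x * cas (l * Real.pi / b * x)) :=
    fun x => by rw [hy]; ring
  simp_rw [e] at hl
  rw [integral_const_mul] at hl
  exact (mul_eq_zero.1 hl).resolve_left hn

lemma orthonormal_prod {p : ℕ → ℝ → ℝ} {q : ℤ → ℝ → ℝ}
    (hp : ∀ j k, ∫ x in Set.Ioo (-a) a, p j x * p k x = if j = k then 1 else 0)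
    (hq : ∀ l m, ∫ y in Set.Ioo (-b) b, q l y * q m y = if l = m then 1 else 0)
    (hc : ∀ i : ℕ × ℤ, Continuous fun z : ℝ × ℝ => p i.1 z.1 * q i.2 z.2) :
    Orthonormal ℝ fun i : ℕ × ℤ => toL2 a b (fun z => p i.1 z.1 * q i.2 z.2) (hc i) := by
  rw [orthonormal_iff_ite]
  intro i j
  rw [inner_toL2]
  have e : ∫ z in Omega a b, toL2 a b _ (hc j) z * (p i.1 z.1 * q i.2 z.2)
      = ∫ z in Omega a b, (p i.1 z.1 * p j.1 z.1) * (q i.2 z.2 * q j.2 z.2) := by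
    refine integral_congr_ae ?_
    filter_upwards [coeFn_toL2 (a := a) (b := b) (hc j)] with z hz
    rw [hz]; ring
  rw [e, integral_Omega_mul (fun x => p i.1 x * p j.1 x) (fun y => q i.2 y * q j.2 y), hp, hq]
  rcases i with ⟨i1, i2⟩
  rcases j with ⟨j1, j2⟩
  by_cases h1 : i1 = j1 <;> by_cases h2 : i2 = j2 <;> simp [h1, h2]

lemma continuous_modeC (a b : ℝ) (i : ℕ × ℤ) : Continuous (modeC a b i) :=
  (contDiff_modeC a b i).continuous

lemma continuous_modeS (a b : ℝ) (i : ℕ × ℤ) : Continuous (modeS a b i) :=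
  (contDiff_modeS a b i).continuous

lemma orthonormal_modeC (ha : 0 < a) (hb : 0 < b) :
    Orthonormal ℝ fun i => toL2 a b (modeC a b i) (continuous_modeC a b i) :=
  orthonormal_prod (p := cx a) (q := hy b) (integral_cx ha) (integral_hy hb)
    (fun i => continuous_modeC a b i)

lemma orthonormal_modeS (ha : 0 < a) (hb : 0 < b) :
    Orthonormal ℝ fun i : ℕ × ℤ => toL2 a b (modeS a b (i.1 + 1, i.2)) (continuous_modeS a b _) :=
  orthonormal_prod (p := fun k => sx a (k + 1)) (q := hy b) (integral_sx ha) (integral_hy hb)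
    (fun i => continuous_modeS a b (i.1 + 1, i.2))

lemma orthogonal_modeC (ha : 0 < a) (hb : 0 < b) :
    (Submodule.span ℝ (Set.range fun i => toL2 a b (modeC a b i) (continuous_modeC a b i)))ᗮ
      = ⊥ := by
  rw [eq_bot_iff]
  intro u hu
  refine eq_zero_of_complete (p := cx a) (q := hy b) (fun k => (contDiff_cx a k).continuous)
    (fun l => (contDiff_hy b l).continuous) (cx_complete ha) (hy_complete hb) fun k l => ?_
  have := inner_eq_zero_of_mem_orthogonal_span hu (k, l)
  rwa [inner_toL2] at this

lemma orthogonal_modeS (ha : 0 < a) (hb : 0 < b) :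
    (Submodule.span ℝ (Set.range fun i : ℕ × ℤ =>
      toL2 a b (modeS a b (i.1 + 1, i.2)) (continuous_modeS a b _)))ᗮ = ⊥ := by
  rw [eq_bot_iff]
  intro u hu
  refine eq_zero_of_complete (p := fun k => sx a (k + 1)) (q := hy b)
    (fun k => (contDiff_sx a _).continuous)
    (fun l => (contDiff_hy b l).continuous) (sx_complete ha) (hy_complete hb) fun k l => ?_
  have := inner_eq_zero_of_mem_orthogonal_span hu (k, l)
  rwa [inner_toL2] at this

/-- The cosine-Hartley basis of `L²(Ω)`. -/
noncomputable def basisC (ha : 0 < a) (hb : 0 < b) : HilbertBasis (ℕ × ℤ) ℝ (L2 a b) :=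
  HilbertBasis.mkOfOrthogonalEqBot (orthonormal_modeC ha hb) (orthogonal_modeC ha hb)

/-- The sine-Hartley basis of `L²(Ω)`. -/
noncomputable def basisS (ha : 0 < a) (hb : 0 < b) : HilbertBasis (ℕ × ℤ) ℝ (L2 a b) :=
  HilbertBasis.mkOfOrthogonalEqBot (orthonormal_modeS ha hb) (orthogonal_modeS ha hb)

lemma basisC_apply (ha : 0 < a) (hb : 0 < b) (i : ℕ × ℤ) :
    basisC ha hb i = toL2 a b (modeC a b i) (continuous_modeC a b i) := by
  rw [basisC, HilbertBasis.coe_mkOfOrthogonalEqBot]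

lemma inner_basisC (ha : 0 < a) (hb : 0 < b) (i : ℕ × ℤ) (u : L2 a b) :
    inner ℝ (basisC ha hb i) u = coefC u i := by
  rw [basisC_apply, inner_toL2, coefC]

lemma inner_basisS (ha : 0 < a) (hb : 0 < b) (i : ℕ × ℤ) (u : L2 a b) :
    inner ℝ (basisS ha hb i) u = coefS u (i.1 + 1, i.2) := by
  have : basisS ha hb i = toL2 a b (modeS a b (i.1 + 1, i.2)) (continuous_modeS a b _) := by
    rw [basisS, HilbertBasis.coe_mkOfOrthogonalEqBot]
  rw [this, inner_toL2, coefS]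

lemma hasSum_coefC (ha : 0 < a) (hb : 0 < b) (u v : L2 a b) :
    HasSum (fun i => coefC u i * coefC v i) (inner ℝ u v) := by
  have := (basisC ha hb).hasSum_inner_mul_inner u v
  simp_rw [real_inner_comm _ u, inner_basisC] at this
  simpa [real_inner_comm] using this

lemma coefS_zero (u : L2 a b) (l : ℤ) : coefS u (0, l) = 0 := by
  simp [coefS, modeS, sx]

lemma hasSum_coefS (ha : 0 < a) (hb : 0 < b) (u v : L2 a b) :
    HasSum (fun i => coefS u i * coefS v i) (inner ℝ u v) := by
  have := (basisS ha hb).hasSum_inner_mul_inner u v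
  simp_rw [real_inner_comm _ u, inner_basisS] at this
  have hinj : Function.Injective fun i : ℕ × ℤ => (i.1 + 1, i.2) := by
    rintro ⟨i, l⟩ ⟨j, m⟩ h
    simpa using h
  rw [real_inner_comm]
  -- The sine basis starts at frequency one; the added row k = 0 consists of zeros, so both bases
  -- share one index set.
  refine (hinj.hasSum_iff ?_).1 this
  rintro ⟨k, l⟩ hk
  rcases k with _ | k
  · simp [coefS_zero]
  · exact absurd ⟨(k, l), rfl⟩ hk

end Bases

/-! ### Integration by parts against modes that vanish only at x = ±a -/

section Cutoff

/-- A smooth function equal to one where `2 ≤ n (r² - x²)` and vanishing where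
`n (r² - x²) ≤ 1`. -/
noncomputable def cut (r : ℝ) (n : ℕ) (x : ℝ) : ℝ := Real.smoothTransition (n * (r ^ 2 - x ^ 2) - 1)

lemma contDiff_cut (r : ℝ) (n : ℕ) : ContDiff ℝ ∞ (cut r n) := by
  unfold cut
  exact Real.smoothTransition.contDiff.comp (by fun_prop)

lemma cut_nonneg (r : ℝ) (n : ℕ) (x : ℝ) : 0 ≤ cut r n x := Real.smoothTransition.nonneg _

lemma cut_le_one (r : ℝ) (n : ℕ) (x : ℝ) : cut r n x ≤ 1 := Real.smoothTransition.le_one _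

lemma abs_cut_le_one (r : ℝ) (n : ℕ) (x : ℝ) : |cut r n x| ≤ 1 := by
  rw [abs_of_nonneg (cut_nonneg r n x)]; exact cut_le_one r n x

lemma le_of_cut_ne_zero {r : ℝ} {n : ℕ} {x : ℝ} (h : cut r n x ≠ 0) : 1 ≤ n * (r ^ 2 - x ^ 2) := by
  by_contra! hlt
  exact h (Real.smoothTransition.zero_of_nonpos (by linarith))

lemma deriv_smoothTransition_eq_zero {t : ℝ} (ht : t < 0 ∨ 1 < t) :
    deriv Real.smoothTransition t = 0 := by
  rcases ht with ht | ht
  · have : Real.smoothTransition =ᶠ[𝓝 t] fun _ => 0 := by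
      filter_upwards [gt_mem_nhds ht] with s hs
      exact Real.smoothTransition.zero_of_nonpos hs.le
    rw [this.deriv_eq, deriv_const]
  · have : Real.smoothTransition =ᶠ[𝓝 t] fun _ => 1 := by
      filter_upwards [lt_mem_nhds ht] with s hs
      exact Real.smoothTransition.one_of_one_le hs.le
    rw [this.deriv_eq, deriv_const]

lemma exists_bound_deriv_smoothTransition :
    ∃ M, 0 ≤ M ∧ ∀ t, |deriv Real.smoothTransition t| ≤ M := by
  have hc : Continuous (deriv Real.smoothTransition) :=
    (Real.smoothTransition.contDiff (n := ⊤)).continuous_deriv (by simp)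
  obtain ⟨M, hM⟩ := (isCompact_Icc (a := (0 : ℝ)) (b := 1)).exists_bound_of_continuousOn
    hc.continuousOn
  refine ⟨|M|, abs_nonneg _, fun t => ?_⟩
  by_cases ht : t ∈ Set.Icc (0 : ℝ) 1
  · exact (hM t ht).trans (le_abs_self _)
  · rw [deriv_smoothTransition_eq_zero, abs_zero]
    · exact abs_nonneg _
    · rw [Set.mem_Icc, not_and_or, not_le, not_le] at ht
      exact ht

/-- The derivative of `cut`. -/
noncomputable def cutD (r : ℝ) (n : ℕ) (x : ℝ) : ℝ :=
  deriv Real.smoothTransition (n * (r ^ 2 - x ^ 2) - 1) * (n * (-(2 * x)))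

lemma hasDerivAt_cut (r : ℝ) (n : ℕ) (x : ℝ) : HasDerivAt (cut r n) (cutD r n x) x := by
  have h1 : HasDerivAt (fun x : ℝ => n * (r ^ 2 - x ^ 2) - 1) (n * (-(2 * x))) x := by
    have h := (((hasDerivAt_id x).pow 2).const_sub (r ^ 2)).const_mul (n : ℝ)
    have h' := h.sub_const 1
    refine h'.congr_deriv ?_
    simp
  have h2 : HasDerivAt Real.smoothTransition
      (deriv Real.smoothTransition (n * (r ^ 2 - x ^ 2) - 1)) (n * (r ^ 2 - x ^ 2) - 1) :=
    ((Real.smoothTransition.contDiff (n := ⊤)).differentiable (by simp) _).hasDerivAt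
  exact h2.comp x h1

/-- The derivative vanishes once n(r² - x²) > 2. Elsewhere the distance factor cancels the factor n,
so the bound does not depend on n. -/
lemma mul_abs_cutD_le {r : ℝ} (hr : 0 < r) {M : ℝ} (hM0 : 0 ≤ M)
    (hM : ∀ t, |deriv Real.smoothTransition t| ≤ M) (n : ℕ) {x : ℝ} (hx : x ∈ Set.Ioo (-r) r) :
    (r ^ 2 - x ^ 2) * |cutD r n x| ≤ 4 * M * r := by
  have hx0 : |x| ≤ r := abs_le.2 ⟨hx.1.le, hx.2.le⟩
  have hsq : 0 ≤ r ^ 2 - x ^ 2 := by nlinarith [hx.1, hx.2]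
  by_cases h : 1 < n * (r ^ 2 - x ^ 2) - 1
  · rw [cutD, deriv_smoothTransition_eq_zero (Or.inr h)]
    simp; positivity
  · rw [cutD, abs_mul, abs_mul, abs_neg, abs_mul, abs_two, Nat.abs_cast]
    calc (r ^ 2 - x ^ 2) * (|deriv Real.smoothTransition (n * (r ^ 2 - x ^ 2) - 1)|
          * (n * (2 * |x|)))
        = |deriv Real.smoothTransition (n * (r ^ 2 - x ^ 2) - 1)| *
          ((n * (r ^ 2 - x ^ 2)) * (2 * |x|)) := by ring
      _ ≤ M * (2 * (2 * r)) := by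
        have h1 : n * (r ^ 2 - x ^ 2) ≤ 2 := by linarith
        have h2 : (0 : ℝ) ≤ n * (r ^ 2 - x ^ 2) := by positivity
        gcongr
        exact hM _
      _ = 4 * M * r := by ring

lemma eventually_cut {r x : ℝ} (hx : x ∈ Set.Ioo (-r) r) :
    ∀ᶠ n : ℕ in atTop, cut r n x = 1 ∧ cutD r n x = 0 := by
  have hsq : 0 < r ^ 2 - x ^ 2 := by nlinarith [hx.1, hx.2]
  have ht : Tendsto (fun n : ℕ => (n : ℝ) * (r ^ 2 - x ^ 2)) atTop atTop :=
    tendsto_natCast_atTop_atTop.atTop_mul_const hsq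
  filter_upwards [ht.eventually_gt_atTop 2] with n hn
  refine ⟨Real.smoothTransition.one_of_one_le (by linarith), ?_⟩
  rw [cutD, deriv_smoothTransition_eq_zero (Or.inr (by linarith)), zero_mul]

variable {a b : ℝ}

lemma cut_mul_mem_TestC {f : ℝ × ℝ → ℝ} (hf : ContDiff ℝ ∞ f) (ha : 0 < a) (hb : 0 < b)
    (n : ℕ) : (fun p => f p * (cut a n p.1 * cut b n p.2)) ∈ TestC a b := by
  set A : Set (ℝ × ℝ) := {p | 1 ≤ n * (a ^ 2 - p.1 ^ 2) ∧ 1 ≤ n * (b ^ 2 - p.2 ^ 2)} with hA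
  have hAc : IsClosed A := by
    refine IsClosed.inter ?_ ?_
    · exact isClosed_le continuous_const
        (by fun_prop : Continuous fun p : ℝ × ℝ => n * (a ^ 2 - p.1 ^ 2))
    · exact isClosed_le continuous_const
        (by fun_prop : Continuous fun p : ℝ × ℝ => n * (b ^ 2 - p.2 ^ 2))
  have key : ∀ {r x : ℝ}, 0 < r → 1 ≤ n * (r ^ 2 - x ^ 2) → x ∈ Set.Ioo (-r) r := by
    intro r x hr h
    have h1 : 0 < r ^ 2 - x ^ 2 := by
      by_contra! hneg
      have := mul_nonpos_of_nonneg_of_nonpos (Nat.cast_nonneg (α := ℝ) n) hneg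
      linarith
    exact abs_lt.1 (abs_lt_of_sq_lt_sq (by linarith) hr.le)
  have hAO : A ⊆ Omega a b := fun p hp => ⟨key ha hp.1, key hb hp.2⟩
  have hAcomp : IsCompact A := by
    refine (isCompact_Icc.prod isCompact_Icc : IsCompact
      (Set.Icc (-a) a ×ˢ Set.Icc (-b) b)).of_isClosed_subset hAc fun p hp => ?_
    exact ⟨Set.Ioo_subset_Icc_self (hAO hp).1, Set.Ioo_subset_Icc_self (hAO hp).2⟩
  have hsupp : Function.support (fun p => f p * (cut a n p.1 * cut b n p.2)) ⊆ A := by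
    intro p hp
    have h1 := right_ne_zero_of_mul hp
    exact ⟨le_of_cut_ne_zero (left_ne_zero_of_mul h1), le_of_cut_ne_zero (right_ne_zero_of_mul h1)⟩
  have hts : tsupport (fun p => f p * (cut a n p.1 * cut b n p.2)) ⊆ A :=
    closure_minimal hsupp hAc
  refine ⟨?_, hAcomp.of_isClosed_subset (isClosed_tsupport _) hts, hts.trans hAO⟩
  exact hf.mul (((contDiff_cut a n).comp contDiff_fst).mul ((contDiff_cut b n).comp contDiff_snd))

lemma pd_mul (e : ℝ × ℝ) {f g : ℝ × ℝ → ℝ} (hf : ContDiff ℝ ∞ f) (hg : ContDiff ℝ ∞ g)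
    (p : ℝ × ℝ) : pd e (fun p => f p * g p) p = f p * pd e g p + g p * pd e f p := by
  have h := ((hf.differentiable (by simp) p).hasFDerivAt).mul
    ((hg.differentiable (by simp) p).hasFDerivAt)
  have h' : HasFDerivAt (fun p => f p * g p) _ p := h
  rw [pd, h'.fderiv]
  simp [pd]

/-- Weak `x`-derivatives may be tested with functions that merely vanish at `x = ±a`. -/
lemma ByParts.ex_of_vanishing {u g : L2 a b} (ha : 0 < a) (hb : 0 < b)
    (h : ByParts a b (TestC a b) ex u g) {f : ℝ × ℝ → ℝ} (hf : ContDiff ℝ ∞ f) {K : ℝ}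
    (hK : 0 ≤ K) (hfK : ∀ p ∈ Omega a b, |f p| ≤ K * (a ^ 2 - p.1 ^ 2)) :
    ∫ p in Omega a b, g p * f p = -∫ p in Omega a b, u p * pd ex f p := by
  obtain ⟨M, hM0, hM⟩ := exists_bound_deriv_smoothTransition
  have hpd : ∀ n p, pd ex (fun p => f p * (cut a n p.1 * cut b n p.2)) p
      = f p * (cutD a n p.1 * cut b n p.2) + cut a n p.1 * cut b n p.2 * pd ex f p := by
    intro n p
    have hc : ContDiff ℝ ∞ fun p : ℝ × ℝ => cut a n p.1 * cut b n p.2 :=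
      ((contDiff_cut a n).comp contDiff_fst).mul ((contDiff_cut b n).comp contDiff_snd)
    rw [pd_mul ex hf hc, pd_ex_prod (hasDerivAt_cut a n p.1)
      (hasDerivAt_cut b n p.2).differentiableAt]
  have hEq : ∀ n, ∫ p in Omega a b, g p * (f p * (cut a n p.1 * cut b n p.2))
      = -∫ p in Omega a b, u p * (f p * (cutD a n p.1 * cut b n p.2)
        + cut a n p.1 * cut b n p.2 * pd ex f p) := by
    intro n
    rw [h _ (cut_mul_mem_TestC hf ha hb n)]
    simp_rw [hpd]
  have hcutc : ∀ r n, Continuous (cut r n) := fun r n => (contDiff_cut r n).continuous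
  have hcutDc : ∀ r n, Continuous (cutD r n) := fun r n => by
    have : cutD r n = deriv (cut r n) := funext fun x => (hasDerivAt_cut r n x).deriv.symm
    rw [this]
    exact (contDiff_cut r n).continuous_deriv (by simp)
  have hfc := hf.continuous
  have hpfc := continuous_pd hf ex
  have h1 : Tendsto (fun n : ℕ => ∫ p in Omega a b, g p * (f p * (cut a n p.1 * cut b n p.2)))
      atTop (𝓝 (∫ p in Omega a b, g p * f p)) := by
    refine tendsto_integral_of_dominated_convergence (fun p => ‖g p * f p‖) (fun n => ?_)
      (integrable_mul_cont g hfc).norm (fun n => ?_) ?_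
    · exact (integrable_mul_cont g (by fun_prop)).aestronglyMeasurable
    · refine Eventually.of_forall fun p => ?_
      rw [← mul_assoc, norm_mul]
      refine mul_le_of_le_one_right (norm_nonneg _) ?_
      rw [Real.norm_eq_abs, abs_mul]
      exact mul_le_one₀ (abs_cut_le_one _ _ _) (abs_nonneg _) (abs_cut_le_one _ _ _)
    · filter_upwards [ae_restrict_mem (measurableSet_Omega a b)] with p hp
      refine tendsto_const_nhds.congr' ?_
      filter_upwards [eventually_cut hp.1, eventually_cut hp.2] with n hn1 hn2
      rw [hn1.1, hn2.1, mul_one, mul_one]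
  -- Only the x-cutoff is differentiated. Its derivative grows like 1/(a² - x²), which the decay of
  -- `f` compensates; it is eventually zero at each point, so dominated convergence removes it. The
  -- y-cutoff needs no decay.
  have h2 : Tendsto (fun n : ℕ => ∫ p in Omega a b, u p * (f p * (cutD a n p.1 * cut b n p.2)
      + cut a n p.1 * cut b n p.2 * pd ex f p)) atTop (𝓝 (∫ p in Omega a b, u p * pd ex f p)) := by
    refine tendsto_integral_of_dominated_convergence
      (fun p => ‖u p * (K * (4 * M * a) + |pd ex f p|)‖) (fun n => ?_)
      (integrable_mul_cont u (by fun_prop)).norm (fun n => ?_) ?_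
    · exact (integrable_mul_cont u (by fun_prop)).aestronglyMeasurable
    · filter_upwards [ae_restrict_mem (measurableSet_Omega a b)] with p hp
      rw [norm_mul, norm_mul]
      refine mul_le_mul_of_nonneg_left ?_ (norm_nonneg _)
      refine le_trans ?_ (le_abs_self _)
      refine (norm_add_le _ _).trans (add_le_add ?_ ?_)
      · rw [norm_mul, norm_mul]
        calc |f p| * (|cutD a n p.1| * |cut b n p.2|)
            ≤ (K * (a ^ 2 - p.1 ^ 2)) * (|cutD a n p.1| * 1) := by
              gcongr
              · exact (abs_nonneg _).trans (hfK p hp)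
              · exact hfK p hp
              · exact abs_cut_le_one _ _ _
          _ = K * ((a ^ 2 - p.1 ^ 2) * |cutD a n p.1|) := by ring
          _ ≤ K * (4 * M * a) := by
              exact mul_le_mul_of_nonneg_left (mul_abs_cutD_le ha hM0 hM n hp.1) hK
      · rw [norm_mul, norm_mul]
        exact mul_le_of_le_one_left (norm_nonneg _)
          (mul_le_one₀ (abs_cut_le_one _ _ _) (abs_nonneg _) (abs_cut_le_one _ _ _))
    · filter_upwards [ae_restrict_mem (measurableSet_Omega a b)] with p hp
      refine tendsto_const_nhds.congr' ?_
      filter_upwards [eventually_cut hp.1, eventually_cut hp.2] with n hn1 hn2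
      rw [hn1.1, hn2.1, hn1.2]
      ring
  have h3 := h2.neg
  simp_rw [← hEq] at h3
  exact tendsto_nhds_unique h1 h3

lemma exists_bound_cx (a : ℝ) (k : ℕ) (x : ℝ) : |cx a k x| ≤ (√(2 * a))⁻¹ + (√a)⁻¹ := by
  rw [cx, abs_mul]
  have h1 : |if k = 0 then (√(2 * a))⁻¹ else (√a)⁻¹| ≤ (√(2 * a))⁻¹ + (√a)⁻¹ := by
    have h1 : 0 ≤ (√(2 * a))⁻¹ := by positivity
    have h2 : 0 ≤ (√a)⁻¹ := by positivity
    split_ifs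
    · rw [abs_of_nonneg h1]; linarith
    · rw [abs_of_nonneg h2]; linarith
  exact (mul_le_of_le_one_right (abs_nonneg _) (Real.abs_cos_le_one _)).trans h1

lemma exists_bound_hy (b : ℝ) (l : ℤ) (y : ℝ) : |hy b l y| ≤ (√(2 * b))⁻¹ * 2 := by
  rw [hy, abs_mul, abs_of_nonneg (by positivity : 0 ≤ (√(2 * b))⁻¹)]
  gcongr
  refine (abs_add_le _ _).trans ?_
  linarith [Real.abs_cos_le_one (l * Real.pi / b * y), Real.abs_sin_le_one (l * Real.pi / b * y)]

lemma exists_bound_modeC (a b : ℝ) : ∃ B, 0 ≤ B ∧ ∀ i p, |modeC a b i p| ≤ B := by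
  refine ⟨((√(2 * a))⁻¹ + (√a)⁻¹) * ((√(2 * b))⁻¹ * 2), by positivity, fun i p => ?_⟩
  rw [modeC, abs_mul]
  gcongr
  · exact exists_bound_cx _ _ _
  · exact exists_bound_hy _ _ _

/-- The sine is Lipschitz and vanishes at both endpoints. On each half of the interval, the distance
to the nearer endpoint is at most (a² - x²)/a. -/
lemma exists_bound_sx (ha : 0 < a) (k : ℕ) :
    ∃ K, 0 ≤ K ∧ ∀ x ∈ Set.Ioo (-a) a, |sx a k x| ≤ K * (a ^ 2 - x ^ 2) := by
  set N := |fx a k| * ((√(2 * a))⁻¹ + (√a)⁻¹) with hN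
  have hN0 : 0 ≤ N := by positivity
  have hlip : ∀ x y, |sx a k x - sx a k y| ≤ N * |x - y| := by
    intro x y
    have := Convex.norm_image_sub_le_of_norm_hasDerivWithin_le (s := Set.univ) (C := N)
      (f := sx a k) (f' := fun x => fx a k * cx a k x) (x := y) (y := x)
      (fun z _ => (hasDerivAt_sx k z).hasDerivWithinAt)
      (fun z _ => by
        rw [norm_mul]
        exact mul_le_mul_of_nonneg_left (exists_bound_cx a k z) (norm_nonneg _))
      convex_univ trivial trivial
    exact this
  refine ⟨N / a, by positivity, fun x hx => ?_⟩
  have hr := hlip x a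
  have hl := hlip x (-a)
  rw [sx_right ha, sub_zero, abs_of_nonpos (by linarith [hx.2] : x - a ≤ 0)] at hr
  rw [sx_left, sub_zero, abs_of_nonneg (by linarith [hx.1] : 0 ≤ x - -a)] at hl
  have e : N / a * (a ^ 2 - x ^ 2) = N * ((a - x) * (a + x) / a) := by ring
  rw [e]
  have h1 : 0 < a - x := by linarith [hx.2]
  have h2 : 0 < a + x := by linarith [hx.1]
  rcases le_total 0 x with h0 | h0
  · refine hr.trans (mul_le_mul_of_nonneg_left ?_ hN0)
    rw [le_div_iff₀ ha]; nlinarith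
  · refine hl.trans (mul_le_mul_of_nonneg_left ?_ hN0)
    rw [le_div_iff₀ ha]; nlinarith

lemma exists_bound_modeS (ha : 0 < a) (b : ℝ) (i : ℕ × ℤ) :
    ∃ K, 0 ≤ K ∧ ∀ p ∈ Omega a b, |modeS a b i p| ≤ K * (a ^ 2 - p.1 ^ 2) := by
  obtain ⟨K, hK, h⟩ := exists_bound_sx ha i.1
  refine ⟨K * ((√(2 * b))⁻¹ * 2), by positivity, fun p hp => ?_⟩
  rw [modeS, abs_mul]
  calc |sx a i.1 p.1| * |hy b i.2 p.2| ≤ (K * (a ^ 2 - p.1 ^ 2)) * ((√(2 * b))⁻¹ * 2) := by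
        gcongr
        · exact (abs_nonneg _).trans (h _ hp.1)
        · exact h _ hp.1
        · exact exists_bound_hy _ _ _
    _ = _ := by ring

end Cutoff

/-! ### Derivatives as Fourier multipliers; the Laplacian controls the H²-norm -/

section Coefficients

variable {a b : ℝ}

lemma integral_mul_const_mul (u : L2 a b) (r : ℝ) (f : ℝ × ℝ → ℝ) :
    ∫ p in Omega a b, u p * (r * f p) = r * ∫ p in Omega a b, u p * f p := by
  rw [← integral_const_mul]
  congr 1
  ext p
  ring

/-- Sine modes vanish at x = ±a, so the interior weak derivative suffices and no boundary condition
on `u` is used. -/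
lemma coefS_of_byParts {u g : L2 a b} (ha : 0 < a) (hb : 0 < b)
    (h : ByParts a b (TestC a b) ex u g) (i : ℕ × ℤ) : coefS g i = -(fx a i.1 * coefC u i) := by
  obtain ⟨K, hK, hb'⟩ := exists_bound_modeS ha b i
  rw [coefS, h.ex_of_vanishing ha hb (contDiff_modeS a b i) hK hb', coefC]
  simp_rw [pd_ex_modeS]
  rw [integral_mul_const_mul]

/-- The modes do not vanish on the boundary, so the relation must hold against all periodic test
functions. This is how periodicity of w and of w_y enters; the Neumann condition enters in the same
way in `coefC_of_byParts_ex`. -/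
lemma coefC_of_byParts_ey {u g : L2 a b} (hb : 0 < b)
    (h : ByParts a b (TestPer b) ey u g) (k : ℕ) (l : ℤ) :
    coefC g (k, l) = -(fy b l * coefC u (k, -l)) := by
  rw [coefC, h _ (modeC_mem_TestPer hb (k, l)), coefC]
  simp_rw [pd_ey_modeC]
  rw [integral_mul_const_mul]

lemma coefC_of_byParts_ex {u g : L2 a b} (hb : 0 < b)
    (h : ByParts a b (TestPer b) ex u g) (i : ℕ × ℤ) :
    coefC g i = fx a i.1 * coefS u i := by
  rw [coefC, h _ (modeC_mem_TestPer hb i), coefS]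
  simp_rw [pd_ex_modeC]
  rw [integral_mul_const_mul]
  ring

lemma coefC_add (u v : L2 a b) (i : ℕ × ℤ) : coefC (u + v) i = coefC u i + coefC v i :=
  integral_add_mul u v (continuous_modeC a b i)

/-- The partial derivative named by `k`, as a continuous linear map. -/
noncomputable def DL (a b : ℝ) (k : Jet) : X a b →L[ℝ] L2 a b :=
  (PiLp.proj 2 (fun _ : Jet => L2 a b) k).comp (X a b).subtypeL

lemma DL_apply (k : Jet) (w : X a b) : DL a b k w = (w : JetL2 a b) k := rfl

/-- The Laplacian as a continuous linear map. -/
noncomputable def lapL (a b : ℝ) : X a b →L[ℝ] L2 a b := DL a b Jet.xx + DL a b Jet.yy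

lemma isH2_X (w : X a b) : IsH2 a b (w : JetL2 a b) := w.2.1

lemma isBC_X (w : X a b) : IsBC a b (w : JetL2 a b) := w.2.2.1

lemma mean_X (w : X a b) : ∫ p in Omega a b, DL a b Jet.o w p = 0 := w.2.2.2

lemma coefS_x (ha : 0 < a) (hb : 0 < b) (w : X a b) (i : ℕ × ℤ) :
    coefS (DL a b Jet.x w) i = -(fx a i.1 * coefC (DL a b Jet.o w) i) :=
  coefS_of_byParts ha hb (isH2_X w).o_x i

lemma coefC_y (hb : 0 < b) (w : X a b) (k : ℕ) (l : ℤ) :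
    coefC (DL a b Jet.y w) (k, l) = -(fy b l * coefC (DL a b Jet.o w) (k, -l)) :=
  coefC_of_byParts_ey hb (isBC_X w).per k l

lemma coefC_yy (hb : 0 < b) (w : X a b) (i : ℕ × ℤ) :
    coefC (DL a b Jet.yy w) i = -(fy b i.2 ^ 2 * coefC (DL a b Jet.o w) i) := by
  obtain ⟨k, l⟩ := i
  have := coefC_of_byParts_ey hb (isBC_X w).per_y k l
  rw [DL_apply, this, ← DL_apply, coefC_y hb, fy_neg, neg_neg]
  ring

lemma coefC_xx (ha : 0 < a) (hb : 0 < b) (w : X a b) (i : ℕ × ℤ) :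
    coefC (DL a b Jet.xx w) i = -(fx a i.1 ^ 2 * coefC (DL a b Jet.o w) i) := by
  have := coefC_of_byParts_ex hb (isBC_X w).neumann i
  rw [DL_apply, this, ← DL_apply, coefS_x ha hb]
  ring

lemma coefS_xy (ha : 0 < a) (hb : 0 < b) (w : X a b) (k : ℕ) (l : ℤ) :
    coefS (DL a b Jet.xy w) (k, l) = fx a k * fy b l * coefC (DL a b Jet.o w) (k, -l) := by
  have := coefS_of_byParts ha hb (isH2_X w).y_x (k, l)
  rw [DL_apply, this, ← DL_apply, coefC_y hb]
  ring

/-- The eigenvalues of `-Δ`. -/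
noncomputable def eig (a b : ℝ) (i : ℕ × ℤ) : ℝ := fx a i.1 ^ 2 + fy b i.2 ^ 2

lemma coefC_lap (ha : 0 < a) (hb : 0 < b) (w : X a b) (i : ℕ × ℤ) :
    coefC (lapL a b w) i = -(eig a b i * coefC (DL a b Jet.o w) i) := by
  rw [lapL, add_apply, coefC_add, coefC_xx ha hb, coefC_yy hb, eig]
  ring

lemma coefC_zero (w : X a b) : coefC (DL a b Jet.o w) (0, 0) = 0 := by
  have e : ∀ p, modeC a b (0, 0) p = (√(2 * a))⁻¹ * (√(2 * b))⁻¹ := by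
    intro p
    simp [modeC, cx, hy, cas]
  simp_rw [coefC, e]
  rw [integral_mul_const, mean_X w, zero_mul]

/-- Away from the origin k² + l² ≥ 1, hence k² + l² ≥ (1 + k²)/2, and likewise for l. Multiplying
the two bounds makes eig⁻² summable over both indices. -/
lemma exists_eig_bound (ha : 0 < a) (hb : 0 < b) : ∃ m > 0, ∀ i : ℕ × ℤ, i ≠ (0, 0) →
    m * (1 + (i.1 : ℝ) ^ 2) ≤ eig a b i ∧ m * (1 + (i.2 : ℝ) ^ 2) ≤ eig a b i := by
  have hpi := Real.pi_pos
  set A := (Real.pi / (2 * a)) ^ 2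
  set B := (Real.pi / b) ^ 2
  have hA : 0 < A := by positivity
  have hB : 0 < B := by positivity
  refine ⟨min A B / 2, by positivity, fun ⟨k, l⟩ hi => ?_⟩
  have e : eig a b (k, l) = A * (k : ℝ) ^ 2 + B * (l : ℝ) ^ 2 := by
    simp only [eig, fx, fy, A, B]; ring
  have h1 : (1 : ℝ) ≤ (k : ℝ) ^ 2 + (l : ℝ) ^ 2 := by
    by_cases hk : k = 0
    · have hl : l ≠ 0 := fun hl => hi (by rw [hk, hl])
      have : (1 : ℤ) ≤ l ^ 2 := by
        have := sq_nonneg l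
        have : l ^ 2 ≠ 0 := pow_ne_zero 2 hl
        omega
      have h' : (1 : ℝ) ≤ (l : ℝ) ^ 2 := by exact_mod_cast this
      nlinarith [sq_nonneg (k : ℝ)]
    · have : (1 : ℝ) ≤ k := by exact_mod_cast Nat.one_le_iff_ne_zero.2 hk
      nlinarith [sq_nonneg (l : ℝ)]
  have h2 : min A B * ((k : ℝ) ^ 2 + (l : ℝ) ^ 2) ≤ eig a b (k, l) := by
    rw [e, mul_add]
    gcongr
    · exact min_le_left _ _
    · exact min_le_right _ _
  have hm : 0 < min A B := lt_min hA hB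
  constructor
  · refine le_trans ?_ h2
    have : min A B / 2 * (1 + (k : ℝ) ^ 2) = min A B * ((1 + (k : ℝ) ^ 2) / 2) := by ring
    simp only
    rw [this]
    gcongr
    nlinarith [sq_nonneg (l : ℝ)]
  · refine le_trans ?_ h2
    have : min A B / 2 * (1 + (l : ℝ) ^ 2) = min A B * ((1 + (l : ℝ) ^ 2) / 2) := by ring
    simp only
    rw [this]
    gcongr
    nlinarith [sq_nonneg (k : ℝ)]

lemma hasSum_sq_coefC (ha : 0 < a) (hb : 0 < b) (u : L2 a b) :
    HasSum (fun i => coefC u i ^ 2) (‖u‖ ^ 2) := by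
  have := hasSum_coefC ha hb u u
  simpa [← sq, real_inner_self_eq_norm_sq] using this

lemma hasSum_sq_coefS (ha : 0 < a) (hb : 0 < b) (u : L2 a b) :
    HasSum (fun i => coefS u i ^ 2) (‖u‖ ^ 2) := by
  have := hasSum_coefS ha hb u u
  simpa [← sq, real_inner_self_eq_norm_sq] using this

/-- Reflection of the second frequency. -/
def negSnd : ℕ × ℤ ≃ ℕ × ℤ := (Equiv.refl ℕ).prodCongr (Equiv.neg ℤ)

lemma negSnd_apply (k : ℕ) (l : ℤ) : negSnd (k, l) = (k, -l) := rfl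

/-- The square norm of each derivative is a weighted sum of the squared coefficients. -/
lemma hasSum_norm_sq (ha : 0 < a) (hb : 0 < b) (k : Jet) : ∃ z : ℕ × ℤ → ℝ,
    (∀ i, z i ≤ (1 + eig a b i) ^ 2) ∧ ∀ w : X a b,
      HasSum (fun i => z i * coefC (DL a b Jet.o w) i ^ 2) (‖DL a b k w‖ ^ 2) := by
  have hX : ∀ i, 0 ≤ fx a i ^ 2 := fun _ => sq_nonneg _
  have hY : ∀ i, 0 ≤ fy b i ^ 2 := fun _ => sq_nonneg _
  cases k with
  | o =>
    refine ⟨fun _ => 1, fun i => ?_, fun w => ?_⟩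
    · rw [eig]; nlinarith [hX i.1, hY i.2]
    · simpa using hasSum_sq_coefC ha hb (DL a b Jet.o w)
  | x =>
    refine ⟨fun i => fx a i.1 ^ 2, fun i => ?_, fun w => ?_⟩
    · rw [eig]; nlinarith [hX i.1, hY i.2, mul_nonneg (hX i.1) (hY i.2)]
    · convert hasSum_sq_coefS ha hb (DL a b Jet.x w) using 2 with i
      rw [coefS_x ha hb]; ring
  | y =>
    refine ⟨fun i => fy b i.2 ^ 2, fun i => ?_, fun w => ?_⟩
    · rw [eig]; nlinarith [hX i.1, hY i.2, mul_nonneg (hX i.1) (hY i.2)]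
    · have h := negSnd.hasSum_iff.2 (hasSum_sq_coefC ha hb (DL a b Jet.y w))
      convert h using 2 with i
      obtain ⟨k, l⟩ := i
      simp only [Function.comp_apply, negSnd_apply]
      rw [coefC_y hb, neg_neg, fy_neg]; ring
  | xx =>
    refine ⟨fun i => fx a i.1 ^ 4, fun i => ?_, fun w => ?_⟩
    · rw [eig]; nlinarith [hX i.1, hY i.2, mul_nonneg (hX i.1) (hY i.2)]
    · convert hasSum_sq_coefC ha hb (DL a b Jet.xx w) using 2 with i
      rw [coefC_xx ha hb]; ring
  | xy =>
    refine ⟨fun i => fx a i.1 ^ 2 * fy b i.2 ^ 2, fun i => ?_, fun w => ?_⟩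
    · rw [eig]; nlinarith [hX i.1, hY i.2, mul_nonneg (hX i.1) (hY i.2)]
    · have h := negSnd.hasSum_iff.2 (hasSum_sq_coefS ha hb (DL a b Jet.xy w))
      convert h using 2 with i
      obtain ⟨k, l⟩ := i
      simp only [Function.comp_apply, negSnd_apply]
      rw [coefS_xy ha hb, neg_neg, fy_neg]; ring
  | yy =>
    refine ⟨fun i => fy b i.2 ^ 4, fun i => ?_, fun w => ?_⟩
    · rw [eig]; nlinarith [hX i.1, hY i.2, mul_nonneg (hX i.1) (hY i.2)]
    · convert hasSum_sq_coefC ha hb (DL a b Jet.yy w) using 2 with i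
      rw [coefC_yy hb]; ring

/-- `∫ w_xx w_yy = ∫ w_xy²` for `w ∈ X`. -/
lemma inner_xx_yy (ha : 0 < a) (hb : 0 < b) (w : X a b) :
    inner ℝ (DL a b Jet.xx w) (DL a b Jet.yy w) = ‖DL a b Jet.xy w‖ ^ 2 := by
  have h1 := hasSum_coefC ha hb (DL a b Jet.xx w) (DL a b Jet.yy w)
  have h2 := negSnd.hasSum_iff.2 (hasSum_sq_coefS ha hb (DL a b Jet.xy w))
  refine h1.unique ?_
  convert h2 using 2 with i
  obtain ⟨k, l⟩ := i
  simp only [Function.comp_apply, negSnd_apply]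
  rw [coefS_xy ha hb, neg_neg, fy_neg, coefC_xx ha hb, coefC_yy hb]
  ring

/-- The Laplacian controls the `H²`-norm on `X`. -/
lemma exists_norm_le_lap (ha : 0 < a) (hb : 0 < b) :
    ∃ C > 0, ∀ w : X a b, ‖w‖ ≤ C * ‖lapL a b w‖ := by
  obtain ⟨m, hm, hq⟩ := exists_eig_bound ha hb
  have hk : ∀ (k : Jet) (w : X a b),
      ‖DL a b k w‖ ^ 2 ≤ (1 + m⁻¹) ^ 2 * ‖lapL a b w‖ ^ 2 := by
    intro k w
    obtain ⟨z, hz, hs⟩ := hasSum_norm_sq ha hb k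
    refine hasSum_le (fun i => ?_) (hs w)
      ((hasSum_sq_coefC ha hb (lapL a b w)).mul_left ((1 + m⁻¹) ^ 2))
    rw [coefC_lap ha hb]
    -- The constant mode, where the eigenvalue is zero, is absent because w has mean zero. All other
    -- eigenvalues are at least m, so 1 + eig is at most a multiple of eig.
    by_cases hi : i = (0, 0)
    · rw [hi, coefC_zero]; simp
    · have h1 : m ≤ eig a b i := by nlinarith [(hq i hi).1, sq_nonneg (i.1 : ℝ)]
      have h2 : 1 + eig a b i ≤ (1 + m⁻¹) * eig a b i := by
        have : 1 ≤ m⁻¹ * eig a b i := by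
          rw [inv_mul_eq_div, le_div_iff₀ hm]; linarith
        linarith
      calc z i * coefC (DL a b Jet.o w) i ^ 2
          ≤ ((1 + m⁻¹) * eig a b i) ^ 2 * coefC (DL a b Jet.o w) i ^ 2 := by
            gcongr
            exact (hz i).trans (by gcongr; linarith)
        _ = _ := by ring
  -- Six entries of the jet, each bounded by (1 + 1/m) ‖Δw‖.
  refine ⟨√6 * (1 + m⁻¹), by positivity, fun w => ?_⟩
  refine le_of_sq_le_sq ?_ (by positivity)
  have h1 : ‖w‖ ^ 2 = ∑ k : Jet, ‖DL a b k w‖ ^ 2 := PiLp.norm_sq_eq_of_L2 _ (w : JetL2 a b)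
  rw [h1, mul_pow, mul_pow, Real.sq_sqrt (by norm_num)]
  calc ∑ k : Jet, ‖DL a b k w‖ ^ 2 ≤ ∑ _k : Jet, (1 + m⁻¹) ^ 2 * ‖lapL a b w‖ ^ 2 :=
        Finset.sum_le_sum fun k _ => hk k w
    _ = _ := by
        rw [Finset.sum_const, nsmul_eq_mul]
        have : (Finset.univ : Finset Jet).card = 6 := rfl
        rw [this]; push_cast; ring

end Coefficients

/-! ### The embedding of X into L^∞ and the bracket in L¹ -/

section Embedding

variable {a b : ℝ}

/-- Cauchy–Schwarz between the coefficients of Δw and the inverse eigenvalues, which are square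
summable in dimension two. This is the quantitative form of the Sobolev embedding. -/
lemma exists_sum_abs_coefC_le (ha : 0 < a) (hb : 0 < b) :
    ∃ C, 0 ≤ C ∧ ∀ (w : X a b) (s : Finset (ℕ × ℤ)),
      ∑ i ∈ s, |coefC (DL a b Jet.o w) i| ≤ C * ‖lapL a b w‖ := by
  obtain ⟨m, hm, hq⟩ := exists_eig_bound ha hb
  set g : ℕ × ℤ → ℝ := fun i => if i = (0, 0) then 0 else (eig a b i)⁻¹ with hg
  have hgsum : Summable fun i => g i ^ 2 := by
    have h1 : Summable fun k : ℕ => (1 + (k : ℝ) ^ 2)⁻¹ := by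
      refine (Real.summable_nat_pow_inv.2 (by norm_num : 1 < 2)).of_norm_bounded_eventually_nat ?_
      filter_upwards [eventually_gt_atTop 0] with k hk
      have hk' : (0 : ℝ) < k := by exact_mod_cast hk
      rw [Real.norm_of_nonneg (by positivity)]
      gcongr
      linarith
    have h2 : Summable fun l : ℤ => (1 + (l : ℝ) ^ 2)⁻¹ := by
      refine Summable.of_nat_of_neg ?_ ?_ <;> simpa using h1
    have h3 : Summable fun i : ℕ × ℤ => (1 + (i.1 : ℝ) ^ 2)⁻¹ * (1 + (i.2 : ℝ) ^ 2)⁻¹ :=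
      h1.mul_of_nonneg h2 (fun _ => by positivity) (fun _ => by positivity)
    refine Summable.of_nonneg_of_le (fun i => sq_nonneg _) (fun i => ?_) (h3.mul_left ((m⁻¹) ^ 2))
    simp only [hg]
    split_ifs with hi
    · rw [zero_pow two_ne_zero]; positivity
    · obtain ⟨h4, h5⟩ := hq i hi
      have e : m⁻¹ ^ 2 * ((1 + (i.1 : ℝ) ^ 2)⁻¹ * (1 + (i.2 : ℝ) ^ 2)⁻¹)
          = ((m * (1 + (i.1 : ℝ) ^ 2)) * (m * (1 + (i.2 : ℝ) ^ 2)))⁻¹ := by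
        rw [mul_inv, mul_inv, mul_inv]; ring
      rw [e, inv_pow, sq]
      gcongr
      exact le_trans (by positivity) h4
  refine ⟨√(∑' i, g i ^ 2), Real.sqrt_nonneg _, fun w s => ?_⟩
  set f : ℕ × ℤ → ℝ := fun i => |coefC (lapL a b w) i| with hf
  have hfg : ∀ i, |coefC (DL a b Jet.o w) i| = g i * f i := by
    intro i
    simp only [hg, hf]
    split_ifs with hi
    · rw [hi, coefC_zero]; simp
    · have hpos : 0 < eig a b i := lt_of_lt_of_le (by positivity) (hq i hi).1
      rw [coefC_lap ha hb, abs_neg, abs_mul, abs_of_pos hpos, inv_mul_cancel_left₀ hpos.ne']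
  simp_rw [hfg]
  refine le_of_sq_le_sq ?_ (by positivity)
  calc (∑ i ∈ s, g i * f i) ^ 2 ≤ (∑ i ∈ s, g i ^ 2) * ∑ i ∈ s, f i ^ 2 :=
        Finset.sum_mul_sq_le_sq_mul_sq s g f
    _ ≤ (∑' i, g i ^ 2) * ‖lapL a b w‖ ^ 2 := by
        refine mul_le_mul (hgsum.sum_le_tsum s fun _ _ => sq_nonneg _) ?_
          (Finset.sum_nonneg fun _ _ => sq_nonneg _) (tsum_nonneg fun _ => sq_nonneg _)
        have h := hasSum_sq_coefC ha hb (lapL a b w)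
        simp only [hf, sq_abs]
        exact sum_le_hasSum s (fun _ _ => sq_nonneg _) h
    _ = (√(∑' i, g i ^ 2) * ‖lapL a b w‖) ^ 2 := by
        rw [mul_pow, Real.sq_sqrt (tsum_nonneg fun _ => sq_nonneg _)]

lemma coeFn_finset_sum {ι : Type*} (s : Finset ι) (r : ι → ℝ) (f : ι → L2 a b) :
    ((∑ i ∈ s, r i • f i : L2 a b) : ℝ × ℝ → ℝ) =ᵐ[mu a b] fun p => ∑ i ∈ s, r i * f i p := by
  classical
  induction s using Finset.induction_on with
  | empty =>
    simp only [Finset.sum_empty]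
    exact Lp.coeFn_zero _ _ _
  | insert i s hi ih =>
    simp only [Finset.sum_insert hi]
    filter_upwards [Lp.coeFn_add (r i • f i) (∑ i ∈ s, r i • f i), Lp.coeFn_smul (r i) (f i), ih]
      with p h1 h2 h3
    rw [h1, Pi.add_apply, h2, h3, Pi.smul_apply, smul_eq_mul]

/-- Elements of `X` are bounded. -/
lemma exists_ae_bound (ha : 0 < a) (hb : 0 < b) :
    ∃ C, 0 ≤ C ∧ ∀ w : X a b, ∀ᵐ p ∂(mu a b), |DL a b Jet.o w p| ≤ C * ‖w‖ := by
  obtain ⟨C, hC, hs⟩ := exists_sum_abs_coefC_le ha hb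
  obtain ⟨B, hB, hm⟩ := exists_bound_modeC a b
  refine ⟨B * (C * ‖lapL a b‖), by positivity, fun w => ?_⟩
  set u := DL a b Jet.o w
  have hsum : Tendsto (fun s : Finset (ℕ × ℤ) => ∑ i ∈ s, coefC u i • basisC ha hb i) atTop
      (𝓝 u) := by
    have := (basisC ha hb).hasSum_repr u
    simp_rw [HilbertBasis.repr_apply_apply, inner_basisC] at this
    exact this
  -- The Fourier series converges in L², so a sequence of partial sums converges almost everywhere,
  -- and the modes are uniformly bounded.
  obtain ⟨ns, -, hns⟩ := (tendstoInMeasure_of_tendsto_Lp hsum).exists_seq_tendsto_ae'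
  have h1 : ∀ᵐ p ∂(mu a b), ∀ n, ((∑ i ∈ ns n, coefC u i • basisC ha hb i : L2 a b) p)
      = ∑ i ∈ ns n, coefC u i * basisC ha hb i p :=
    ae_all_iff.2 fun n => coeFn_finset_sum (ns n) _ _
  have h2 : ∀ᵐ p ∂(mu a b), ∀ i, basisC ha hb i p = modeC a b i p := by
    refine ae_all_iff.2 fun i => ?_
    rw [basisC_apply]
    exact coeFn_toL2 _
  filter_upwards [hns, h1, h2] with p hp hp1 hp2
  refine le_of_tendsto hp.abs (Eventually.of_forall fun n => ?_)
  rw [hp1]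
  calc |∑ i ∈ ns n, coefC u i * basisC ha hb i p|
      ≤ ∑ i ∈ ns n, |coefC u i| * B := by
        refine (Finset.abs_sum_le_sum_abs _ _).trans (Finset.sum_le_sum fun i _ => ?_)
        rw [abs_mul, hp2]
        gcongr
        exact hm i p
    _ = B * ∑ i ∈ ns n, |coefC u i| := by rw [← Finset.sum_mul, mul_comm]
    _ ≤ B * (C * (‖lapL a b‖ * ‖w‖)) := by
        gcongr
        refine (hs w (ns n)).trans ?_
        gcongr
        exact (lapL a b).le_opNorm w
    _ = B * (C * ‖lapL a b‖) * ‖w‖ := by ring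

lemma memLp_top_X (ha : 0 < a) (hb : 0 < b) (w : X a b) : MemLp (DL a b Jet.o w) ⊤ (mu a b) := by
  obtain ⟨C, -, h⟩ := exists_ae_bound ha hb
  exact memLp_top_of_bound (Lp.aestronglyMeasurable _) _ (h w)

/-- The embedding of `X` into `L^∞(Ω)`. -/
noncomputable def embInf (ha : 0 < a) (hb : 0 < b) : X a b →L[ℝ] Lp ℝ ⊤ (mu a b) :=
  LinearMap.mkContinuousOfExistsBound
    { toFun := fun w => (memLp_top_X ha hb w).toLp _
      map_add' := fun v w => by
        rw [← MemLp.toLp_add]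
        refine MemLp.toLp_congr _ _ ?_
        rw [map_add]
        exact Lp.coeFn_add _ _
      map_smul' := fun r w => by
        rw [← MemLp.toLp_const_smul]
        refine MemLp.toLp_congr _ _ ?_
        rw [map_smul]
        exact Lp.coeFn_smul _ _ } <| by
    obtain ⟨C, hC, h⟩ := exists_ae_bound ha hb
    refine ⟨C, fun w => ?_⟩
    have h1 := Lp.norm_le_of_ae_bound (f := (memLp_top_X ha hb w).toLp _) (C := C * ‖w‖)
      (by positivity) (by
        filter_upwards [MemLp.coeFn_toLp (memLp_top_X ha hb w), h w] with p hp1 hp2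
        rw [hp1]
        exact hp2)
    simpa using h1

lemma coeFn_embInf (ha : 0 < a) (hb : 0 < b) (w : X a b) :
    embInf ha hb w =ᵐ[mu a b] DL a b Jet.o w :=
  MemLp.coeFn_toLp (memLp_top_X ha hb w)

/-- Integration of an `L¹`-function against elements of `X`. -/
noncomputable def pairX (ha : 0 < a) (hb : 0 < b) : Lp ℝ 1 (mu a b) →L[ℝ] X a b →L[ℝ] ℝ :=
  ((ContinuousLinearMap.mul ℝ ℝ).lpPairing (mu a b) 1 ⊤).bilinearComp
    (ContinuousLinearMap.id ℝ _) (embInf ha hb)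

lemma pairX_apply (ha : 0 < a) (hb : 0 < b) (g : Lp ℝ 1 (mu a b)) (w : X a b) :
    pairX ha hb g w = ∫ p in Omega a b, g p * DL a b Jet.o w p := by
  rw [pairX, ContinuousLinearMap.bilinearComp_apply, ContinuousLinearMap.lpPairing_eq_integral]
  refine integral_congr_ae ?_
  filter_upwards [coeFn_embInf ha hb w] with p hp
  rw [hp]
  rfl

/-- The product of two `L²`-functions. -/
noncomputable def mulL (a b : ℝ) : L2 a b →L[ℝ] L2 a b →L[ℝ] Lp ℝ 1 (mu a b) :=
  (ContinuousLinearMap.mul ℝ ℝ).holderL (mu a b) 2 2 1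

lemma coeFn_mulL (u v : L2 a b) : mulL a b u v =ᵐ[mu a b] fun p => u p * v p :=
  ContinuousLinearMap.coeFn_holder _ u v

/-- The bracket as a continuous bilinear map. -/
noncomputable def brL (a b : ℝ) : X a b →L[ℝ] X a b →L[ℝ] Lp ℝ 1 (mu a b) :=
  (1 / 2 : ℝ) • (mulL a b).bilinearComp (DL a b Jet.xx) (DL a b Jet.yy)
  + (1 / 2 : ℝ) • (mulL a b).bilinearComp (DL a b Jet.yy) (DL a b Jet.xx)
  - (mulL a b).bilinearComp (DL a b Jet.xy) (DL a b Jet.xy)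

lemma coeFn_brL (u v : X a b) : brL a b u v =ᵐ[mu a b] bracket u v := by
  set A := mulL a b (DL a b Jet.xx u) (DL a b Jet.yy v) with hA
  set B := mulL a b (DL a b Jet.yy u) (DL a b Jet.xx v) with hB
  set C := mulL a b (DL a b Jet.xy u) (DL a b Jet.xy v) with hC
  have e : brL a b u v = (1 / 2 : ℝ) • A + (1 / 2 : ℝ) • B - C := rfl
  rw [e]
  filter_upwards [Lp.coeFn_sub ((1 / 2 : ℝ) • A + (1 / 2 : ℝ) • B) C,
    Lp.coeFn_add ((1 / 2 : ℝ) • A) ((1 / 2 : ℝ) • B), Lp.coeFn_smul (1 / 2 : ℝ) A,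
    Lp.coeFn_smul (1 / 2 : ℝ) B, coeFn_mulL (DL a b Jet.xx u) (DL a b Jet.yy v),
    coeFn_mulL (DL a b Jet.yy u) (DL a b Jet.xx v),
    coeFn_mulL (DL a b Jet.xy u) (DL a b Jet.xy v)] with p h1 h2 h3 h4 h5 h6 h7
  rw [h1, Pi.sub_apply, h2, Pi.add_apply, h3, h4, Pi.smul_apply, Pi.smul_apply, h5, h6, h7]
  simp only [smul_eq_mul, bracket, D, DL_apply]
  ring

lemma integrable_bracket (u v : X a b) : Integrable (bracket u v) (mu a b) :=
  ((memLp_one_iff_integrable.1 (Lp.memLp (brL a b u v)))).congr (coeFn_brL u v)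

end Embedding

/-! ### Completeness of X and the Lax–Milgram solution operator -/

section Solution

variable {a b : ℝ}

/-- For a fixed test function both sides are L² inner products with fixed continuous functions,
hence continuous in the jet. -/
lemma isClosed_byParts {T : Set (ℝ × ℝ → ℝ)} (hT : ∀ f ∈ T, ContDiff ℝ ∞ f) (e : ℝ × ℝ)
    (j k : Jet) : IsClosed {J : JetL2 a b | ByParts a b T e (J j) (J k)} := by
  have hc : ∀ (f : ℝ × ℝ → ℝ) (_ : Continuous f) (k : Jet),
      Continuous fun J : JetL2 a b => ∫ p in Omega a b, (J k) p * f p := by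
    intro f hf k
    simp_rw [← inner_toL2 hf]
    fun_prop
  simp only [ByParts, Set.ofPred_forall]
  refine isClosed_iInter fun f => isClosed_iInter fun hf => ?_
  exact isClosed_eq (hc f (hT f hf).continuous k) (hc _ (continuous_pd (hT f hf) e) j).neg

lemma isClosed_X (a b : ℝ) : IsClosed (X a b : Set (JetL2 a b)) := by
  have hC : ∀ f ∈ TestC a b, ContDiff ℝ ∞ f := fun _ => TestC.smooth
  have hP : ∀ f ∈ TestPer b, ContDiff ℝ ∞ f := fun _ => TestPer.smooth
  have hmean : IsClosed {J : JetL2 a b | ∫ p in Omega a b, J Jet.o p = 0} := by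
    refine isClosed_eq ?_ continuous_const
    have : ∀ J : JetL2 a b, ∫ p in Omega a b, J Jet.o p
        = inner ℝ (toL2 a b (fun _ => 1) continuous_const) (J Jet.o) := fun J => by
      rw [inner_toL2]; simp
    simp_rw [this]
    fun_prop
  have hset : (X a b : Set (JetL2 a b)) =
      (({J | ByParts a b (TestC a b) ex (J Jet.o) (J Jet.x)} ∩
        {J | ByParts a b (TestC a b) ey (J Jet.o) (J Jet.y)} ∩
        {J | ByParts a b (TestC a b) ex (J Jet.x) (J Jet.xx)} ∩
        {J | ByParts a b (TestC a b) ey (J Jet.x) (J Jet.xy)} ∩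
        {J | ByParts a b (TestC a b) ex (J Jet.y) (J Jet.xy)} ∩
        {J | ByParts a b (TestC a b) ey (J Jet.y) (J Jet.yy)}) ∩
       ({J | ByParts a b (TestPer b) ey (J Jet.o) (J Jet.y)} ∩
        {J | ByParts a b (TestPer b) ey (J Jet.y) (J Jet.yy)} ∩
        {J | ByParts a b (TestPer b) ex (J Jet.x) (J Jet.xx)})) ∩
      {J : JetL2 a b | ∫ p in Omega a b, J Jet.o p = 0} := by
    ext J
    constructor
    · rintro ⟨h1, h2, h3⟩
      exact ⟨⟨⟨⟨⟨⟨⟨h1.o_x, h1.o_y⟩, h1.x_x⟩, h1.x_y⟩, h1.y_x⟩, h1.y_y⟩,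
        ⟨⟨h2.per, h2.per_y⟩, h2.neumann⟩⟩, h3⟩
    · rintro ⟨⟨⟨⟨⟨⟨⟨h1, h2⟩, h3⟩, h4⟩, h5⟩, h6⟩, ⟨⟨h7, h8⟩, h9⟩⟩, h10⟩
      exact ⟨⟨h1, h2, h3, h4, h5, h6⟩, ⟨h7, h8, h9⟩, h10⟩
  rw [hset]
  refine IsClosed.inter (IsClosed.inter ?_ ?_) hmean
  · exact (((((isClosed_byParts hC _ _ _).inter (isClosed_byParts hC _ _ _)).inter
      (isClosed_byParts hC _ _ _)).inter (isClosed_byParts hC _ _ _)).inter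
      (isClosed_byParts hC _ _ _)).inter (isClosed_byParts hC _ _ _)
  · exact ((isClosed_byParts hP _ _ _).inter (isClosed_byParts hP _ _ _)).inter
      (isClosed_byParts hP _ _ _)

instance completeSpace_X (a b : ℝ) : CompleteSpace (X a b) :=
  (isClosed_X a b).completeSpace_coe

/-- The bilinear form `∫ Δu Δv`. -/
noncomputable def lapForm (a b : ℝ) : X a b →L[ℝ] X a b →L[ℝ] ℝ :=
  (innerSL ℝ).bilinearComp (lapL a b) (lapL a b)

lemma lapForm_apply (u v : X a b) : lapForm a b u v = inner ℝ (lapL a b u) (lapL a b v) := rfl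

lemma isCoercive_lapForm (ha : 0 < a) (hb : 0 < b) : IsCoercive (lapForm a b) := by
  obtain ⟨C, hC, h⟩ := exists_norm_le_lap ha hb
  refine ⟨(C ^ 2)⁻¹, by positivity, fun u => ?_⟩
  rw [lapForm_apply, real_inner_self_eq_norm_sq, mul_assoc, inv_mul_le_iff₀ (by positivity),
    ← mul_pow, ← sq]
  gcongr
  exact h u

/-- The Riesz map on a real Hilbert space as a linear map. -/
noncomputable def rieszL (V : Type*) [NormedAddCommGroup V] [InnerProductSpace ℝ V]
    [CompleteSpace V] : (V →L[ℝ] ℝ) →L[ℝ] V :=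
  LinearMap.mkContinuous
    { toFun := fun ℓ => (InnerProductSpace.toDual ℝ V).symm ℓ
      map_add' := fun ℓ m => map_add _ _ _
      map_smul' := fun r ℓ => by simp } 1 (fun ℓ => by simp)

lemma inner_rieszL {V : Type*} [NormedAddCommGroup V] [InnerProductSpace ℝ V]
    [CompleteSpace V] (ℓ : V →L[ℝ] ℝ) (v : V) : inner ℝ (rieszL V ℓ) v = ℓ v :=
  InnerProductSpace.toDual_symm_apply

/-- The solution operator of the weak biharmonic equation on `X`. -/
noncomputable def solOp (ha : 0 < a) (hb : 0 < b) : (X a b →L[ℝ] ℝ) →L[ℝ] X a b :=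
  ((isCoercive_lapForm ha hb).continuousLinearEquivOfBilin.symm : X a b →L[ℝ] X a b).comp
    (rieszL (X a b))

lemma inner_lap_solOp (ha : 0 < a) (hb : 0 < b) (ℓ : X a b →L[ℝ] ℝ) (f : X a b) :
    inner ℝ (lapL a b (solOp ha hb ℓ)) (lapL a b f) = ℓ f := by
  rw [← lapForm_apply, ← (isCoercive_lapForm ha hb).continuousLinearEquivOfBilin_apply]
  have : (isCoercive_lapForm ha hb).continuousLinearEquivOfBilin (solOp ha hb ℓ)
      = rieszL (X a b) ℓ := by
    simp [solOp]
  rw [this, inner_rieszL]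

end Solution

/-! ### Smooth test functions as elements of X -/

section SmoothFunctions

variable {a b : ℝ}

lemma contDiff_pd {f : ℝ × ℝ → ℝ} (hf : ContDiff ℝ ∞ f) (e : ℝ × ℝ) : ContDiff ℝ ∞ (pd e f) :=
  (hf.fderiv_right (m := ∞) (by simp)).clm_apply contDiff_const

lemma pd_comm {f : ℝ × ℝ → ℝ} (hf : ContDiff ℝ ∞ f) (e e' : ℝ × ℝ) :
    pd e (pd e' f) = pd e' (pd e f) := by
  have h2 : ∀ (d d' p : ℝ × ℝ), pd d (pd d' f) p = fderiv ℝ (fderiv ℝ f) p d d' := by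
    intro d d' p
    have h := ((hf.fderiv_right (m := ∞) (by simp)).differentiable (by simp) p).hasFDerivAt
    have h' := h.clm_apply (hasFDerivAt_const d' p)
    rw [pd]
    change fderiv ℝ (fun q => fderiv ℝ f q d') p d = _
    rw [h'.fderiv]
    simp
  ext p
  rw [h2, h2]
  exact ((contDiff_infty.1 hf 2).contDiffAt.isSymmSndFDerivAt (by simp)).eq e e'

lemma hasDerivAt_slice_x {h : ℝ × ℝ → ℝ} (hh : ContDiff ℝ ∞ h) (x y : ℝ) :
    HasDerivAt (fun x => h (x, y)) (pd ex h (x, y)) x :=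
  ((hh.differentiable (by simp) (x, y)).hasFDerivAt).comp_hasDerivAt x
    ((hasDerivAt_id x).prodMk (hasDerivAt_const x y))

lemma hasDerivAt_slice_y {h : ℝ × ℝ → ℝ} (hh : ContDiff ℝ ∞ h) (x y : ℝ) :
    HasDerivAt (fun y => h (x, y)) (pd ey h (x, y)) y :=
  ((hh.differentiable (by simp) (x, y)).hasFDerivAt).comp_hasDerivAt y
    ((hasDerivAt_const y x).prodMk (hasDerivAt_id y))

lemma integrable_cont {f : ℝ × ℝ → ℝ} (hf : Continuous f) : Integrable f (mu a b) :=
  memLp_one_iff_integrable.1 (memLp_of_continuous a b hf 1)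

lemma integral_pd_ex_eq_zero (ha : 0 < a) {h : ℝ × ℝ → ℝ} (hh : ContDiff ℝ ∞ h)
    (hbd : ∀ y, h (a, y) = h (-a, y)) : ∫ p in Omega a b, pd ex h p = 0 := by
  have hi : Integrable (pd ex h) (mu a b) := integrable_cont (continuous_pd hh ex)
  change ∫ p, pd ex h p ∂(mu a b) = 0
  rw [mu_eq_prod] at hi ⊢
  rw [integral_prod_symm _ hi]
  refine integral_eq_zero_of_ae (Eventually.of_forall fun y => ?_)
  have := continuous_pd hh ex
  simp only [Pi.zero_apply]
  rw [integral_Ioo_eq_sub (by linarith) (fun x => hasDerivAt_slice_x hh x y) (by fun_prop), hbd,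
    sub_self]

lemma integral_pd_ey_eq_zero (hb : 0 < b) {h : ℝ × ℝ → ℝ} (hh : ContDiff ℝ ∞ h)
    (hbd : ∀ x, h (x, b) = h (x, -b)) : ∫ p in Omega a b, pd ey h p = 0 := by
  have hi : Integrable (pd ey h) (mu a b) := integrable_cont (continuous_pd hh ey)
  change ∫ p, pd ey h p ∂(mu a b) = 0
  rw [mu_eq_prod] at hi ⊢
  rw [integral_prod _ hi]
  refine integral_eq_zero_of_ae (Eventually.of_forall fun x => ?_)
  have := continuous_pd hh ey
  simp only [Pi.zero_apply]
  rw [integral_Ioo_eq_sub (by linarith) (fun y => hasDerivAt_slice_y hh x y) (by fun_prop), hbd,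
    sub_self]

lemma integral_toL2_mul {h f : ℝ × ℝ → ℝ} (hh : Continuous h) :
    ∫ p in Omega a b, toL2 a b h hh p * f p = ∫ p in Omega a b, h p * f p := by
  refine integral_congr_ae ?_
  filter_upwards [coeFn_toL2 (a := a) (b := b) hh] with p hp
  rw [hp]

/-- By the product rule, integration by parts holds once the total derivative of `h * f` integrates
to zero, which is a condition on boundary values only. -/
lemma byParts_toL2 {T : Set (ℝ × ℝ → ℝ)} (hT : ∀ f ∈ T, ContDiff ℝ ∞ f) {e : ℝ × ℝ}
    {h g : ℝ × ℝ → ℝ} (hh : ContDiff ℝ ∞ h) (hg : Continuous g) (hgh : pd e h = g)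
    (hz : ∀ f ∈ T, ∫ p in Omega a b, pd e (fun p => h p * f p) p = 0) :
    ByParts a b T e (toL2 a b h hh.continuous) (toL2 a b g hg) := by
  subst hgh
  intro f hf
  have hfs := hT f hf
  rw [integral_toL2_mul, integral_toL2_mul]
  have h0 := hz f hf
  have hc := continuous_pd hfs e
  have hc' := hfs.continuous
  have hc'' := hh.continuous
  simp_rw [pd_mul e hh hfs] at h0
  rw [integral_add (integrable_cont (by fun_prop)) (integrable_cont (by fun_prop))] at h0
  have : ∫ p in Omega a b, pd e h p * f p = ∫ p in Omega a b, f p * pd e h p := by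
    simp_rw [mul_comm]
  linarith

lemma TestC.eq_zero {f : ℝ × ℝ → ℝ} (hf : f ∈ TestC a b) {p : ℝ × ℝ} (hp : p ∉ Omega a b) :
    f p = 0 :=
  image_eq_zero_of_notMem_tsupport fun h => hp (hf.2.2 h)

lemma integral_pd_mul_testC (ha : 0 < a) (hb : 0 < b) {h f : ℝ × ℝ → ℝ} (hh : ContDiff ℝ ∞ h)
    (hf : f ∈ TestC a b) : (∫ p in Omega a b, pd ex (fun p => h p * f p) p = 0) ∧
      ∫ p in Omega a b, pd ey (fun p => h p * f p) p = 0 := by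
  have hs := hh.mul hf.1
  refine ⟨integral_pd_ex_eq_zero ha hs fun y => ?_, integral_pd_ey_eq_zero hb hs fun x => ?_⟩
  · rw [TestC.eq_zero hf (fun hp => lt_irrefl _ hp.1.2), TestC.eq_zero hf (fun hp => lt_irrefl _ hp.1.1)]
    simp
  · rw [TestC.eq_zero hf (fun hp => lt_irrefl _ hp.2.2), TestC.eq_zero hf (fun hp => lt_irrefl _ hp.2.1)]
    simp

lemma periodic_boundary {f : ℝ × ℝ → ℝ} (hf : f ∈ TestPer b) (x : ℝ) : f (x, b) = f (x, -b) := by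
  have := hf.2 x (-b)
  rw [← this]
  congr 2
  ring

lemma pd_ey_mem_TestPer {f : ℝ × ℝ → ℝ} (hf : f ∈ TestPer b) : pd ey f ∈ TestPer b := by
  refine ⟨contDiff_pd hf.1 ey, fun x y => ?_⟩
  have h1 := (hasDerivAt_slice_y hf.1 x (y + 2 * b)).comp_add_const y (2 * b)
  have h2 : (fun y => f (x, y + 2 * b)) = fun y => f (x, y) := funext fun y => hf.2 x y
  have h3 : HasDerivAt (fun y => f (x, y)) (pd ey f (x, y + 2 * b)) y := by
    rw [← h2]; exact h1
  exact h3.unique (hasDerivAt_slice_y hf.1 x y)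

lemma sub_const_mem_TestPer {f : ℝ × ℝ → ℝ} (hf : f ∈ TestPer b) (m : ℝ) :
    (fun p => f p - m) ∈ TestPer b :=
  ⟨hf.1.sub contDiff_const, fun x y => congrArg (· - m) (hf.2 x y)⟩

lemma pd_sub_const (e : ℝ × ℝ) (f : ℝ × ℝ → ℝ) (m : ℝ) : pd e (fun p => f p - m) = pd e f := by
  ext p
  rw [pd, pd, fderiv_sub_const]

lemma integral_pd_ey_mul_testPer (hb : 0 < b) {h f : ℝ × ℝ → ℝ} (hh : h ∈ TestPer b)
    (hf : f ∈ TestPer b) : ∫ p in Omega a b, pd ey (fun p => h p * f p) p = 0 :=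
  integral_pd_ey_eq_zero hb (hh.1.mul hf.1) fun x => by
    rw [periodic_boundary hh, periodic_boundary hf]

/-- The derivatives of `f - m` up to order two. -/
noncomputable def smoothJetFun (f : ℝ × ℝ → ℝ) (m : ℝ) : Jet → ℝ × ℝ → ℝ
  | Jet.o => fun p => f p - m
  | Jet.x => pd ex f
  | Jet.y => pd ey f
  | Jet.xx => pd ex (pd ex f)
  | Jet.xy => pd ey (pd ex f)
  | Jet.yy => pd ey (pd ey f)

lemma contDiff_smoothJetFun {f : ℝ × ℝ → ℝ} (hf : ContDiff ℝ ∞ f) (m : ℝ) (k : Jet) :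
    ContDiff ℝ ∞ (smoothJetFun f m k) := by
  have h1 := contDiff_pd hf ex
  have h2 := contDiff_pd hf ey
  cases k
  · exact hf.sub contDiff_const
  · exact h1
  · exact h2
  · exact contDiff_pd h1 ex
  · exact contDiff_pd h1 ey
  · exact contDiff_pd h2 ey

/-- The jet of the smooth function `f - m`. -/
noncomputable def smoothJet (a b : ℝ) (f : ℝ × ℝ → ℝ) (hf : ContDiff ℝ ∞ f) (m : ℝ) : JetL2 a b :=
  WithLp.toLp 2 fun k =>
    toL2 a b (smoothJetFun f m k) (contDiff_smoothJetFun hf m k).continuous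

lemma smoothJet_mem (ha : 0 < a) (hb : 0 < b) {f : ℝ × ℝ → ℝ} (hf : f ∈ TestBC a b) :
    smoothJet a b f hf.1.1 (⨍ p, f p ∂(mu a b)) ∈ X a b := by
  set m := ⨍ p, f p ∂(mu a b)
  have hs := hf.1.1
  have hC : ∀ f ∈ TestC a b, ContDiff ℝ ∞ f := fun _ => TestC.smooth
  have hP : ∀ f ∈ TestPer b, ContDiff ℝ ∞ f := fun _ => TestPer.smooth
  have hjs := contDiff_smoothJetFun hs m
  refine ⟨⟨?_, ?_, ?_, ?_, ?_, ?_⟩, ⟨?_, ?_, ?_⟩, ?_⟩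
  · exact byParts_toL2 hC (hjs Jet.o) (hjs Jet.x).continuous (pd_sub_const ex f m)
      fun g hg => (integral_pd_mul_testC ha hb (hjs Jet.o) hg).1
  · exact byParts_toL2 hC (hjs Jet.o) (hjs Jet.y).continuous (pd_sub_const ey f m)
      fun g hg => (integral_pd_mul_testC ha hb (hjs Jet.o) hg).2
  · exact byParts_toL2 hC (hjs Jet.x) (hjs Jet.xx).continuous rfl
      fun g hg => (integral_pd_mul_testC ha hb (hjs Jet.x) hg).1
  · exact byParts_toL2 hC (hjs Jet.x) (hjs Jet.xy).continuous rfl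
      fun g hg => (integral_pd_mul_testC ha hb (hjs Jet.x) hg).2
  -- The mixed entry is stored as ∂_y ∂_x, so this relation uses symmetry of second derivatives.
  · exact byParts_toL2 hC (hjs Jet.y) (hjs Jet.xy).continuous (pd_comm hs ex ey)
      fun g hg => (integral_pd_mul_testC ha hb (hjs Jet.y) hg).1
  · exact byParts_toL2 hC (hjs Jet.y) (hjs Jet.yy).continuous rfl
      fun g hg => (integral_pd_mul_testC ha hb (hjs Jet.y) hg).2
  · exact byParts_toL2 hP (hjs Jet.o) (hjs Jet.y).continuous (pd_sub_const ey f m)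
      fun g hg => integral_pd_ey_mul_testPer hb (sub_const_mem_TestPer hf.1 m) hg
  · exact byParts_toL2 hP (hjs Jet.y) (hjs Jet.yy).continuous rfl
      fun g hg => integral_pd_ey_mul_testPer hb (pd_ey_mem_TestPer hf.1) hg
  · refine byParts_toL2 hP (hjs Jet.x) (hjs Jet.xx).continuous rfl fun g hg => ?_
    refine integral_pd_ex_eq_zero ha ((hjs Jet.x).mul hg.1) fun y => ?_
    simp only [smoothJetFun]
    rw [(hf.2 y).1, (hf.2 y).2]
    simp
  · have h1 := integral_toL2_mul (a := a) (b := b) (f := fun _ => 1) (hjs Jet.o).continuous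
    simp only [mul_one] at h1
    refine Eq.trans h1 ?_
    exact integral_sub_average (mu a b) f

/-- Test functions, normalized to mean zero, belong to `X`. -/
lemma exists_X_of_testBC (ha : 0 < a) (hb : 0 < b) {f : ℝ × ℝ → ℝ} (hf : f ∈ TestBC a b) :
    ∃ (v : X a b) (m : ℝ), (DL a b Jet.o v =ᵐ[mu a b] fun p => f p - m) ∧
      lap v =ᵐ[mu a b] fun p => pd ex (pd ex f) p + pd ey (pd ey f) p := by
  refine ⟨⟨_, smoothJet_mem ha hb hf⟩, _,
    coeFn_toL2 (contDiff_smoothJetFun hf.1.1 (⨍ p, f p ∂(mu a b)) Jet.o).continuous, ?_⟩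
  have h1 := coeFn_toL2 (a := a) (b := b)
    (contDiff_smoothJetFun hf.1.1 (⨍ p, f p ∂(mu a b)) Jet.xx).continuous
  have h2 := coeFn_toL2 (a := a) (b := b)
    (contDiff_smoothJetFun hf.1.1 (⨍ p, f p ∂(mu a b)) Jet.yy).continuous
  filter_upwards [h1, h2] with p hp1 hp2
  exact congrArg₂ (· + ·) hp1 hp2

end SmoothFunctions

/-! ### The stress functions φ and φ₁ as explicit operators -/

section Biharmonic

variable {a b : ℝ}

lemma coeFn_lapL (w : X a b) : lapL a b w =ᵐ[mu a b] lap w :=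
  Lp.coeFn_add (DL a b Jet.xx w) (DL a b Jet.yy w)

lemma integral_lap_mul (u : X a b) (f : ℝ × ℝ → ℝ) :
    ∫ p in Omega a b, lap u p * f p = ∫ p in Omega a b, lapL a b u p * f p := by
  refine integral_congr_ae ?_
  filter_upwards [coeFn_lapL u] with p hp
  rw [hp]

lemma inner_L2 (u v : L2 a b) : inner ℝ u v = ∫ p in Omega a b, u p * v p := by
  rw [L2.inner_def]
  congr 1
  ext p
  simp [mul_comm]

lemma inner_lapL (u v : X a b) :
    inner ℝ (lapL a b u) (lapL a b v) = ∫ p in Omega a b, lap u p * lap v p := by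
  rw [inner_L2, integral_lap_mul]
  refine integral_congr_ae ?_
  filter_upwards [coeFn_lapL v] with p hp
  rw [hp]

/-- Test functions need not have mean zero, whereas elements of X do. Subtracting a constant changes
neither side, because g integrates to zero; this is the solvability condition. -/
lemma solvesBiharmonic_of_forall_X (ha : 0 < a) (hb : 0 < b) {g : ℝ × ℝ → ℝ} {φ : X a b}
    (hg : Integrable g (mu a b)) (hg0 : ∫ p in Omega a b, g p = 0)
    (h : ∀ v : X a b, inner ℝ (lapL a b φ) (lapL a b v)
      = ∫ p in Omega a b, g p * DL a b Jet.o v p) : SolvesBiharmonic g φ := by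
  intro f hf
  obtain ⟨v, m, hv, hlap⟩ := exists_X_of_testBC ha hb hf
  have hgf : Integrable (fun p => g p * f p) (mu a b) := by
    obtain ⟨M, hM⟩ := exists_bound_Omega a b hf.1.1.continuous
    refine hg.mul_bdd (c := M) hf.1.1.continuous.aestronglyMeasurable ?_
    exact (ae_restrict_iff' (measurableSet_Omega a b)).2 (Eventually.of_forall hM)
  calc ∫ p in Omega a b, lap φ p * (pd ex (pd ex f) p + pd ey (pd ey f) p)
      = ∫ p in Omega a b, lap φ p * lap v p := by
        refine integral_congr_ae ?_
        filter_upwards [hlap] with p hp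
        rw [hp]
    _ = ∫ p in Omega a b, g p * DL a b Jet.o v p := by rw [← inner_lapL, h]
    _ = ∫ p in Omega a b, (g p * f p - g p * m) := by
        refine integral_congr_ae ?_
        filter_upwards [hv] with p hp
        rw [hp, mul_sub]
    _ = ∫ p in Omega a b, g p * f p := by
        rw [integral_sub hgf (hg.mul_const m), integral_mul_const, hg0, zero_mul, sub_zero]

lemma eq_of_lapL_eq (ha : 0 < a) (hb : 0 < b) {u v : X a b} (h : lapL a b u = lapL a b v) :
    u = v := by
  obtain ⟨C, -, hC⟩ := exists_norm_le_lap ha hb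
  have := hC (u - v)
  rw [map_sub, h, sub_self, norm_zero, mul_zero] at this
  exact sub_eq_zero.1 (norm_le_zero_iff.1 this)

lemma eq_of_coefC_eq (ha : 0 < a) (hb : 0 < b) {u v : L2 a b} (h : ∀ i, coefC u i = coefC v i) :
    u = v := by
  refine (basisC ha hb).repr.injective ?_
  ext i
  rw [HilbertBasis.repr_apply_apply, HilbertBasis.repr_apply_apply, inner_basisC, inner_basisC, h]

/-- The cosine modes are admissible test functions and eigenfunctions of Δ, so g determines every
Fourier coefficient of Δφ with nonzero eigenvalue; the others vanish. -/
lemma solvesBiharmonic_unique (ha : 0 < a) (hb : 0 < b) {g : ℝ × ℝ → ℝ} {φ ψ : X a b}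
    (hφ : SolvesBiharmonic g φ) (hψ : SolvesBiharmonic g ψ) : φ = ψ := by
  have key : ∀ {χ : X a b}, SolvesBiharmonic g χ → ∀ i,
      -eig a b i * coefC (lapL a b χ) i = ∫ p in Omega a b, g p * modeC a b i p := by
    intro χ hχ i
    rw [← hχ _ (modeC_mem_TestBC ha hb i), integral_lap_mul]
    simp_rw [lap_modeC]
    rw [integral_mul_const_mul, coefC, eig]
  refine eq_of_lapL_eq ha hb (eq_of_coefC_eq ha hb fun i => ?_)
  by_cases hi : eig a b i = 0
  · rw [coefC_lap ha hb, coefC_lap ha hb, hi, zero_mul, zero_mul]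
  · exact mul_left_cancel₀ (neg_ne_zero.2 hi) ((key hφ i).trans (key hψ i).symm)

lemma solveBiharmonic_eq (ha : 0 < a) (hb : 0 < b) {g : ℝ × ℝ → ℝ} {φ : X a b}
    (hφ : SolvesBiharmonic g φ) : solveBiharmonic a b g = φ :=
  solvesBiharmonic_unique ha hb (Classical.epsilon_spec ⟨φ, hφ⟩) hφ

/-- The linear part of `-φ`. -/
noncomputable def phiLin (ha : 0 < a) (hb : 0 < b) : X a b →L[ℝ] X a b :=
  (solOp ha hb).comp ((innerSL ℝ).bilinearComp (DL a b Jet.xx) (DL a b Jet.o))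

/-- The quadratic part of `-φ`. -/
noncomputable def phiQuad (ha : 0 < a) (hb : 0 < b) : X a b →L[ℝ] X a b →L[ℝ] X a b :=
  (ContinuousLinearMap.compL ℝ (X a b) (Lp ℝ 1 (mu a b)) (X a b)
    ((solOp ha hb).comp (pairX ha hb))).comp (brL a b)

lemma inner_lap_phiLin (ha : 0 < a) (hb : 0 < b) (w v : X a b) :
    inner ℝ (lapL a b (phiLin ha hb w)) (lapL a b v)
      = ∫ p in Omega a b, D Jet.xx w p * DL a b Jet.o v p := by
  rw [phiLin, ContinuousLinearMap.comp_apply, inner_lap_solOp]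
  exact inner_L2 _ _

lemma inner_lap_phiQuad (ha : 0 < a) (hb : 0 < b) (u w v : X a b) :
    inner ℝ (lapL a b (phiQuad ha hb u w)) (lapL a b v)
      = ∫ p in Omega a b, bracket u w p * DL a b Jet.o v p := by
  have : phiQuad ha hb u w = solOp ha hb (pairX ha hb (brL a b u w)) := rfl
  rw [this, inner_lap_solOp, pairX_apply]
  refine integral_congr_ae ?_
  filter_upwards [coeFn_brL u w] with p hp
  rw [hp]

lemma integrable_D (k : Jet) (w : X a b) : Integrable (D k w) (mu a b) :=
  (Lp.memLp (DL a b k w)).integrable (by norm_num)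

lemma integral_xx_eq_zero (w : X a b) : ∫ p in Omega a b, D Jet.xx w p = 0 := by
  have h := (isBC_X w).neumann (fun _ => 1) ⟨contDiff_const, fun _ _ => rfl⟩
  have h0 : ∀ p, pd ex (fun _ : ℝ × ℝ => (1 : ℝ)) p = 0 := fun p => by simp [pd]
  simp_rw [h0] at h
  simpa [D] using h

/-- The determinant of the Hessian has mean zero by `inner_xx_yy`; this is the solvability condition
for φ. -/
lemma integral_bracket_self (ha : 0 < a) (hb : 0 < b) (w : X a b) :
    ∫ p in Omega a b, bracket w w p = 0 := by
  have h := inner_xx_yy ha hb w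
  rw [← real_inner_self_eq_norm_sq, inner_L2, inner_L2] at h
  have i1 : Integrable (fun p => DL a b Jet.xx w p * DL a b Jet.yy w p) (mu a b) :=
    MemLp.integrable_mul (Lp.memLp (DL a b Jet.xx w)) (Lp.memLp (DL a b Jet.yy w))
  have i2 : Integrable (fun p => DL a b Jet.xy w p * DL a b Jet.xy w p) (mu a b) :=
    MemLp.integrable_mul (Lp.memLp (DL a b Jet.xy w)) (Lp.memLp (DL a b Jet.xy w))
  have e : ∀ p, bracket w w p = DL a b Jet.xx w p * DL a b Jet.yy w p
      - DL a b Jet.xy w p * DL a b Jet.xy w p := by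
    intro p
    simp only [bracket, D, DL_apply]
    ring
  simp_rw [e]
  rw [integral_sub i1 i2, h, sub_self]

lemma integrable_mul_X (ha : 0 < a) (hb : 0 < b) {g : ℝ × ℝ → ℝ} (hg : Integrable g (mu a b))
    (v : X a b) : Integrable (fun p => g p * DL a b Jet.o v p) (mu a b) := by
  obtain ⟨C, -, h⟩ := exists_ae_bound ha hb
  exact hg.mul_bdd (c := C * ‖v‖) (Lp.aestronglyMeasurable _) (h v)

lemma phi1_eq (ha : 0 < a) (hb : 0 < b) (w : X a b) : phi1 w = -phiLin ha hb w := by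
  refine solveBiharmonic_eq ha hb (solvesBiharmonic_of_forall_X ha hb (integrable_D _ w).neg ?_ ?_)
  · rw [integral_neg, integral_xx_eq_zero, neg_zero]
  · intro v
    rw [map_neg, inner_neg_left, inner_lap_phiLin, ← integral_neg]
    simp_rw [neg_mul]

lemma phi_eq (ha : 0 < a) (hb : 0 < b) (w : X a b) :
    phi w = -(phiQuad ha hb w w + phiLin ha hb w) := by
  have hbr := integrable_bracket w w
  have hxx := integrable_D Jet.xx w
  refine solveBiharmonic_eq ha hb (solvesBiharmonic_of_forall_X ha hb (hbr.neg.sub hxx) ?_ ?_)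
  · have h := integral_sub hbr.neg hxx
    simp only [Pi.neg_apply] at h
    rw [h, integral_neg, integral_bracket_self ha hb, integral_xx_eq_zero]
    simp
  · intro v
    rw [map_neg, map_add, inner_neg_left, inner_add_left, inner_lap_phiLin, inner_lap_phiQuad,
      ← integral_add (integrable_mul_X ha hb hbr v) (integrable_mul_X ha hb hxx v), ← integral_neg]
    congr 1
    ext p
    ring

lemma integral_lap_sq_add (u v : X a b) : ∫ p in Omega a b, (lap u p ^ 2 + lap v p ^ 2)
    = ‖lapL a b u‖ ^ 2 + ‖lapL a b v‖ ^ 2 := by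
  have hi : ∀ u : X a b, Integrable (fun p => lap u p * lap u p) (mu a b) := fun u => by
    have h : Integrable (fun p => lapL a b u p * lapL a b u p) (mu a b) :=
      MemLp.integrable_mul (Lp.memLp (lapL a b u)) (Lp.memLp (lapL a b u))
    refine h.congr ?_
    filter_upwards [coeFn_lapL u] with p hp
    rw [hp]
  simp_rw [sq]
  rw [integral_add (hi u) (hi v), ← inner_lapL, ← inner_lapL, real_inner_self_eq_norm_mul_norm,
    real_inner_self_eq_norm_mul_norm]

lemma normX_eq (ha : 0 < a) (hb : 0 < b) (w : X a b) :
    normX w = √(‖lapL a b w‖ ^ 2 + ‖lapL a b (phiLin ha hb w)‖ ^ 2) := by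
  rw [normX, integral_lap_sq_add, phi1_eq ha hb, map_neg, norm_neg]

lemma E_eq (ha : 0 < a) (hb : 0 < b) (w : X a b) : E w = 1 / 2 * (‖lapL a b w‖ ^ 2
    + ‖lapL a b (phiQuad ha hb w w + phiLin ha hb w)‖ ^ 2) := by
  rw [E, integral_lap_sq_add, phi_eq ha hb, map_neg, norm_neg]

lemma S_eq (w : X a b) : S w = 1 / 2 * ‖DL a b Jet.x w‖ ^ 2 := by
  rw [S, ← real_inner_self_eq_norm_sq, inner_L2]
  simp_rw [sq]
  rfl

end Biharmonic

/-! ### Calculus of the quartic functional -/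

section Quartic

variable {V Y Z W : Type*} [NormedAddCommGroup V] [NormedSpace ℝ V]
  [NormedAddCommGroup Y] [InnerProductSpace ℝ Y] [NormedAddCommGroup Z] [InnerProductSpace ℝ Z]
  [NormedAddCommGroup W] [InnerProductSpace ℝ W]

/-- The derivative of the quartic `½‖A w‖² + ½‖B w w + L w‖² - (lam/2)‖D w‖²`. -/
lemma hasFDerivAt_quartic (A : V →L[ℝ] Y) (B : V →L[ℝ] V →L[ℝ] Z) (L : V →L[ℝ] Z)
    (T : V →L[ℝ] W) (lam : ℝ) (w : V) : ∃ d : V →L[ℝ] ℝ,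
    HasFDerivAt (fun w => 1 / 2 * (‖A w‖ ^ 2 + ‖B w w + L w‖ ^ 2) - lam * (1 / 2 * ‖T w‖ ^ 2)) d w ∧
    ∀ h, d h = inner ℝ (A w) (A h) + inner ℝ (B w w + L w) (B w h + B h w + L h)
      - lam * inner ℝ (T w) (T h) := by
  have hA := (A.hasFDerivAt (x := w)).norm_sq
  have hT := (T.hasFDerivAt (x := w)).norm_sq
  have hB := ((B.hasFDerivAt (x := w)).clm_apply (hasFDerivAt_id w)).add (L.hasFDerivAt (x := w))
  have hB2 := hB.norm_sq
  have h := ((hA.add hB2).const_mul (1 / 2)).sub ((hT.const_mul (1 / 2)).const_mul lam)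
  refine ⟨_, h, fun k => ?_⟩
  simp [inner_add_left, inner_add_right]

/-- Expanding the squares exactly leaves ½‖A h‖², ½‖r‖², the pairing of q with B h h, and the
T-term. For ‖w‖ ≤ R each is bounded by a multiple of ‖h‖²; ‖h‖ ≤ 1 is used to bound r linearly in h.
-/
lemma quartic_le (A : V →L[ℝ] Y) (B : V →L[ℝ] V →L[ℝ] Z) (L : V →L[ℝ] Z)
    (T : V →L[ℝ] W) (lam R : ℝ) : ∃ C : ℝ, ∀ w h : V, ‖w‖ ≤ R → ‖h‖ ≤ 1 →
    1 / 2 * (‖A (w + h)‖ ^ 2 + ‖B (w + h) (w + h) + L (w + h)‖ ^ 2)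
        - lam * (1 / 2 * ‖T (w + h)‖ ^ 2)
      ≤ 1 / 2 * (‖A w‖ ^ 2 + ‖B w w + L w‖ ^ 2) - lam * (1 / 2 * ‖T w‖ ^ 2)
        + (inner ℝ (A w) (A h) + inner ℝ (B w w + L w) (B w h + B h w + L h)
          - lam * inner ℝ (T w) (T h)) + C * ‖h‖ ^ 2 := by
  set Q := ‖B‖ * |R| * |R| + ‖L‖ * |R|
  set P := 2 * ‖B‖ * |R| + ‖L‖ + ‖B‖
  refine ⟨1 / 2 * ‖A‖ ^ 2 + Q * ‖B‖ + 1 / 2 * P ^ 2 + |lam| * (1 / 2 * ‖T‖ ^ 2),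
    fun w h hw hh => ?_⟩
  have hw' : ‖w‖ ≤ |R| := hw.trans (le_abs_self R)
  set q := B w w + L w
  set r := B w h + B h w + L h + B h h with hr
  have e1 : B (w + h) (w + h) + L (w + h) = q + r := by
    simp only [q, r, map_add, add_apply]; abel
  have e2 : B w h + B h w + L h = r - B h h := by simp only [r]; abel
  have hq : ‖q‖ ≤ Q := by
    refine (norm_add_le _ _).trans (add_le_add ?_ ?_)
    · refine (B.le_opNorm₂ w w).trans ?_; gcongr
    · refine (L.le_opNorm w).trans ?_; gcongr
  have hBhh : ‖B h h‖ ≤ ‖B‖ * ‖h‖ ^ 2 := by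
    refine (B.le_opNorm₂ h h).trans (le_of_eq ?_); ring
  have hrP : ‖r‖ ≤ P * ‖h‖ := by
    have h1 : ‖B w h‖ ≤ ‖B‖ * |R| * ‖h‖ := (B.le_opNorm₂ w h).trans (by gcongr)
    have h2 : ‖B h w‖ ≤ ‖B‖ * ‖h‖ * |R| := (B.le_opNorm₂ h w).trans (by gcongr)
    have h3 : ‖L h‖ ≤ ‖L‖ * ‖h‖ := L.le_opNorm h
    have h4 : ‖B h h‖ ≤ ‖B‖ * ‖h‖ * 1 := (B.le_opNorm₂ h h).trans (by gcongr)
    have h5 : ‖r‖ ≤ ‖B w h‖ + ‖B h w‖ + ‖L h‖ + ‖B h h‖ := norm_add₄_le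
    refine h5.trans ?_
    simp only [P]
    linarith
  have hA : ‖A h‖ ^ 2 ≤ ‖A‖ ^ 2 * ‖h‖ ^ 2 := by
    rw [← mul_pow]; gcongr; exact A.le_opNorm h
  have hT : ‖T h‖ ^ 2 ≤ ‖T‖ ^ 2 * ‖h‖ ^ 2 := by
    rw [← mul_pow]; gcongr; exact T.le_opNorm h
  have hr2 : ‖r‖ ^ 2 ≤ P ^ 2 * ‖h‖ ^ 2 := by rw [← mul_pow]; gcongr
  have hin : inner ℝ q (B h h) ≤ Q * (‖B‖ * ‖h‖ ^ 2) :=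
    (real_inner_le_norm _ _).trans (by gcongr)
  have hlam : -(lam * (1 / 2 * ‖T h‖ ^ 2)) ≤ |lam| * (1 / 2 * (‖T‖ ^ 2 * ‖h‖ ^ 2)) := by
    rw [← neg_mul]
    exact mul_le_mul (neg_le_abs lam) (by gcongr) (by positivity) (abs_nonneg _)
  rw [e1, e2, map_add, map_add, inner_sub_right, norm_add_sq_real (A w) (A h),
    norm_add_sq_real q r, norm_add_sq_real (T w) (T h)]
  linarith

lemma contDiff_quartic (A : V →L[ℝ] Y) (B : V →L[ℝ] V →L[ℝ] Z) (L : V →L[ℝ] Z)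
    (T : V →L[ℝ] W) (lam : ℝ) : ContDiff ℝ 1
      (fun w => 1 / 2 * (‖A w‖ ^ 2 + ‖B w w + L w‖ ^ 2) - lam * (1 / 2 * ‖T w‖ ^ 2)) := by
  have hB : ContDiff ℝ 1 fun w => B w w + L w := (B.contDiff.clm_apply contDiff_id).add L.contDiff
  exact (contDiff_const.mul ((A.contDiff.norm_sq ℝ).add (hB.norm_sq ℝ))).sub
    (contDiff_const.mul (contDiff_const.mul (T.contDiff.norm_sq ℝ)))

end Quartic

/-! ### Verification of the abstract hypotheses for F -/

section Potential

variable {a b : ℝ}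

/-- The sign in φ = -(Q(w,w) + Lw) disappears in the norm, so Δ composed with Q and L supplies the
quadratic and linear parts. -/
lemma F_eq_quartic (ha : 0 < a) (hb : 0 < b) (lam : ℝ) : F lam = fun w : X a b =>
    1 / 2 * (‖lapL a b w‖ ^ 2
      + ‖((ContinuousLinearMap.compL ℝ (X a b) (X a b) (L2 a b) (lapL a b)).comp
          (phiQuad ha hb)) w w + ((lapL a b).comp (phiLin ha hb)) w‖ ^ 2)
      - lam * (1 / 2 * ‖DL a b Jet.x w‖ ^ 2) := by
  ext w
  rw [F, E_eq ha hb, S_eq, map_add]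
  rfl

lemma contDiff_F (ha : 0 < a) (hb : 0 < b) (lam : ℝ) : ContDiff ℝ 1 (F lam : X a b → ℝ) := by
  rw [F_eq_quartic ha hb]
  exact contDiff_quartic _ _ _ _ _

lemma fderiv_F_zero (ha : 0 < a) (hb : 0 < b) (lam : ℝ) :
    fderiv ℝ (F lam : X a b → ℝ) 0 = 0 := by
  rw [F_eq_quartic ha hb]
  obtain ⟨d, hd, hd'⟩ := hasFDerivAt_quartic (lapL a b)
    ((ContinuousLinearMap.compL ℝ (X a b) (X a b) (L2 a b) (lapL a b)).comp (phiQuad ha hb))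
    ((lapL a b).comp (phiLin ha hb)) (DL a b Jet.x) lam 0
  rw [hd.fderiv]
  ext h
  rw [hd']
  simp

lemma F_add_le (ha : 0 < a) (hb : 0 < b) (lam R : ℝ) : ∃ C : ℝ, ∀ w : X a b, ‖w‖ ≤ R →
    ∀ h, ‖h‖ ≤ 1 → F lam (w + h) ≤ F lam w + fderiv ℝ (F lam) w h + C * ‖h‖ ^ 2 := by
  rw [F_eq_quartic ha hb]
  obtain ⟨C, hC⟩ := quartic_le (lapL a b)
    ((ContinuousLinearMap.compL ℝ (X a b) (X a b) (L2 a b) (lapL a b)).comp (phiQuad ha hb))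
    ((lapL a b).comp (phiLin ha hb)) (DL a b Jet.x) lam R
  refine ⟨C, fun w hw h hh => ?_⟩
  obtain ⟨d, hd, hd'⟩ := hasFDerivAt_quartic (lapL a b)
    ((ContinuousLinearMap.compL ℝ (X a b) (X a b) (L2 a b) (lapL a b)).comp (phiQuad ha hb))
    ((lapL a b).comp (phiLin ha hb)) (DL a b Jet.x) lam w
  rw [hd.fderiv, hd']
  exact hC w h hw hh

lemma continuous_E (ha : 0 < a) (hb : 0 < b) : Continuous (E : X a b → ℝ) := by
  have h := (contDiff_F ha hb 0 : ContDiff ℝ 1 (F 0 : X a b → ℝ)).continuous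
  have e : (F 0 : X a b → ℝ) = E := by ext w; rw [F, zero_mul, sub_zero]
  rwa [e] at h

lemma continuous_S (a b : ℝ) : Continuous (S : X a b → ℝ) := by
  have e : (S : X a b → ℝ) = fun w => 1 / 2 * ‖DL a b Jet.x w‖ ^ 2 := funext S_eq
  rw [e]
  fun_prop

lemma S_nonneg (w : X a b) : 0 ≤ S w := by rw [S_eq]; positivity

/-- The φ-term is nonnegative, so E alone dominates ½‖Δw‖². -/
lemma exists_norm_le_of_E_le (ha : 0 < a) (hb : 0 < b) (M : ℝ) :
    ∃ R, ∀ w : X a b, E w ≤ M → ‖w‖ ≤ R := by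
  obtain ⟨C, hC, h⟩ := exists_norm_le_lap ha hb
  refine ⟨C * √(2 * M), fun w hw => (h w).trans ?_⟩
  gcongr
  refine Real.le_sqrt_of_sq_le ?_
  rw [E_eq ha hb] at hw
  nlinarith [sq_nonneg ‖lapL a b (phiQuad ha hb w w + phiLin ha hb w)‖]

lemma exists_norm_le_normX (ha : 0 < a) (hb : 0 < b) :
    ∃ C > 0, ∀ w : X a b, ‖w‖ ≤ C * normX w := by
  obtain ⟨C, hC, h⟩ := exists_norm_le_lap ha hb
  refine ⟨C, hC, fun w => (h w).trans ?_⟩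
  gcongr
  rw [normX_eq ha hb]
  exact Real.le_sqrt_of_sq_le (by linarith [sq_nonneg ‖lapL a b (phiLin ha hb w)‖])

lemma exists_normX_le_norm (ha : 0 < a) (hb : 0 < b) :
    ∃ C, 0 ≤ C ∧ ∀ w : X a b, normX w ≤ C * ‖w‖ := by
  refine ⟨‖lapL a b‖ + ‖(lapL a b).comp (phiLin ha hb)‖, by positivity, fun w => ?_⟩
  have h1 := (lapL a b).le_opNorm w
  have h2 := ((lapL a b).comp (phiLin ha hb)).le_opNorm w
  rw [ContinuousLinearMap.comp_apply] at h2
  have h3 := norm_nonneg (lapL a b w)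
  have h4 := norm_nonneg (lapL a b (phiLin ha hb w))
  rw [normX_eq ha hb]
  refine (Real.sqrt_le_iff.2 ⟨add_nonneg h3 h4, ?_⟩).trans ?_
  · nlinarith
  · linarith

lemma mpLevel_E_S (w₂ : X a b) : mpLevel E S w₂ = c w₂ := rfl

end Potential

end VKD

/-! ### The bounded almost critical sequence -/

theorem lemma3p3 (a b : ℝ) (ha : 0 < a) (hb : 0 < b) (lam : ℝ) (hlam : lam ∈ Set.Ioo (0 : ℝ) 2)
    (w₂ : VKD.X a b) (hw₂ : VKD.F lam w₂ < 0) (hc : DifferentiableAt ℝ (VKD.c w₂) lam) :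
    ∃ w : ℕ → VKD.X a b,
      (∃ M : ℝ, ∀ n, VKD.normX (w n) ≤ M) ∧
      (∀ n, DifferentiableAt ℝ (VKD.F lam) (w n)) ∧
      (∃ δ : ℕ → ℝ, Tendsto δ atTop (𝓝 0) ∧
        ∀ n (v : VKD.X a b), |fderiv ℝ (VKD.F lam) (w n) v| ≤ δ n * VKD.normX v) ∧
      Tendsto (fun n => VKD.F lam (w n)) atTop (𝓝 (VKD.c w₂ lam)) ∧
      ∃ (γ : ℕ → Path (0 : VKD.X a b) w₂) (m : ℕ → ℝ),
        (∀ n, w n ∈ Set.range (γ n)) ∧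
        (∀ n, IsGreatest (Set.range fun t : unitInterval => VKD.F lam (γ n t)) (m n)) ∧
        Tendsto m atTop (𝓝 (VKD.c w₂ lam)) := by
  have hE := VKD.continuous_E ha hb
  have hS := VKD.continuous_S a b
  have hFc := (VKD.contDiff_F ha hb lam).continuous
  have hE0 : VKD.E (0 : VKD.X a b) = 0 := by rw [VKD.E_eq ha hb]; simp
  have hS0 : VKD.S (0 : VKD.X a b) = 0 := by rw [VKD.S_eq]; simp
  rw [← VKD.mpLevel_E_S] at hc ⊢
  obtain ⟨R, hR⟩ := VKD.exists_almost_critical hE hS VKD.S_nonneg hE0 hS0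
    (VKD.exists_norm_le_of_E_le ha hb) (VKD.contDiff_F ha hb lam) (VKD.fderiv_F_zero ha hb lam)
    (VKD.F_add_le ha hb lam) hw₂.le hc
  choose w γ hwR hdw hlev hmem hpath using fun n : ℕ =>
    hR (1 / ((n : ℝ) + 1)) Nat.one_div_pos_of_nat
  have hε : Tendsto (fun n : ℕ => 1 / ((n : ℝ) + 1)) atTop (𝓝 0) :=
    tendsto_one_div_add_atTop_nhds_zero_nat
  -- The abstract result is stated in the jet norm. The first comparison converts the bound on the
  -- derivative, the second the bound on the sequence.
  obtain ⟨C₁, hC₁, hle⟩ := VKD.exists_norm_le_normX ha hb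
  obtain ⟨C₂, hC₂, hge⟩ := VKD.exists_normX_le_norm ha hb
  have hmax : ∀ n, ∃ m, IsGreatest (Set.range fun t : unitInterval => VKD.F lam (γ n t)) m :=
    fun n => (isCompact_range (hFc.comp (γ n).continuous)).exists_isGreatest
      (Set.range_nonempty _)
  choose m hm using hmax
  refine ⟨w, ⟨C₂ * R, fun n => (hge _).trans (by gcongr; exact hwR n)⟩,
    fun n => (VKD.contDiff_F ha hb lam).differentiable (by simp) _,
    ⟨fun n => 1 / ((n : ℝ) + 1) * C₁, by simpa using hε.mul_const C₁, fun n v => ?_⟩, ?_,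
    γ, m, hmem, hm, ?_⟩
  · calc |fderiv ℝ (VKD.F lam) (w n) v| ≤ ‖fderiv ℝ (VKD.F lam) (w n)‖ * ‖v‖ :=
          (fderiv ℝ (VKD.F lam) (w n)).le_opNorm v
      _ ≤ 1 / ((n : ℝ) + 1) * (C₁ * VKD.normX v) := by
          gcongr
          · exact hdw n
          · exact hle v
      _ = 1 / ((n : ℝ) + 1) * C₁ * VKD.normX v := by ring
  · rw [tendsto_iff_dist_tendsto_zero]
    exact squeeze_zero (fun _ => dist_nonneg) hlev hε
  · have hup : Tendsto (fun n : ℕ => VKD.mpLevel VKD.E VKD.S w₂ lam + 1 / ((n : ℝ) + 1)) atTop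
        (𝓝 (VKD.mpLevel VKD.E VKD.S w₂ lam)) := by
      simpa using hε.const_add (VKD.mpLevel VKD.E VKD.S w₂ lam)
    -- The maximum along any admissible path is at least the infimum, and along `γ n` it exceeds it
    -- by at most 1/(n+1).
    refine tendsto_of_tendsto_of_tendsto_of_le_of_le tendsto_const_nhds hup (fun n => ?_)
      (fun n => ?_)
    · exact VKD.mpLevel_le hE hS (γ n) fun t => (hm n).2 ⟨t, rfl⟩
    · obtain ⟨t, ht⟩ := (hm n).1
      rw [← ht]
      exact hpath n t
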